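/- **Theorem AC (approximate controllability with respect to the leader).** Let $0<k<1-\frac1{\sqrt e}$, $\sigma>0$, $\Omega=(0,1)$, $Q=\Omega\times(0,T)$, and put $\alpha_k(t)=1+kt$, $\beta_k(y,t)=\frac{1-k^2y^2}{\alpha_k(t)}$, $\gamma_k(y)=-2ky$, $$Lv=-\Big[\frac{\beta_k(y,t)}{\alpha_k(t)}v_y\Big]_y+\frac{\gamma_k(y)}{\alpha_k(t)}v'_y .$$ Assume $T>\frac{2}{1-k}$. Fix $v_0\in L^2(\Omega)$, $v_1\in H^{-1}(\Omega)$ and $v_2\in L^2(Q)$. The leader and the follower both act on the whole side $\Sigma_1=\Sigma_2=\Sigma_0=\{0\}\times(0,T)$. For $w_1,w_2\in L^2(0,T)$ let $v=v(w_1,w_2)\in C([0,T];L^2(\Omega))\cap C^1([0,T];H^{-1}(\Omega))$ be the solution, in the sense of transposition, of $$v''+Lv=0\ \text{in }Q,\qquad v(0,t)=w_1(t)+w_2(t),\quad v(1,t)=0,\qquad v(0)=v_0,\ v'(0)=v_1,$$ that is, the initial conditions hold and, for all $\theta$ of class $C^2$ near $\overline Q$ with $\theta=0$ at $y=0$ and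 $y=1$ and $\theta(T)=\theta'(T)=0$, $$\int_0^T\!\!\int_\Omega v\,(\theta''+L^*\theta)\,dy\,dt=\langle v_1,\theta(0)\rangle-\int_\Omega v_0\Big(\theta'(0)+\Big[\frac{\gamma_k}{\alpha_k(0)}\theta(0)\Big]_y\Big)dy+\int_0^T\frac{w_1+w_2}{\alpha_k(t)^2}\,\theta_y(0,t)\,dt,$$ where $L^*\theta=-\big[\frac{\beta_k}{\alpha_k}\theta_y\big]_y+\big[\frac{\gamma_k}{\alpha_k}\theta\big]_{yt}$. A Nash equilibrium for $w_1$ is a $w_2\in L^2(0,T)$ that minimizes $$J_2(w_1,\cdot):\ w_2\mapsto\frac12\int_0^T\!\!\int_\Omega\alpha_k(t)\,[v(w_1,w_2)-v_2]^2\,dy\,dt+\frac\sigma2\int_0^T w_2^2\,dt$$ over $L^2(0,T)$. Then: 1. the boundary value problem has exactly one solution for every boundary control $w=w_1+w_2\in L^2(0,T)$; 2. for every $w_1\in L^2(0,T)$ there is exactly one Nash equilibrium $w_2=\mathfrak F(w_1)$; 3. the set $\{(v(T),v'(T)) : v=v(w_1,\mathfrak F(w_1)),\ w_1\in L^2(0,T)\}$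 is dense in $L^2(\Omega)\times H^{-1}(\Omega)$. -/

import Mathlib

open MeasureTheory Set Filter Topology
open scoped ContDiff

namespace MovingWave

noncomputable section

/-! ### The spaces `L²`, `H¹₀(0,1)` and `H⁻¹(0,1)` -/

/-- The real Hilbert space `L²(s)`, for Lebesgue measure on `s`. -/
abbrev L2 {X : Type*} [MeasureSpace X] (s : Set X) : Type _ :=
  Lp ℝ 2 ((volume : Measure X).restrict s)

/-- `L²(0,1)`. -/
abbrev L2Omega : Type := L2 (Ioo (0 : ℝ) 1)

/-- The Hilbert space `L²(0,1) × L²(0,1)`, which contains the pairs `(φ, φ')`, `φ ∈ H¹(0,1)`. -/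
abbrev L2Pair : Type := WithLp 2 (L2Omega × L2Omega)

/-- The pairs `(ψ, ψ')` with `ψ` a smooth function with compact support in `(0,1)`. -/
def testPairs : Set L2Pair :=
  {p | ∃ ψ : ℝ → ℝ, ContDiff ℝ ∞ ψ ∧ HasCompactSupport ψ ∧ tsupport ψ ⊆ Ioo 0 1 ∧
    p.fst =ᵐ[volume.restrict (Ioo 0 1)] ψ ∧ p.snd =ᵐ[volume.restrict (Ioo 0 1)] deriv ψ}

/-- `H¹₀(0,1)`, the closure of `C_c^∞(0,1)` in `H¹(0,1)`; a function `φ` is represented by the pair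
`(φ, φ')`, so that the norm is `(‖φ‖² + ‖φ'‖²)^{1/2}`. -/
def H10 : Submodule ℝ L2Pair := (Submodule.span ℝ testPairs).topologicalClosure

/-- `H⁻¹(0,1)`, the dual space of `H¹₀(0,1)` with the dual norm. -/
abbrev Hm1 : Type := StrongDual ℝ H10

/-- The embedding of `L²(0,1)` into `H⁻¹(0,1)`: the functional `φ ↦ ∫ f φ`. -/
def toHm1 (f : L2Omega) : Hm1 :=
  (innerSL ℝ f).comp ((WithLp.fstL 2 ℝ L2Omega L2Omega).comp H10.subtypeL)
theorem memLp_of_contOn {f : ℝ → ℝ} (hf : ContinuousOn f (Icc 0 1)) :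
    MemLp f 2 ((volume : Measure ℝ).restrict (Ioo 0 1)) := by
  obtain ⟨C, hC⟩ := isCompact_Icc.exists_bound_of_continuousOn hf
  refine MemLp.of_bound
    ((hf.mono Ioo_subset_Icc_self).aestronglyMeasurable measurableSet_Ioo) C ?_
  filter_upwards [ae_restrict_mem measurableSet_Ioo] with y hy using hC y (Ioo_subset_Icc_self hy)

theorem tendsto_eLpNorm_of_bounded {f : ℕ → ℝ → ℝ} {g : ℝ → ℝ} {C : ℝ}
    (hf : ∀ n, Continuous (f n)) (hg : ContinuousOn g (Icc 0 1))
    (hC : ∀ n, ∀ y ∈ Ioo (0 : ℝ) 1, |f n y| ≤ C)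
    (hlim : ∀ y ∈ Ioo (0 : ℝ) 1, Tendsto (fun n => f n y) atTop (𝓝 (g y))) :
    Tendsto (fun n => eLpNorm (f n - g) 2 ((volume : Measure ℝ).restrict (Ioo 0 1)))
      atTop (𝓝 0) := by
  refine tendsto_Lp_finite_of_tendsto_ae one_le_two ENNReal.ofNat_ne_top
    (fun n => (hf n).aestronglyMeasurable) (memLp_of_contOn hg) ?_ ?_
  · refine unifIntegrable_of one_le_two ENNReal.ofNat_ne_top
      (fun n => (hf n).aestronglyMeasurable) fun ε _ => ⟨(|C| + 1).toNNReal, fun n => ?_⟩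
    rw [eLpNorm_congr_ae (g := fun _ => (0 : ℝ))]
    · simp
    · filter_upwards [ae_restrict_mem measurableSet_Ioo] with y hy
      apply indicator_of_notMem
      simp only [mem_ofPred_eq, not_le]
      rw [← NNReal.coe_lt_coe, Real.coe_toNNReal _ (by positivity), coe_nnnorm, Real.norm_eq_abs]
      have := hC n y hy
      have := le_abs_self C
      linarith
  · filter_upwards [ae_restrict_mem measurableSet_Ioo] with y hy using hlim y hy

/-- The pair `(φ, φ')` for a function `φ` that is `C¹` on `[0,1]`. -/
def pairOf (φ : ℝ → ℝ) (h₀ : ContinuousOn φ (Icc 0 1)) (h₁ : ContinuousOn (deriv φ) (Icc 0 1)) :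
    L2Pair :=
  WithLp.toLp 2 ((memLp_of_contOn h₀).toLp φ, (memLp_of_contOn h₁).toLp (deriv φ))

theorem pairOf_mem_of_approx {φ : ℝ → ℝ} (h₀ : ContinuousOn φ (Icc 0 1))
    (h₁ : ContinuousOn (deriv φ) (Icc 0 1)) (ψ : ℕ → ℝ → ℝ) (hψ : ∀ n, ContDiff ℝ ∞ (ψ n))
    (hmem : ∀ n, pairOf (ψ n) (hψ n).continuous.continuousOn
      ((hψ n).continuous_deriv (by simp)).continuousOn ∈ H10)
    (C : ℝ) (hC : ∀ n, ∀ y ∈ Ioo (0 : ℝ) 1, |ψ n y| ≤ C)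
    (hC' : ∀ n, ∀ y ∈ Ioo (0 : ℝ) 1, |deriv (ψ n) y| ≤ C)
    (hlim : ∀ y ∈ Ioo (0 : ℝ) 1, Tendsto (fun n => ψ n y) atTop (𝓝 (φ y)))
    (hlim' : ∀ y ∈ Ioo (0 : ℝ) 1, Tendsto (fun n => deriv (ψ n) y) atTop (𝓝 (deriv φ y))) :
    pairOf φ h₀ h₁ ∈ H10 := by
  refine (Submodule.isClosed_topologicalClosure _).mem_of_tendsto (b := atTop) ?_
    (Eventually.of_forall hmem)
  refine ((WithLp.prod_continuous_toLp 2 L2Omega L2Omega).tendsto _).comp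
    (Tendsto.prodMk_nhds ?_ ?_)
  · rw [Lp.tendsto_Lp_iff_tendsto_eLpNorm'']
    exact tendsto_eLpNorm_of_bounded (fun n => (hψ n).continuous) h₀ hC hlim
  · rw [Lp.tendsto_Lp_iff_tendsto_eLpNorm'']
    exact tendsto_eLpNorm_of_bounded (fun n => (hψ n).continuous_deriv (by simp)) h₁ hC' hlim'

theorem pairOf_mem_of_test {ψ : ℝ → ℝ} (h : ContDiff ℝ ∞ ψ) (hs : tsupport ψ ⊆ Ioo 0 1) :
    pairOf ψ h.continuous.continuousOn (h.continuous_deriv (by simp)).continuousOn ∈ H10 :=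
  Submodule.le_topologicalClosure _ (Submodule.subset_span
    ⟨ψ, h, HasCompactSupport.of_support_subset_isCompact (isCompact_Icc (a := 0) (b := 1))
      ((subset_tsupport _).trans (hs.trans Ioo_subset_Icc_self)), hs,
      MemLp.coeFn_toLp (memLp_of_contOn h.continuous.continuousOn),
      MemLp.coeFn_toLp (memLp_of_contOn (h.continuous_deriv (by simp)).continuousOn)⟩)

theorem exists_bound_deriv_smoothTransition : ∃ M : ℝ, ∀ x, |deriv Real.smoothTransition x| ≤ M ∧
    (x < 0 ∨ 1 < x → deriv Real.smoothTransition x = 0) := by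
  have hz : ∀ x : ℝ, x < 0 ∨ 1 < x → deriv Real.smoothTransition x = 0 := by
    rintro x (hx | hx)
    · have : Real.smoothTransition =ᶠ[𝓝 x] fun _ => (0 : ℝ) := by
        filter_upwards [Iio_mem_nhds hx] with y hy
          using Real.smoothTransition.zero_of_nonpos (le_of_lt hy)
      rw [this.deriv_eq]; simp
    · have : Real.smoothTransition =ᶠ[𝓝 x] fun _ => (1 : ℝ) := by
        filter_upwards [Ioi_mem_nhds hx] with y hy
          using Real.smoothTransition.one_of_one_le (le_of_lt hy)
      rw [this.deriv_eq]; simp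
  have hc : Continuous (deriv Real.smoothTransition) :=
    (Real.smoothTransition.contDiff (n := 1)).continuous_deriv (by simp)
  obtain ⟨M, hM⟩ := (isCompact_Icc (a := (0 : ℝ)) (b := 1)).exists_bound_of_continuousOn
    hc.continuousOn
  refine ⟨max M 0, fun x => ⟨?_, hz x⟩⟩
  by_cases hx : x ∈ Icc (0 : ℝ) 1
  · exact le_max_of_le_left (hM x hx)
  · rw [hz x (by
      by_contra hcon
      push Not at hcon
      exact hx hcon)]; simp

theorem pairOf_mem_of_smooth {P : ℝ → ℝ} (hP : ContDiff ℝ ∞ P) (h0 : P 0 = 0) (h1 : P 1 = 0) :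
    pairOf P hP.continuous.continuousOn (hP.continuous_deriv (by simp)).continuousOn ∈ H10 := by
  obtain ⟨M, hM⟩ := exists_bound_deriv_smoothTransition
  have hM0 : 0 ≤ M := (abs_nonneg _).trans (hM 0).1
  have hPd : ∀ y, HasDerivAt P (deriv P y) y := fun y =>
    (hP.differentiable (by simp)).differentiableAt.hasDerivAt
  obtain ⟨A, hA⟩ := (isCompact_Icc (a := (0 : ℝ)) (b := 1)).exists_bound_of_continuousOn
    hP.continuous.continuousOn
  obtain ⟨B, hB⟩ := (isCompact_Icc (a := (0 : ℝ)) (b := 1)).exists_bound_of_continuousOn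
    (hP.continuous_deriv (by simp)).continuousOn
  have hA0 : 0 ≤ A := (norm_nonneg _).trans (hA 0 (by simp))
  have hB0 : 0 ≤ B := (norm_nonneg _).trans (hB 0 (by simp))
  have hlip : ∀ x ∈ Icc (0 : ℝ) 1, ∀ y ∈ Icc (0 : ℝ) 1, |P y - P x| ≤ B * |y - x| := by
    intro x hx y hy
    exact (convex_Icc (0 : ℝ) 1).norm_image_sub_le_of_norm_deriv_le
      (fun z _ => (hPd z).differentiableAt) hB hx hy
  let S := Real.smoothTransition
  have hS : ∀ x, |S x| ≤ 1 := fun x => by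
    rw [abs_of_nonneg (Real.smoothTransition.nonneg x)]; exact Real.smoothTransition.le_one x
  have hSd : ∀ x, HasDerivAt S (deriv S x) x := fun x =>
    ((Real.smoothTransition.contDiff (n := 1)).differentiable (by simp)).differentiableAt.hasDerivAt
  let ψ : ℕ → ℝ → ℝ := fun n y => S ((n + 1) * y - 1) * S ((n + 1) * (1 - y) - 1) * P y
  have hSc : ContDiff ℝ ∞ S := Real.smoothTransition.contDiff
  have hψ : ∀ n, ContDiff ℝ ∞ (ψ n) := fun n =>
    ((hSc.comp ((contDiff_const.mul contDiff_id).sub contDiff_const)).mul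
      (hSc.comp ((contDiff_const.mul (contDiff_const.sub contDiff_id)).sub contDiff_const))).mul hP
  have hψd : ∀ (n : ℕ) y, deriv (ψ n) y =
      (n + 1) * deriv S ((n + 1) * y - 1) * P y * S ((n + 1) * (1 - y) - 1)
      - (n + 1) * deriv S ((n + 1) * (1 - y) - 1) * P y * S ((n + 1) * y - 1)
      + S ((n + 1) * y - 1) * S ((n + 1) * (1 - y) - 1) * deriv P y := by
    intro n y
    have e1 : HasDerivAt (fun y : ℝ => ((n : ℝ) + 1) * y - 1) ((n : ℝ) + 1) y := by
      simpa using ((hasDerivAt_id y).const_mul ((n : ℝ) + 1)).sub_const 1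
    have e2 : HasDerivAt (fun y : ℝ => ((n : ℝ) + 1) * (1 - y) - 1) (-((n : ℝ) + 1)) y := by
      simpa using (((hasDerivAt_id y).const_sub 1).const_mul ((n : ℝ) + 1)).sub_const 1
    have := (((hSd _).comp y e1).mul ((hSd _).comp y e2)).mul (hPd y)
    refine this.deriv.trans ?_
    simp only [Function.comp, Pi.mul_apply]
    ring
  have hev : ∀ y ∈ Ioo (0 : ℝ) 1, ∀ᶠ n : ℕ in atTop,
      1 < ((n : ℝ) + 1) * y - 1 ∧ 1 < ((n : ℝ) + 1) * (1 - y) - 1 := by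
    intro y hy
    obtain ⟨N, hN⟩ := exists_nat_gt (2 / y)
    obtain ⟨K, hK⟩ := exists_nat_gt (2 / (1 - y))
    filter_upwards [eventually_ge_atTop N, eventually_ge_atTop K] with n hn hk
    have hy1 : 0 < 1 - y := by linarith [hy.2]
    rw [div_lt_iff₀ hy.1] at hN
    rw [div_lt_iff₀ hy1] at hK
    have hn' : (N : ℝ) ≤ n := by exact_mod_cast hn
    have hk' : (K : ℝ) ≤ n := by exact_mod_cast hk
    constructor <;> nlinarith [hy.1]
  refine pairOf_mem_of_approx _ _ ψ hψ (fun n => pairOf_mem_of_test (hψ n) ?_)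
    (max A (2 * M * B + 2 * M * B + B)) ?_ ?_ ?_ ?_
  · have hn : (0 : ℝ) < n + 1 := by positivity
    have hsub : tsupport (ψ n) ⊆ Icc (1 / ((n : ℝ) + 1)) (1 - 1 / ((n : ℝ) + 1)) := by
      refine closure_minimal (fun y hy => ?_) isClosed_Icc
      by_contra hcon
      rw [mem_Icc, not_and_or, not_le, not_le] at hcon
      apply hy
      rcases hcon with h | h
      · have : S (((n : ℝ) + 1) * y - 1) = 0 := Real.smoothTransition.zero_of_nonpos (by
          rw [lt_div_iff₀ hn] at h; linarith)
        simp [ψ, this]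
      · have : S (((n : ℝ) + 1) * (1 - y) - 1) = 0 := Real.smoothTransition.zero_of_nonpos (by
          have h' : 1 - y < 1 / ((n : ℝ) + 1) := by linarith
          rw [lt_div_iff₀ hn] at h'; linarith)
        simp [ψ, this]
    refine hsub.trans fun y hy => ?_
    have : 0 < 1 / ((n : ℝ) + 1) := by positivity
    exact ⟨by linarith [hy.1], by linarith [hy.2]⟩
  · intro n y hy
    refine le_max_of_le_left ?_
    have h := hA y (Ioo_subset_Icc_self hy)
    rw [Real.norm_eq_abs] at h
    calc |ψ n y| = |S (((n : ℝ) + 1) * y - 1)| * |S (((n : ℝ) + 1) * (1 - y) - 1)| * |P y| := by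
          simp only [ψ, abs_mul]
      _ ≤ 1 * 1 * A := by gcongr <;> apply hS
      _ = A := by ring
  · intro n y hy
    refine le_max_of_le_right ?_
    have hn : (0 : ℝ) < n + 1 := by positivity
    have key : ∀ d z : ℝ, 0 < z → |P y| ≤ B * z → d = deriv S (((n : ℝ) + 1) * z - 1) →
        |((n : ℝ) + 1) * d * P y| ≤ 2 * M * B := by
      rintro d z hz hPz rfl
      by_cases hzz : ((n : ℝ) + 1) * z - 1 ≤ 1
      · rw [abs_mul, abs_mul, abs_of_pos hn]
        calc ((n : ℝ) + 1) * |deriv S (((n : ℝ) + 1) * z - 1)| * |P y|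
            ≤ ((n : ℝ) + 1) * M * (B * z) := by gcongr; exact (hM _).1
          _ = (((n : ℝ) + 1) * z) * (M * B) := by ring
          _ ≤ 2 * (M * B) := by gcongr; linarith
          _ = _ := by ring
      · rw [show deriv S (((n : ℝ) + 1) * z - 1) = 0 from (hM _).2 (Or.inr (not_le.1 hzz))]
        simp only [mul_zero, zero_mul, abs_zero]; positivity
    have k1 := key _ y hy.1 (by
      have := hlip 0 (by simp) y (Ioo_subset_Icc_self hy)
      rwa [h0, sub_zero, sub_zero, abs_of_pos hy.1] at this) rfl
    have k2 := key _ (1 - y) (by linarith [hy.2]) (by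
      have := hlip 1 (by simp) y (Ioo_subset_Icc_self hy)
      rwa [h1, sub_zero, abs_sub_comm y 1, abs_of_pos (a := 1 - y) (by linarith [hy.2])] at this) rfl
    have h3 := hB y (Ioo_subset_Icc_self hy)
    rw [Real.norm_eq_abs] at h3
    rw [hψd]
    refine (abs_add_le _ _).trans (add_le_add ((abs_sub _ _).trans (add_le_add ?_ ?_)) ?_)
    · rw [abs_mul]; exact (mul_le_of_le_one_right (abs_nonneg _) (hS _)).trans k1
    · rw [abs_mul]; exact (mul_le_of_le_one_right (abs_nonneg _) (hS _)).trans k2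
    · rw [abs_mul, abs_mul]
      calc _ ≤ 1 * 1 * B := by gcongr <;> apply hS
        _ = B := by ring
  · intro y hy
    refine tendsto_const_nhds.congr' ?_
    filter_upwards [hev y hy] with n hn
    simp [ψ, S, Real.smoothTransition.one_of_one_le hn.1.le,
      Real.smoothTransition.one_of_one_le hn.2.le]
  · intro y hy
    refine tendsto_const_nhds.congr' ?_
    filter_upwards [hev y hy] with n hn
    rw [hψd n y, show deriv S (((n : ℝ) + 1) * y - 1) = 0 from (hM _).2 (Or.inr hn.1),
      show deriv S (((n : ℝ) + 1) * (1 - y) - 1) = 0 from (hM _).2 (Or.inr hn.2)]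
    simp [S, Real.smoothTransition.one_of_one_le hn.1.le,
      Real.smoothTransition.one_of_one_le hn.2.le]

theorem pairOf_mem {φ : ℝ → ℝ} (hφ : ∀ y ∈ Icc (0 : ℝ) 1, ContDiffAt ℝ 1 φ y)
    (h0 : φ 0 = 0) (h1 : φ 1 = 0) (hc : ContinuousOn φ (Icc 0 1))
    (hc' : ContinuousOn (deriv φ) (Icc 0 1)) : pairOf φ hc hc' ∈ H10 := by
  have hφd : ∀ y ∈ Icc (0 : ℝ) 1, HasDerivAt φ (deriv φ y) y := fun y hy =>
    ((hφ y hy).differentiableAt (by simp)).hasDerivAt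
  have hpoly : ∀ n : ℕ, ∃ p : Polynomial ℝ, ∀ y ∈ Icc (0 : ℝ) 1,
      |p.eval y - deriv φ y| < 1 / ((n : ℝ) + 1) := fun n =>
    exists_polynomial_near_of_continuousOn 0 1 (deriv φ) hc' _ (by positivity)
  choose p hp using hpoly
  let I : ℕ → ℝ → ℝ := fun n y => ∫ z in (0 : ℝ)..y, (p n).eval z
  have hId : ∀ n y, HasDerivAt (I n) ((p n).eval y) y := fun n y =>
    (p n).continuous.integral_hasStrictDerivAt 0 y |>.hasDerivAt
  let P : ℕ → ℝ → ℝ := fun n y => I n y - y * I n 1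
  have hPd : ∀ n y, HasDerivAt (P n) ((p n).eval y - I n 1) y := fun n y => by
    have := (hId n y).sub ((hasDerivAt_id y).mul_const (I n 1))
    rw [one_mul] at this
    exact this
  have hPderiv : ∀ n, deriv (P n) = fun y => (p n).eval y - I n 1 := fun n =>
    funext fun y => (hPd n y).deriv
  have hPs : ∀ n, ContDiff ℝ ∞ (P n) := fun n => by
    rw [contDiff_infty_iff_deriv]
    refine ⟨fun y => (hPd n y).differentiableAt, ?_⟩
    rw [hPderiv]
    exact ((p n).contDiff_aeval (𝕜 := ℝ) ∞).sub contDiff_const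
  have hIe : ∀ n, ∀ y ∈ Icc (0 : ℝ) 1, |I n y - φ y| ≤ 1 / ((n : ℝ) + 1) := by
    intro n y hy
    have := (convex_Icc (0 : ℝ) 1).norm_image_sub_le_of_norm_hasDerivWithin_le
      (f := fun y => I n y - φ y)
      (fun z hz => ((hId n z).sub (hφd z hz)).hasDerivWithinAt) (C := 1 / ((n : ℝ) + 1))
      (fun z hz => (hp n z hz).le) (x := 0) (by simp) hy
    simp only [I, intervalIntegral.integral_same, h0, sub_zero, Real.norm_eq_abs] at this
    refine this.trans (mul_le_of_le_one_right (by positivity) ?_)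
    rw [abs_of_nonneg hy.1]; exact hy.2
  have hI1 : ∀ n, |I n 1| ≤ 1 / ((n : ℝ) + 1) := fun n => by
    simpa [h1] using hIe n 1 (by simp)
  have e0 : ∀ n, ∀ y ∈ Icc (0 : ℝ) 1, |P n y - φ y| ≤ 2 * (1 / ((n : ℝ) + 1)) := by
    intro n y hy
    have : P n y - φ y = (I n y - φ y) - y * I n 1 := by simp only [P]; ring
    rw [this]
    refine (abs_sub _ _).trans ?_
    rw [two_mul]
    refine add_le_add (hIe n y hy) ?_
    rw [abs_mul, abs_of_nonneg hy.1]
    exact (mul_le_of_le_one_left (abs_nonneg _) hy.2).trans (hI1 n)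
  have e1 : ∀ n, ∀ y ∈ Icc (0 : ℝ) 1, |deriv (P n) y - deriv φ y| ≤ 2 * (1 / ((n : ℝ) + 1)) := by
    intro n y hy
    have : deriv (P n) y - deriv φ y = ((p n).eval y - deriv φ y) - I n 1 := by
      rw [hPderiv]; ring
    rw [this]
    refine (abs_sub _ _).trans ?_
    rw [two_mul]
    exact add_le_add (hp n y hy).le (hI1 n)
  have hlim : Tendsto (fun n : ℕ => 2 * (1 / ((n : ℝ) + 1))) atTop (𝓝 0) := by
    simpa using (tendsto_one_div_add_atTop_nhds_zero_nat (𝕜 := ℝ)).const_mul 2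
  obtain ⟨A, hA⟩ := (isCompact_Icc (a := (0 : ℝ)) (b := 1)).exists_bound_of_continuousOn hc
  obtain ⟨B, hB⟩ := (isCompact_Icc (a := (0 : ℝ)) (b := 1)).exists_bound_of_continuousOn hc'
  have hle : ∀ n : ℕ, 2 * (1 / ((n : ℝ) + 1)) ≤ 2 := fun n => by
    have : 1 / ((n : ℝ) + 1) ≤ 1 := by
      rw [div_le_one (by positivity)]; linarith [(Nat.cast_nonneg n : (0 : ℝ) ≤ n)]
    linarith
  refine pairOf_mem_of_approx _ _ P hPs (fun n => pairOf_mem_of_smooth (hPs n) (by simp [P, I])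
    (by simp [P])) (max (A + 2) (B + 2)) ?_ ?_ ?_ ?_
  · intro n y hy
    have hy' := Ioo_subset_Icc_self hy
    refine le_max_of_le_left ?_
    have h1 := hA y hy'
    rw [Real.norm_eq_abs] at h1
    have := abs_sub_abs_le_abs_sub (P n y) (φ y)
    linarith [e0 n y hy', hle n]
  · intro n y hy
    have hy' := Ioo_subset_Icc_self hy
    refine le_max_of_le_right ?_
    have h1 := hB y hy'
    rw [Real.norm_eq_abs] at h1
    have := abs_sub_abs_le_abs_sub (deriv (P n) y) (deriv φ y)
    linarith [e1 n y hy', hle n]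
  · intro y hy
    exact tendsto_iff_norm_sub_tendsto_zero.2 (squeeze_zero (fun _ => norm_nonneg _)
      (fun n => e0 n y (Ioo_subset_Icc_self hy)) hlim)
  · intro y hy
    exact tendsto_iff_norm_sub_tendsto_zero.2 (squeeze_zero (fun _ => norm_nonneg _)
      (fun n => e1 n y (Ioo_subset_Icc_self hy)) hlim)

/-! ### The transformed wave equation -/

/-- `α_k(t) = 1 + k t`. -/
def alpha (k t : ℝ) : ℝ := 1 + k * t

/-- `β_k(y,t) = (1 - k² y²) / α_k(t)`. -/
def beta (k y t : ℝ) : ℝ := (1 - k ^ 2 * y ^ 2) / alpha k t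

/-- `γ_k(y) = -2 k y`. -/
def gamma (k y : ℝ) : ℝ := -2 * k * y

/-- Partial derivative in `y` of a function of `(y,t)`. -/
def dy (θ : ℝ → ℝ → ℝ) : ℝ → ℝ → ℝ := fun y t => deriv (fun z => θ z t) y

/-- Partial derivative in `t` of a function of `(y,t)`. -/
def dt (θ : ℝ → ℝ → ℝ) : ℝ → ℝ → ℝ := fun y t => deriv (fun s => θ y s) t

/-- The formal adjoint `L* θ = -[(β_k/α_k) θ_y]_y + [(γ_k/α_k) θ]_{yt}` of the operator
`L v = -[(β_k/α_k) v_y]_y + (γ_k/α_k) v'_y`. -/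
def adjointL (k : ℝ) (θ : ℝ → ℝ → ℝ) : ℝ → ℝ → ℝ := fun y t =>
  -dy (fun y t => beta k y t / alpha k t * dy θ y t) y t
    + dt (dy (fun y t => gamma k y / alpha k t * θ y t)) y t

/-- The test functions of the transposition method: functions `θ(y,t)`, of class `C²` on (a
neighbourhood of) the closed rectangle `[0,1] × [0,T]`, with `θ = 0` on the lateral boundary and
`θ(T) = θ'(T) = 0`. -/
structure AdjointTest (T : ℝ) where
  toFun : ℝ → ℝ → ℝ
  smooth : ∀ y ∈ Icc (0 : ℝ) 1, ∀ t ∈ Icc 0 T,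
    ContDiffAt ℝ 2 (fun p : ℝ × ℝ => toFun p.1 p.2) (y, t)
  left : ∀ t ∈ Icc 0 T, toFun 0 t = 0
  right : ∀ t ∈ Icc 0 T, toFun 1 t = 0
  final : ∀ y ∈ Icc (0 : ℝ) 1, toFun y T = 0
  final_deriv : ∀ y ∈ Icc (0 : ℝ) 1, dt toFun y T = 0

namespace AdjointTest

variable {T : ℝ}

theorem contDiffAt_initial (θ : AdjointTest T) (hT : 0 < T) :
    ∀ y ∈ Icc (0 : ℝ) 1, ContDiffAt ℝ 1 (fun z => θ.toFun z 0) y := fun y hy =>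
  ((θ.smooth y hy 0 ⟨le_rfl, hT.le⟩).of_le (by norm_num)).comp (f := fun z : ℝ => (z, (0 : ℝ))) y
    (contDiffAt_id.prodMk contDiffAt_const)

theorem continuousOn_initial (θ : AdjointTest T) (hT : 0 < T) :
    ContinuousOn (fun z => θ.toFun z 0) (Icc 0 1) := fun y hy =>
  (θ.contDiffAt_initial hT y hy).continuousAt.continuousWithinAt

theorem continuousOn_deriv_initial (θ : AdjointTest T) (hT : 0 < T) :
    ContinuousOn (deriv fun z => θ.toFun z 0) (Icc 0 1) := fun y hy =>
  (((θ.contDiffAt_initial hT y hy).fderiv_right (m := 0) (by norm_num)).continuousAt.clm_apply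
    (continuousAt_const (y := (1 : ℝ)))).continuousWithinAt

/-- The initial value `θ(0)`, an element of `H¹₀(0,1)`. -/
def initial (θ : AdjointTest T) (hT : 0 < T) : H10 :=
  ⟨pairOf (fun z => θ.toFun z 0) (θ.continuousOn_initial hT) (θ.continuousOn_deriv_initial hT),
    pairOf_mem (θ.contDiffAt_initial hT) (θ.left 0 ⟨le_rfl, hT.le⟩) (θ.right 0 ⟨le_rfl, hT.le⟩)
      _ _⟩

end AdjointTest

/-- `v ∈ C([0,T]; L²(0,1)) ∩ C¹([0,T]; H⁻¹(0,1))`, with time derivative `vt = v'`, is the solution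
in the sense of transposition of `v'' + L v = 0` in `(0,1) × (0,T)`, `v(0,t) = w(t)`, `v(1,t) = 0`,
`v(0) = v₀`, `v'(0) = v₁`. -/
structure IsSolution (k : ℝ) {T : ℝ} (hT : 0 < T) (v₀ : L2Omega) (v₁ : Hm1) (w : L2 (Ioo 0 T))
    (v : ℝ → L2Omega) (vt : ℝ → Hm1) : Prop where
  continuousOn : ContinuousOn v (Icc 0 T)
  hasDeriv : ∀ t ∈ Icc 0 T, HasDerivWithinAt (fun s => toHm1 (v s)) (vt t) (Icc 0 T) t
  continuousOn_deriv : ContinuousOn vt (Icc 0 T)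
  initial : v 0 = v₀
  initial_deriv : vt 0 = v₁
  transposition : ∀ θ : AdjointTest T,
    (∫ t in Ioo 0 T, ∫ y in Ioo (0 : ℝ) 1,
        v t y * (dt (dt θ.toFun) y t + adjointL k θ.toFun y t)) =
      v₁ (θ.initial hT)
        - (∫ y in Ioo (0 : ℝ) 1,
            v₀ y * (dt θ.toFun y 0 + dy (fun y t => gamma k y / alpha k t * θ.toFun y t) y 0))
        + (∫ t in Ioo 0 T, w t * (1 / alpha k t ^ 2 * dy θ.toFun 0 t))

/-- The cost `J₂` of the follower, for the state `v` and the follower control `w₂`. -/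
def cost (k σ : ℝ) {T : ℝ} (v₂ : L2 (Ioo (0 : ℝ) 1 ×ˢ Ioo 0 T)) (v : ℝ → L2Omega)
    (w₂ : L2 (Ioo 0 T)) : ℝ :=
  1 / 2 * (∫ t in Ioo 0 T, ∫ y in Ioo (0 : ℝ) 1, alpha k t * (v t y - v₂ (y, t)) ^ 2)
    + σ / 2 * (∫ t in Ioo 0 T, w₂ t ^ 2)

/-- `w₂` is a Nash equilibrium for the leader `w₁`: it minimizes `J₂(w₁, ·)` over `L²(Σ₂)`. Here
`Σ₁ = Σ₂ = Σ₀` and the boundary control is `w = w₁ + w₂`. -/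
def IsNash (k σ : ℝ) {T : ℝ} (hT : 0 < T) (v₀ : L2Omega) (v₁ : Hm1)
    (v₂ : L2 (Ioo (0 : ℝ) 1 ×ˢ Ioo 0 T)) (w₁ w₂ : L2 (Ioo 0 T)) : Prop :=
  ∃ v vt, IsSolution k hT v₀ v₁ (w₁ + w₂) v vt ∧
    ∀ (u₂ : L2 (Ioo 0 T)) (z : ℝ → L2Omega) (zt : ℝ → Hm1),
      IsSolution k hT v₀ v₁ (w₁ + u₂) z zt → cost k σ v₂ v w₂ ≤ cost k σ v₂ z u₂

end

end MovingWave

namespace MovingWave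

noncomputable section

/-! ### Weighted composition operators on `L²` -/

/-! In the variables ξ = α(1 + ky), η = α(1 - ky), with α = 1 + kt, the equation is the plain wave
equation of the moving domain 0 < x < 1 + kt. Its solutions are v = P(ξ) + Q(η) with profiles P, Q
in L²(ℝ). The side y = 0 is the line ξ = η and the side y = 1 is the line ξ = λη with λ =
(1+k)/(1-k), where the boundary condition reads P(s) = -Q(s/λ). Existence and controllability become
a matter of which intervals of the real line carry which data.

Existence. Two profiles whose traces cancel at y = 1 give a solution in the sense of transposition
(`isSolution_of_profiles`): by Green's formula for smooth profiles, and by density for all, because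
every term is continuous in the profile. Poincaré's inequality and Lax–Milgram write each element of
H⁻¹ as φ ↦ ∫ U φ', so every initial state splits into two initial profiles
(`exists_state_profiles`). The boundary control then yields a fixed point equation for Q whose
operator is nilpotent, since finitely many reflections fit into (0,T) (`exists_profiles`).

Uniqueness. On products αA(ξ)B(η) the adjoint operator acts as 4k²αA'(ξ)B'(η) (`adjointOp_product`).
Summing signed reflections of such a product, with primitives that vanish far to the right, gives an
admissible test function whose image is a single bump in the characteristic coordinates
(`exists_test`). Sums of bumps approximate every continuous function with compact support in the
region, so a difference of two solutions is orthogonal to all of these and vanishes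
(`eq_zero_of_transposition`).

Equilibrium. The weighted state depends affinely on the boundary control w = w₁ + w₂, so the
follower minimizes ½‖c + K(w₁ + w₂)‖² + (σ/2)‖w₂‖². The minimizer is the only solution of K*(c + Kw₁
+ Kw₂) + σw₂ = 0 (`exists_isNash_iff`).

Controllability. This equation involves w₁ only through the sum w. For any w, the choice w₂ =
-σ⁻¹K*(c + Kw), w₁ = w - w₂ makes w₂ the equilibrium for w₁, so the leader can bring about every
boundary control. It remains to steer the wave equation exactly (`exists_control`). For T > 2/(1-k)
the intervals on which the initial and the final state prescribe Q are disjoint, and the control is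
read off as the trace at y = 0. The reachable set is the whole space, and in particular dense. -/

/-- The hypotheses under which `f ↦ m · (f ∘ Φ)` is bounded from `L²(ν)` to `L²(μ)`. -/
structure WBdd {X Y : Type*} [MeasurableSpace X] [MeasurableSpace Y] (m : X → ℝ) (Φ : X → Y)
    (μ : Measure X) (ν : Measure Y) (C c : NNReal) : Prop where
  meas_weight : Measurable m
  meas_map : Measurable Φ
  bound : ∀ᵐ x ∂μ, ‖m x‖₊ ≤ C
  -- Only the set where the weight is nonzero is transported. With an indicator as weight, `Φ` may
  -- leave the region that carries `ν` elsewhere.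
  map_le : (μ.restrict {x | m x ≠ 0}).map Φ ≤ c • ν

section WComp

variable {X Y : Type*} [MeasurableSpace X] [MeasurableSpace Y] {m : X → ℝ} {Φ : X → Y}
  {μ : Measure X} {ν : Measure Y} {C c : NNReal}

theorem WBdd.measurableSet (h : WBdd m Φ μ ν C c) : MeasurableSet {x | m x ≠ 0} :=
  h.meas_weight (measurableSet_singleton 0).compl

theorem WBdd.ae_comp (h : WBdd m Φ μ ν C c) {p : Y → Prop} (hp : ∀ᵐ y ∂ν, p y) :
    ∀ᵐ x ∂μ, m x ≠ 0 → p (Φ x) := by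
  have h1 : ∀ᵐ y ∂((μ.restrict {x | m x ≠ 0}).map Φ), p y :=
    (Measure.absolutelyContinuous_of_le_smul h.map_le).ae_le hp
  have h2 := ae_of_ae_map h.meas_map.aemeasurable h1
  rwa [ae_restrict_iff' h.measurableSet] at h2

theorem WBdd.congr (h : WBdd m Φ μ ν C c) {f g : Y → ℝ} (hfg : f =ᵐ[ν] g) :
    (fun x => m x * f (Φ x)) =ᵐ[μ] fun x => m x * g (Φ x) := by
  filter_upwards [h.ae_comp hfg] with x hx
  by_cases h0 : m x = 0
  · simp [h0]
  · rw [hx h0]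

/-- The weight costs its supremum `C`, and the change of variables costs the square root of the
density bound `c`. -/
theorem WBdd.eLpNorm_le (h : WBdd m Φ μ ν C c) {f : Y → ℝ} (hf : StronglyMeasurable f) :
    eLpNorm (fun x => m x * f (Φ x)) 2 μ ≤ C * (c : ENNReal) ^ (1 / 2 : ℝ) * eLpNorm f 2 ν := by
  have hS := h.measurableSet
  have e1 : (fun x => m x * f (Φ x)) = indicator {x | m x ≠ 0} (fun x => m x * f (Φ x)) := by
    ext x
    by_cases h0 : m x = 0
    · simp [h0]
    · rw [indicator_of_mem (by exact h0)]
  rw [e1, eLpNorm_indicator_eq_eLpNorm_restrict hS]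
  have e2 : eLpNorm (fun x => m x * f (Φ x)) 2 (μ.restrict {x | m x ≠ 0}) ≤
      C • eLpNorm (fun x => f (Φ x)) 2 (μ.restrict {x | m x ≠ 0}) := by
    refine eLpNorm_le_nnreal_smul_eLpNorm_of_ae_le_mul ?_ 2
    filter_upwards [ae_restrict_of_ae h.bound] with x hx
    rw [nnnorm_mul]
    gcongr
  refine e2.trans ?_
  have e3 : eLpNorm (fun x => f (Φ x)) 2 (μ.restrict {x | m x ≠ 0}) =
      eLpNorm f 2 ((μ.restrict {x | m x ≠ 0}).map Φ) :=
    (eLpNorm_map_measure hf.aestronglyMeasurable h.meas_map.aemeasurable).symm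
  rw [e3, ENNReal.smul_def, smul_eq_mul, mul_assoc]
  gcongr
  refine (eLpNorm_mono_measure f h.map_le).trans ?_
  by_cases hc : c = 0
  · simp [hc]
  rw [show (c • ν : Measure Y) = (c : ENNReal) • ν from rfl,
    eLpNorm_smul_measure_of_ne_zero (by exact_mod_cast hc)]
  simp

theorem WBdd.memLp (h : WBdd m Φ μ ν C c) (f : Lp ℝ 2 ν) :
    MemLp (fun x => m x * f (Φ x)) 2 μ := by
  have hf := Lp.stronglyMeasurable f
  refine ⟨(h.meas_weight.mul (hf.measurable.comp h.meas_map)).aestronglyMeasurable,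
    (h.eLpNorm_le hf).trans_lt ?_⟩
  exact ENNReal.mul_lt_top (ENNReal.mul_lt_top (by simp)
    (ENNReal.rpow_lt_top_of_nonneg (by norm_num) (by simp))) (Lp.eLpNorm_lt_top f)

open Classical in
/-- The weighted composition operator `f ↦ m · (f ∘ Φ)` from `L²(ν)` to `L²(μ)`. -/
def wcomp (m : X → ℝ) (Φ : X → Y) (μ : Measure X) (ν : Measure Y) : Lp ℝ 2 ν →L[ℝ] Lp ℝ 2 μ :=
  -- The value is zero when no bounds exist. The operators below are thus defined for all
  -- parameters, and side conditions enter only where their values are computed.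
  if h : ∃ C c, WBdd m Φ μ ν C c then
    LinearMap.mkContinuous
      { toFun := fun f => (h.choose_spec.choose_spec.memLp f).toLp _
        map_add' := fun f g => by
          rw [← MemLp.toLp_add]
          refine MemLp.toLp_congr _ _ ?_
          refine (h.choose_spec.choose_spec.congr (Lp.coeFn_add f g)).trans (.of_forall fun x => ?_)
          simp [mul_add]
        map_smul' := fun r f => by
          rw [RingHom.id_apply, ← MemLp.toLp_const_smul]
          refine MemLp.toLp_congr _ _ ?_
          refine (h.choose_spec.choose_spec.congr (Lp.coeFn_smul r f)).trans
            (.of_forall fun x => ?_)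
          simp only [Pi.smul_apply, smul_eq_mul]
          ring }
      (h.choose * Real.sqrt h.choose_spec.choose) fun f => by
        rw [LinearMap.coe_mk, AddHom.coe_mk, Lp.norm_toLp, Lp.norm_def]
        have := h.choose_spec.choose_spec.eLpNorm_le (Lp.stronglyMeasurable f)
        refine (ENNReal.toReal_mono ?_ this).trans (le_of_eq ?_)
        · exact (ENNReal.mul_lt_top (ENNReal.mul_lt_top (by simp)
            (ENNReal.rpow_lt_top_of_nonneg (by norm_num) (by simp))) (Lp.eLpNorm_lt_top f)).ne
        · rw [ENNReal.toReal_mul, ENNReal.toReal_mul, ← ENNReal.toReal_rpow, Real.sqrt_eq_rpow]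
          simp
  else 0

theorem WBdd.coeFn_wcomp (h : WBdd m Φ μ ν C c) (f : Lp ℝ 2 ν) :
    wcomp m Φ μ ν f =ᵐ[μ] fun x => m x * f (Φ x) := by
  have h' : ∃ C c, WBdd m Φ μ ν C c := ⟨C, c, h⟩
  rw [wcomp, dif_pos h']
  exact MemLp.coeFn_toLp (h'.choose_spec.choose_spec.memLp f)

theorem WBdd.coeFn_wcomp_of_ae (h : WBdd m Φ μ ν C c) (f : Lp ℝ 2 ν) {g : Y → ℝ}
    (hg : f =ᵐ[ν] g) : wcomp m Φ μ ν f =ᵐ[μ] fun x => m x * g (Φ x) :=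
  (h.coeFn_wcomp f).trans (h.congr hg)

theorem WBdd.norm_wcomp_le (h : WBdd m Φ μ ν C c) (f : Lp ℝ 2 ν) :
    ‖wcomp m Φ μ ν f‖ ≤ C * Real.sqrt c * ‖f‖ := by
  rw [Lp.norm_def, eLpNorm_congr_ae (h.coeFn_wcomp f), Lp.norm_def]
  refine (ENNReal.toReal_mono ?_ (h.eLpNorm_le (Lp.stronglyMeasurable f))).trans (le_of_eq ?_)
  · exact (ENNReal.mul_lt_top (ENNReal.mul_lt_top (by simp)
      (ENNReal.rpow_lt_top_of_nonneg (by norm_num) (by simp))) (Lp.eLpNorm_lt_top f)).ne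
  · rw [ENNReal.toReal_mul, ENNReal.toReal_mul, ← ENNReal.toReal_rpow, Real.sqrt_eq_rpow]
    simp

end WComp

/-! ### Affine changes of variables -/

theorem map_affine_le {a b : ℝ} (hb : b ≠ 0) {s u : Set ℝ}
    (h : ∀ x ∈ s, a + b * x ∈ u) (c : NNReal) (hc : |b|⁻¹ ≤ c) :
    (volume.restrict s).map (fun x => a + b * x) ≤ c • volume.restrict u := by
  have hm : Measurable fun x : ℝ => a + b * x := by fun_prop
  refine Measure.le_iff.2 fun A hA => ?_
  rw [Measure.map_apply hm hA, Measure.restrict_apply (hm hA), Measure.smul_apply,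
    Measure.restrict_apply hA]
  calc volume ((fun x => a + b * x) ⁻¹' A ∩ s)
      ≤ volume ((fun x => b * x) ⁻¹' ((fun x => a + x) ⁻¹' (A ∩ u))) :=
        measure_mono fun x hx => ⟨hx.1, h x hx.2⟩
    _ = ENNReal.ofReal |b⁻¹| * volume (A ∩ u) := by
        rw [Real.volume_preimage_mul_left hb, measure_preimage_add]
    _ ≤ c • volume (A ∩ u) := by
        rw [ENNReal.smul_def, smul_eq_mul]
        gcongr
        rw [abs_inv]
        exact ENNReal.ofReal_le_of_le_toReal (by simpa using hc)

theorem WBdd.affine {a b : ℝ} (hb : b ≠ 0) {s t u : Set ℝ} {m : ℝ → ℝ} {C : NNReal}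
    (ht : MeasurableSet t) (hm : Measurable m)
    (hC : ∀ x ∈ t, ‖m x‖₊ ≤ C) (hs : ∀ x ∈ t, m x ≠ 0 → x ∈ s)
    (h : ∀ x ∈ s, a + b * x ∈ u) (c : NNReal) (hc : |b|⁻¹ ≤ c) :
    WBdd m (fun x => a + b * x) (volume.restrict t) (volume.restrict u) C c where
  meas_weight := hm
  meas_map := by fun_prop
  bound := (ae_restrict_iff' ht).2 (.of_forall hC)
  map_le := by
    refine le_trans (Measure.map_mono ?_ (by fun_prop)) (map_affine_le hb h c hc)
    have hS : MeasurableSet {x | m x ≠ 0} := hm (measurableSet_singleton 0).compl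
    rw [Measure.restrict_restrict hS]
    exact Measure.restrict_mono (fun x hx => hs x hx.2 hx.1) le_rfl

theorem WBdd.affine_one {a b : ℝ} (hb : b ≠ 0) {t : Set ℝ} (ht : MeasurableSet t)
    (c : NNReal) (hc : |b|⁻¹ ≤ c) :
    WBdd (fun _ => 1) (fun x => a + b * x) (volume.restrict t) volume 1 c := by
  have := WBdd.affine (a := a) hb (s := t) (t := t) (u := univ) (m := fun _ => 1) (C := 1) ht
    measurable_const (by simp) (fun x hx _ => hx) (fun _ _ => mem_univ _) c hc
  rwa [Measure.restrict_univ] at this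

/-! ### The d'Alembert operators -/

/-- `L²(ℝ)`. -/
abbrev L2R : Type := Lp ℝ 2 (volume : Measure ℝ)

theorem one_le_alpha {k t : ℝ} (hk : 0 < k) (ht : 0 ≤ t) : 1 ≤ alpha k t := by
  unfold alpha; nlinarith [mul_nonneg hk.le ht]

/-- The profile `f` at time `t`: `f ↦ f(α(t)(1 + e k y))` as a function of `y ∈ (0,1)`. -/
def slice (k e t : ℝ) : L2R →L[ℝ] L2Omega :=
  wcomp (fun _ => 1) (fun y => alpha k t + alpha k t * (e * k) * y) (volume.restrict (Ioo 0 1))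
    volume

/-- The wave with profile `f` on the whole of `(0,1) × (0,T)`. -/
def wave (k e T : ℝ) : L2R →L[ℝ] L2 (Ioo (0 : ℝ) 1 ×ˢ Ioo 0 T) :=
  wcomp (fun _ => 1) (fun p : ℝ × ℝ => alpha k p.2 * (1 + e * k * p.1))
    (volume.restrict (Ioo (0 : ℝ) 1 ×ˢ Ioo 0 T)) volume

/-- The trace `f ↦ f(α(t)(1 + e k b))` at `y = b`, as a function of `t ∈ (0,T)`. -/
def trace (k e b T : ℝ) : L2R →L[ℝ] L2 (Ioo 0 T) :=
  wcomp (fun _ => 1) (fun t => (1 + e * k * b) + (1 + e * k * b) * k * t)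
    (volume.restrict (Ioo 0 T)) volume

variable {k e t T : ℝ}

/-- The slope has absolute value α(t)k ≥ k, so the bound k⁻¹ is independent of t. This uniformity is
what `wbdd_wave` and `continuousOn_slice` need. -/
theorem wbdd_slice (hk : 0 < k) (he : e ^ 2 = 1) (ht : 0 ≤ t) :
    WBdd (fun _ => 1) (fun y => alpha k t + alpha k t * (e * k) * y)
      (volume.restrict (Ioo 0 1)) volume 1 (Real.toNNReal k⁻¹) := by
  have ha := one_le_alpha hk ht
  have he' : |e| = 1 := by
    rw [← sq_abs] at he
    exact (pow_eq_one_iff_of_nonneg (abs_nonneg e) two_ne_zero).1 he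
  have hb : |alpha k t * (e * k)| = alpha k t * k := by
    rw [abs_mul, abs_mul, he', one_mul, abs_of_pos hk, abs_of_pos (by linarith)]
  refine WBdd.affine_one ?_ measurableSet_Ioo _ ?_
  · rw [← abs_ne_zero, hb]; positivity
  · rw [hb, Real.coe_toNNReal _ (by positivity)]
    gcongr
    nlinarith

theorem coeFn_slice (hk : 0 < k) (he : e ^ 2 = 1) (ht : 0 ≤ t) (f : L2R) {g : ℝ → ℝ}
    (hg : f =ᵐ[volume] g) :
    slice k e t f =ᵐ[volume.restrict (Ioo 0 1)] fun y => g (alpha k t * (1 + e * k * y)) := by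
  refine ((wbdd_slice hk he ht).coeFn_wcomp_of_ae f hg).trans (.of_forall fun y => ?_)
  simp only [one_mul]
  congr 1; ring

theorem norm_slice_le (hk : 0 < k) (he : e ^ 2 = 1) (ht : 0 ≤ t) (f : L2R) :
    ‖slice k e t f‖ ≤ Real.sqrt k⁻¹ * ‖f‖ := by
  have := (wbdd_slice hk he ht).norm_wcomp_le f
  rwa [Real.coe_toNNReal _ (by positivity), NNReal.coe_one, one_mul] at this

theorem wbdd_trace {b : ℝ} (hk : 0 < k) (hb : 1 + e * k * b ≠ 0) :
    WBdd (fun _ => 1) (fun t => (1 + e * k * b) + (1 + e * k * b) * k * t)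
      (volume.restrict (Ioo 0 T)) volume 1 (Real.toNNReal |(1 + e * k * b) * k|⁻¹) :=
  WBdd.affine_one (mul_ne_zero hb hk.ne') measurableSet_Ioo _ (Real.le_coe_toNNReal _)

theorem coeFn_trace {b : ℝ} (hk : 0 < k) (hb : 1 + e * k * b ≠ 0) (f : L2R) {g : ℝ → ℝ}
    (hg : f =ᵐ[volume] g) :
    trace k e b T f =ᵐ[volume.restrict (Ioo 0 T)] fun t => g (alpha k t * (1 + e * k * b)) := by
  refine ((wbdd_trace hk hb).coeFn_wcomp_of_ae f hg).trans (.of_forall fun y => ?_)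
  simp only [one_mul]
  congr 1; unfold alpha; ring

/-- Fubini: the uniform density bound for slices is integrated over t in (0,T). -/
theorem wbdd_wave (hk : 0 < k) (he : e ^ 2 = 1) :
    WBdd (fun _ => 1) (fun p : ℝ × ℝ => alpha k p.2 * (1 + e * k * p.1))
      (volume.restrict (Ioo (0 : ℝ) 1 ×ˢ Ioo 0 T)) volume 1 (Real.toNNReal (T * k⁻¹)) where
  meas_weight := measurable_const
  meas_map := by unfold alpha; fun_prop
  bound := by simp
  map_le := by
    have hm : Measurable fun p : ℝ × ℝ => alpha k p.2 * (1 + e * k * p.1) := by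
      unfold alpha; fun_prop
    simp only [ne_eq, one_ne_zero, not_false_eq_true, ofPred_true, Measure.restrict_univ]
    refine Measure.le_iff.2 fun A hA => ?_
    rw [Measure.map_apply hm hA, Measure.volume_eq_prod, ← Measure.prod_restrict,
      Measure.prod_apply_symm (hm hA)]
    calc ∫⁻ t in Ioo 0 T, (volume.restrict (Ioo (0 : ℝ) 1))
          ((fun y => (y, t)) ⁻¹' ((fun p : ℝ × ℝ => alpha k p.2 * (1 + e * k * p.1)) ⁻¹' A))
        ≤ ∫⁻ _ in Ioo 0 T, Real.toNNReal k⁻¹ • volume A := by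
          refine setLIntegral_mono measurable_const fun t ht => ?_
          have h1 := (wbdd_slice hk he ht.1.le).map_le
          simp only [ne_eq, one_ne_zero, not_false_eq_true, ofPred_true, Measure.restrict_univ] at h1
          have h2 := h1 A
          rw [Measure.map_apply (by fun_prop) hA, Measure.smul_apply] at h2
          refine le_trans (le_of_eq ?_) h2
          congr 1
          ext y
          simp only [mem_preimage]
          ring_nf
      _ = _ := by
          rw [setLIntegral_const, Real.volume_Ioo, sub_zero, Measure.smul_apply, mul_comm,
            ENNReal.smul_def, ENNReal.smul_def, smul_eq_mul, smul_eq_mul, ← mul_assoc]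
          congr 1
          rw [mul_comm T, Real.toNNReal_mul (by positivity), ENNReal.coe_mul, mul_comm]
          rfl

theorem coeFn_wave (hk : 0 < k) (he : e ^ 2 = 1) (f : L2R) :
    wave k e T f =ᵐ[volume.restrict (Ioo (0 : ℝ) 1 ×ˢ Ioo 0 T)]
      fun p => f (alpha k p.2 * (1 + e * k * p.1)) := by
  refine ((wbdd_wave hk he).coeFn_wcomp f).trans (.of_forall fun y => ?_)
  simp only [one_mul]

theorem inner_eq_integral {X : Type*} [MeasureSpace X] {s : Set X} (f g : L2 s) :
    inner ℝ f g = ∫ x in s, f x * g x := by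
  rw [L2.inner_def]
  exact integral_congr_ae (.of_forall fun x => mul_comm _ _)

theorem norm_L2Omega_le {f : L2Omega} {C : ℝ} (hC : 0 ≤ C)
    (h : ∀ᵐ y ∂(volume.restrict (Ioo (0 : ℝ) 1)), ‖f y‖ ≤ C) : ‖f‖ ≤ C := by
  refine (Lp.norm_le_of_ae_bound hC h).trans (le_of_eq ?_)
  have : measureUnivNNReal (volume.restrict (Ioo (0 : ℝ) 1)) = 1 := by
    rw [← ENNReal.coe_inj, coe_measureUnivNNReal]; simp
  rw [this]; simp

theorem integrable_slice_mul_aux (hk : 0 < k) (he : e ^ 2 = 1) (f : L2R)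
    (G : L2 (Ioo (0 : ℝ) 1 ×ˢ Ioo 0 T)) {g : ℝ → ℝ → ℝ}
    (hg : G =ᵐ[volume.restrict (Ioo (0 : ℝ) 1 ×ˢ Ioo 0 T)] fun p => g p.1 p.2) :
    Integrable (fun p : ℝ × ℝ => f (alpha k p.2 * (1 + e * k * p.1)) * g p.1 p.2)
        ((volume.restrict (Ioo (0 : ℝ) 1)).prod (volume.restrict (Ioo 0 T))) ∧
      inner ℝ (wave k e T f) G = ∫ p : ℝ × ℝ, f (alpha k p.2 * (1 + e * k * p.1)) * g p.1 p.2
        ∂((volume.restrict (Ioo (0 : ℝ) 1)).prod (volume.restrict (Ioo 0 T))) := by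
  have hae : (fun p => wave k e T f p * G p)
      =ᵐ[volume.restrict (Ioo (0 : ℝ) 1 ×ˢ Ioo 0 T)]
      fun p => f (alpha k p.2 * (1 + e * k * p.1)) * g p.1 p.2 := by
    filter_upwards [coeFn_wave hk he f, hg] with p h1 h2
    rw [h1, h2]
  have hint := (L2.integrable_inner (𝕜 := ℝ) G (wave k e T f)).congr hae
  have hin := (inner_eq_integral (wave k e T f) G).trans (integral_congr_ae hae)
  have hm : (volume.restrict (Ioo (0 : ℝ) 1 ×ˢ Ioo 0 T) : Measure (ℝ × ℝ)) =
      (volume.restrict (Ioo (0 : ℝ) 1)).prod (volume.restrict (Ioo 0 T)) := by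
    rw [Measure.prod_restrict, Measure.volume_eq_prod]
  rw [← hm]
  exact ⟨hint, hin⟩

theorem slice_mul_congr (hk : 0 < k) (he : e ^ 2 = 1) (f : L2R) (g : ℝ → ℝ → ℝ)
    {t : ℝ} (ht : t ∈ Ioo 0 T) :
    ∫ y in Ioo (0 : ℝ) 1, f (alpha k t * (1 + e * k * y)) * g y t =
      ∫ y in Ioo (0 : ℝ) 1, slice k e t f y * g y t := by
  refine integral_congr_ae ?_
  filter_upwards [coeFn_slice hk he ht.1.le f .rfl] with y hy
  rw [hy]

/-- Turns the iterated integral of the transposition formula into an inner product, hence into a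
continuous function of the profile. This opens the way to density arguments. -/
theorem integral_slice_mul (hk : 0 < k) (he : e ^ 2 = 1) (f : L2R)
    (G : L2 (Ioo (0 : ℝ) 1 ×ˢ Ioo 0 T)) {g : ℝ → ℝ → ℝ}
    (hg : G =ᵐ[volume.restrict (Ioo (0 : ℝ) 1 ×ˢ Ioo 0 T)] fun p => g p.1 p.2) :
    ∫ t in Ioo 0 T, ∫ y in Ioo (0 : ℝ) 1, slice k e t f y * g y t = inner ℝ (wave k e T f) G := by
  obtain ⟨h1, h2⟩ := integrable_slice_mul_aux hk he f G hg
  rw [h2, integral_prod_symm _ h1]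
  exact setIntegral_congr_fun measurableSet_Ioo fun t ht => (slice_mul_congr hk he f g ht).symm

theorem integrableOn_slice_mul (hk : 0 < k) (he : e ^ 2 = 1) (f : L2R)
    (G : L2 (Ioo (0 : ℝ) 1 ×ˢ Ioo 0 T)) {g : ℝ → ℝ → ℝ}
    (hg : G =ᵐ[volume.restrict (Ioo (0 : ℝ) 1 ×ˢ Ioo 0 T)] fun p => g p.1 p.2) :
    IntegrableOn (fun t => ∫ y in Ioo (0 : ℝ) 1, slice k e t f y * g y t) (Ioo 0 T) :=
  IntegrableOn.congr_fun (integrable_slice_mul_aux hk he f G hg).1.integral_prod_right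
    (fun _ ht => slice_mul_congr hk he f g ht) measurableSet_Ioo

/-- For a smooth profile with compact support this is uniform continuity. A general profile is an L²
limit of such, and the bound of `norm_slice_le` makes the convergence of slices uniform in t. -/
theorem continuousOn_slice (hk : 0 < k) (he : e ^ 2 = 1) (f : L2R) :
    ContinuousOn (fun t => slice k e t f) (Icc 0 T) := by
  have key : ∀ f : L2R, (∃ g : ℝ → ℝ, f =ᵐ[volume] g ∧ HasCompactSupport g ∧ ContDiff ℝ ∞ g) →
      ContinuousOn (fun t => slice k e t f) (Icc 0 T) := by
    rintro f ⟨g, hfg, hgs, hg⟩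
    have huc := hgs.uniformContinuous_of_continuous hg.continuous
    rw [Metric.uniformContinuous_iff] at huc
    rw [Metric.continuousOn_iff]
    intro t ht ε hε
    obtain ⟨δ, hδ, h⟩ := huc (ε / 2) (by positivity)
    have hC : 0 < k * (1 + |e * k|) := by positivity
    refine ⟨δ / (k * (1 + |e * k|)), by positivity, fun s hs hst => ?_⟩
    rw [dist_eq_norm]
    refine lt_of_le_of_lt (norm_L2Omega_le (C := ε / 2) (by positivity) ?_) (half_lt_self hε)
    · filter_upwards [Lp.coeFn_sub (slice k e s f) (slice k e t f), coeFn_slice hk he hs.1 f hfg,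
        coeFn_slice hk he ht.1 f hfg, ae_restrict_mem measurableSet_Ioo] with y h1 h2 h3 hy
      rw [h1, Pi.sub_apply, h2, h3, ← dist_eq_norm]
      refine (h ?_).le
      rw [Real.dist_eq] at hst ⊢
      rw [lt_div_iff₀ hC] at hst
      have : alpha k s * (1 + e * k * y) - alpha k t * (1 + e * k * y) =
          (s - t) * (k * (1 + e * k * y)) := by unfold alpha; ring
      rw [this, abs_mul, abs_mul, abs_of_pos hk]
      refine lt_of_le_of_lt ?_ hst
      gcongr
      refine (abs_add_le _ _).trans ?_
      rw [abs_one, abs_mul]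
      gcongr
      refine mul_le_of_le_one_right (abs_nonneg _) ?_
      rw [abs_of_pos hy.1]; exact hy.2.le
  refine continuousOn_of_uniform_approx_of_continuousOn fun u hu => ?_
  obtain ⟨ε, hε, hεu⟩ := Metric.mem_uniformity_dist.1 hu
  have hs : 0 < Real.sqrt k⁻¹ := by positivity
  obtain ⟨g, hg, hfg⟩ := Metric.dense_iff.1
    (Lp.dense_hasCompactSupport_contDiff (F := ℝ) (μ := (volume : Measure ℝ)) (p := 2)
      ENNReal.ofNat_ne_top) f (ε / Real.sqrt k⁻¹) (by positivity)
  refine ⟨fun t => slice k e t g, key g hfg, fun t ht => hεu ?_⟩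
  rw [dist_eq_norm, ← map_sub]
  refine (norm_slice_le hk he ht.1 _).trans_lt ?_
  rw [Metric.mem_ball, dist_comm, dist_eq_norm, lt_div_iff₀ hs] at hg
  linarith

/-! ### Calculus in the `(y,t)` plane -/

/-- `θ(y,t)` is of class `Cⁿ` near the point `(y,t)`. -/
abbrev SmoothAt (n : WithTop ℕ∞) (θ : ℝ → ℝ → ℝ) (y t : ℝ) : Prop :=
  ContDiffAt ℝ n (fun p : ℝ × ℝ => θ p.1 p.2) (y, t)

section Calculus

variable {θ η : ℝ → ℝ → ℝ} {y t : ℝ}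

theorem SmoothAt.fderiv_y (h : SmoothAt 1 θ y t) :
    HasDerivAt (fun z => θ z t) (fderiv ℝ (fun p : ℝ × ℝ => θ p.1 p.2) (y, t) (1, 0)) y := by
  have h1 := (h.differentiableAt (by simp)).hasFDerivAt
  have h2 : HasDerivAt (fun z : ℝ => (z, t)) (1, 0) y := (hasDerivAt_id y).prodMk (hasDerivAt_const y t)
  exact h1.comp_hasDerivAt (f := fun z : ℝ => (z, t)) y h2

theorem SmoothAt.fderiv_t (h : SmoothAt 1 θ y t) :
    HasDerivAt (fun s => θ y s) (fderiv ℝ (fun p : ℝ × ℝ => θ p.1 p.2) (y, t) (0, 1)) t := by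
  have h1 := (h.differentiableAt (by simp)).hasFDerivAt
  have h2 : HasDerivAt (fun s : ℝ => (y, s)) (0, 1) t := (hasDerivAt_const t y).prodMk (hasDerivAt_id t)
  exact h1.comp_hasDerivAt (f := fun s : ℝ => (y, s)) t h2

theorem SmoothAt.hasDerivAt_y (h : SmoothAt 1 θ y t) :
    HasDerivAt (fun z => θ z t) (dy θ y t) y := h.fderiv_y.differentiableAt.hasDerivAt

theorem SmoothAt.hasDerivAt_t (h : SmoothAt 1 θ y t) :
    HasDerivAt (fun s => θ y s) (dt θ y t) t := h.fderiv_t.differentiableAt.hasDerivAt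

theorem SmoothAt.fderiv_apply_y (h : SmoothAt 1 θ y t) :
    fderiv ℝ (fun p : ℝ × ℝ => θ p.1 p.2) (y, t) (1, 0) = dy θ y t :=
  h.fderiv_y.deriv.symm

theorem SmoothAt.fderiv_apply_t (h : SmoothAt 1 θ y t) :
    fderiv ℝ (fun p : ℝ × ℝ => θ p.1 p.2) (y, t) (0, 1) = dt θ y t :=
  h.fderiv_t.deriv.symm

theorem SmoothAt.eventually {n : ℕ} (h : SmoothAt n θ y t) :
    ∀ᶠ p in 𝓝 (y, t), SmoothAt n θ p.1 p.2 :=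
  ContDiffAt.eventually h (by simp)

theorem SmoothAt.dy {n : ℕ} (h : SmoothAt (n + 1) θ y t) : SmoothAt n (dy θ) y t := by
  have h1 : ContDiffAt ℝ n
      (fun p : ℝ × ℝ => fderiv ℝ (fun p : ℝ × ℝ => θ p.1 p.2) p (1, 0)) (y, t) :=
    (h.fderiv_right le_rfl).clm_apply contDiffAt_const
  refine h1.congr_of_eventuallyEq ?_
  filter_upwards [SmoothAt.eventually (n := n + 1) (by exact_mod_cast h)] with p hp
  exact (SmoothAt.fderiv_apply_y (hp.of_le (by simp))).symm

theorem SmoothAt.dt {n : ℕ} (h : SmoothAt (n + 1) θ y t) : SmoothAt n (dt θ) y t := by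
  have h1 : ContDiffAt ℝ n
      (fun p : ℝ × ℝ => fderiv ℝ (fun p : ℝ × ℝ => θ p.1 p.2) p (0, 1)) (y, t) :=
    (h.fderiv_right le_rfl).clm_apply contDiffAt_const
  refine h1.congr_of_eventuallyEq ?_
  filter_upwards [SmoothAt.eventually (n := n + 1) (by exact_mod_cast h)] with p hp
  exact (SmoothAt.fderiv_apply_t (hp.of_le (by simp))).symm

theorem SmoothAt.dy' (h : SmoothAt 2 θ y t) : SmoothAt 1 (MovingWave.dy θ) y t := by
  have := SmoothAt.dy (n := 1) (θ := θ) (y := y) (t := t) (by norm_num; exact h)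
  exact_mod_cast this

theorem SmoothAt.dt' (h : SmoothAt 2 θ y t) : SmoothAt 1 (MovingWave.dt θ) y t := by
  have := SmoothAt.dt (n := 1) (θ := θ) (y := y) (t := t) (by norm_num; exact h)
  exact_mod_cast this

theorem SmoothAt.continuousAt_dy (h : SmoothAt 1 θ y t) :
    ContinuousAt (fun p : ℝ × ℝ => MovingWave.dy θ p.1 p.2) (y, t) :=
  (SmoothAt.dy (n := 0) (by simpa using h)).continuousAt

theorem SmoothAt.continuousAt_dt (h : SmoothAt 1 θ y t) :
    ContinuousAt (fun p : ℝ × ℝ => MovingWave.dt θ p.1 p.2) (y, t) :=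
  (SmoothAt.dt (n := 0) (by simpa using h)).continuousAt

theorem dy_congr {θ η : ℝ → ℝ → ℝ} (h : ∀ᶠ p in 𝓝 (y, t), θ p.1 p.2 = η p.1 p.2) :
    ∀ᶠ p in 𝓝 (y, t), dy θ p.1 p.2 = dy η p.1 p.2 := by
  filter_upwards [eventually_eventually_nhds.2 h] with p hp
  exact Filter.EventuallyEq.deriv_eq
    ((Continuous.prodMk_left p.2).tendsto p.1 |>.eventually hp)

theorem dt_congr {θ η : ℝ → ℝ → ℝ} (h : ∀ᶠ p in 𝓝 (y, t), θ p.1 p.2 = η p.1 p.2) :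
    ∀ᶠ p in 𝓝 (y, t), dt θ p.1 p.2 = dt η p.1 p.2 := by
  filter_upwards [eventually_eventually_nhds.2 h] with p hp
  exact Filter.EventuallyEq.deriv_eq
    ((Continuous.prodMk_right p.1).tendsto p.2 |>.eventually hp)

end Calculus

/-! ### The adjoint operator and Green's formula -/

/-- `θ'' + L* θ`. -/
def adjointOp (k : ℝ) (θ : ℝ → ℝ → ℝ) : ℝ → ℝ → ℝ := fun y t =>
  dt (dt θ) y t + adjointL k θ y t

theorem smoothAt_coef {k : ℝ} {n : WithTop ℕ∞} {y t : ℝ} (ht : alpha k t ≠ 0) :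
    SmoothAt n (fun y t => beta k y t / alpha k t) y t ∧
      SmoothAt n (fun y t => gamma k y / alpha k t) y t ∧
      SmoothAt n (fun _ t => (alpha k t)⁻¹) y t := by
  have h1 : ContDiff ℝ n fun p : ℝ × ℝ => alpha k p.2 := by unfold alpha; fun_prop
  have h2 : ContDiff ℝ n fun p : ℝ × ℝ => gamma k p.1 := by unfold gamma; fun_prop
  have h3 : ContDiff ℝ n fun p : ℝ × ℝ => 1 - k ^ 2 * p.1 ^ 2 := by fun_prop
  refine ⟨(h3.contDiffAt.div h1.contDiffAt ht).div h1.contDiffAt ht,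
    h2.contDiffAt.div h1.contDiffAt ht, h1.contDiffAt.inv ht⟩

section AdjointRegularity

variable {θ η : ℝ → ℝ → ℝ} {k y t : ℝ}

theorem SmoothAt.flux (ht : alpha k t ≠ 0) (h : SmoothAt 2 θ y t) :
    SmoothAt 1 (fun y t => beta k y t / alpha k t * MovingWave.dy θ y t) y t :=
  (smoothAt_coef ht).1.mul h.dy'

theorem SmoothAt.drift (ht : alpha k t ≠ 0) (h : SmoothAt 2 θ y t) :
    SmoothAt 1 (MovingWave.dy fun y t => gamma k y / alpha k t * θ y t) y t :=
  SmoothAt.dy' ((smoothAt_coef ht).2.1.mul h)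

theorem SmoothAt.continuousAt_adjointOp (ht : alpha k t ≠ 0) (h : SmoothAt 2 θ y t) :
    ContinuousAt (fun p : ℝ × ℝ => adjointOp k θ p.1 p.2) (y, t) :=
  h.dt'.continuousAt_dt.add ((h.flux ht).continuousAt_dy.neg.add (h.drift ht).continuousAt_dt)

theorem continuousOn_of_rect {F : ℝ → ℝ → ℝ} {T : ℝ}
    (h : ∀ y ∈ Icc (0 : ℝ) 1, ∀ t ∈ Icc 0 T, ContinuousAt (fun p : ℝ × ℝ => F p.1 p.2) (y, t)) :
    ContinuousOn (fun p : ℝ × ℝ => F p.1 p.2) (Icc 0 1 ×ˢ Icc 0 T) :=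
  fun p hp => (h p.1 hp.1 p.2 hp.2).continuousWithinAt

/-- Green's formula on the rectangle `(0,1) × (0,T)`. -/
theorem green {R P : ℝ → ℝ → ℝ} {T : ℝ} (hT : 0 ≤ T)
    (hR : ∀ y ∈ Icc (0 : ℝ) 1, ∀ t ∈ Icc 0 T, SmoothAt 1 R y t)
    (hP : ∀ y ∈ Icc (0 : ℝ) 1, ∀ t ∈ Icc 0 T, SmoothAt 1 P y t) :
    ∫ t in Ioo 0 T, ∫ y in Ioo (0 : ℝ) 1, (dy R y t + dt P y t) =
      (∫ t in Ioo 0 T, (R 1 t - R 0 t)) + ∫ y in Ioo (0 : ℝ) 1, (P y T - P y 0) := by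
  have hle : ((0 : ℝ), (0 : ℝ)) ≤ (1, T) := ⟨zero_le_one, hT⟩
  have hIcc : Icc ((0 : ℝ), (0 : ℝ)) (1, T) = Icc 0 1 ×ˢ Icc 0 T := Icc_prod_eq _ _
  have hcD : ContinuousOn (fun p : ℝ × ℝ => dy R p.1 p.2 + dt P p.1 p.2) (Icc 0 1 ×ˢ Icc 0 T) :=
    (continuousOn_of_rect fun y hy t ht => (hR y hy t ht).continuousAt_dy).add
      (continuousOn_of_rect fun y hy t ht => (hP y hy t ht).continuousAt_dt)
  have hint := hcD.integrableOn_compact (μ := volume) (isCompact_Icc.prod isCompact_Icc)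
  have heq : ∀ p ∈ Icc (0 : ℝ) 1 ×ˢ Icc 0 T,
      fderiv ℝ (fun p : ℝ × ℝ => R p.1 p.2) p (1, 0) + fderiv ℝ (fun p : ℝ × ℝ => P p.1 p.2) p (0, 1)
      = dy R p.1 p.2 + dt P p.1 p.2 := fun p hp => by
    rw [(hR p.1 hp.1 p.2 hp.2).fderiv_apply_y, (hP p.1 hp.1 p.2 hp.2).fderiv_apply_t]
  have hms : MeasurableSet (Icc (0 : ℝ) 1 ×ˢ Icc 0 T) := measurableSet_Icc.prod measurableSet_Icc
  have key := integral_divergence_prod_Icc_of_hasFDerivAt_of_le (fun p : ℝ × ℝ => R p.1 p.2)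
    (fun p : ℝ × ℝ => P p.1 p.2) _ _ (0, 0) (1, T) hle
    (hIcc ▸ continuousOn_of_rect fun y hy t ht => (hR y hy t ht).continuousAt)
    (hIcc ▸ continuousOn_of_rect fun y hy t ht => (hP y hy t ht).continuousAt)
    (fun p hp => ((hR p.1 (Ioo_subset_Icc_self hp.1) p.2
      (Ioo_subset_Icc_self hp.2)).differentiableAt (by simp)).hasFDerivAt)
    (fun p hp => ((hP p.1 (Ioo_subset_Icc_self hp.1) p.2
      (Ioo_subset_Icc_self hp.2)).differentiableAt (by simp)).hasFDerivAt)
    (by rw [hIcc]; exact hint.congr_fun (fun p hp => (heq p hp).symm) hms)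
  rw [hIcc, setIntegral_congr_fun hms heq] at key
  simp only [intervalIntegral.integral_of_le hT, intervalIntegral.integral_of_le zero_le_one,
    integral_Ioc_eq_integral_Ioo] at key
  have e1 : ∫ p in Icc (0 : ℝ) 1 ×ˢ Icc 0 T, (dy R p.1 p.2 + dt P p.1 p.2) =
      ∫ t in Ioo 0 T, ∫ y in Ioo (0 : ℝ) 1, (dy R y t + dt P y t) := by
    have h0 := hint
    rw [IntegrableOn, Measure.volume_eq_prod, ← Measure.prod_restrict] at h0
    rw [Measure.volume_eq_prod, ← Measure.prod_restrict, integral_prod_symm _ h0]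
    simp only [integral_Icc_eq_integral_Ioo]
  have hci : ∀ {F : ℝ → ℝ} {a b : ℝ}, ContinuousOn F (Icc a b) → IntegrableOn F (Ioo a b) :=
    fun h => (h.integrableOn_compact isCompact_Icc).mono_set Ioo_subset_Icc_self
  have cR : ∀ y ∈ Icc (0 : ℝ) 1, ContinuousOn (fun t => R y t) (Icc 0 T) := fun y hy t ht =>
    (hR y hy t ht).hasDerivAt_t.continuousAt.continuousWithinAt
  have cP : ∀ t ∈ Icc (0 : ℝ) T, ContinuousOn (fun y => P y t) (Icc 0 1) := fun t ht y hy =>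
    (hP y hy t ht).hasDerivAt_y.continuousAt.continuousWithinAt
  rw [← e1, key, integral_sub (hci (cR 1 (by simp))) (hci (cR 0 (by simp))),
    integral_sub (hci (cP T ⟨hT, le_rfl⟩)) (hci (cP 0 ⟨le_rfl, hT⟩))]
  ring

end AdjointRegularity

/-! ### Smooth waves -/

section SmoothWave

variable {θ : ℝ → ℝ → ℝ} {f : ℝ → ℝ} {k e T y t : ℝ}

theorem hasDerivAt_char_y (k e y t : ℝ) :
    HasDerivAt (fun y => alpha k t * (1 + e * k * y)) (e * k * alpha k t) y := by
  have := (((hasDerivAt_id y).const_mul (e * k)).const_add 1).const_mul (alpha k t)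
  simpa [mul_comm, mul_left_comm] using this

theorem hasDerivAt_alpha (k t : ℝ) : HasDerivAt (fun t => alpha k t) k t := by
  simpa [alpha] using ((hasDerivAt_id t).const_mul k).const_add 1

theorem hasDerivAt_char_t (k e y t : ℝ) :
    HasDerivAt (fun t => alpha k t * (1 + e * k * y)) (k * (1 + e * k * y)) t := by
  simpa using (hasDerivAt_alpha k t).mul_const (1 + e * k * y)

theorem smoothAt_char {n : WithTop ℕ∞} (hf : ContDiff ℝ n f) :
    SmoothAt n (fun y t => f (alpha k t * (1 + e * k * y))) y t := by
  have : ContDiff ℝ n fun p : ℝ × ℝ => alpha k p.2 * (1 + e * k * p.1) := by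
    unfold alpha; fun_prop
  exact (hf.comp this).contDiffAt

theorem SmoothAt.one (h : SmoothAt 2 θ y t) : SmoothAt 1 θ y t := h.of_le (by norm_num)

/-- For v = f(α(1 + eky)) the product v(θ'' + L*θ) differs from the divergence of an explicit field
by a multiple of θ(v'' + Lv), which vanishes for a travelling wave. Green's formula then leaves
boundary terms only. -/
theorem smoothWave_green (hk : 0 < k) (he : e ^ 2 = 1) (hT : 0 ≤ T) (hf : ContDiff ℝ 2 f)
    (hθ : ∀ y ∈ Icc (0 : ℝ) 1, ∀ t ∈ Icc 0 T, SmoothAt 2 θ y t) :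
    ∫ t in Ioo 0 T, ∫ y in Ioo (0 : ℝ) 1,
        f (alpha k t * (1 + e * k * y)) * adjointOp k θ y t =
      (∫ t in Ioo 0 T,
        ((-(f (alpha k t * (1 + e * k * 1)) * (beta k 1 t / alpha k t * dy θ 1 t))
          + e * k * (1 - k ^ 2 * 1 ^ 2) / alpha k t * deriv f (alpha k t * (1 + e * k * 1)) * θ 1 t
          - k * (1 + e * k * 1) * deriv f (alpha k t * (1 + e * k * 1))
            * (gamma k 1 / alpha k t * θ 1 t))
        - (-(f (alpha k t * (1 + e * k * 0)) * (beta k 0 t / alpha k t * dy θ 0 t))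
          + e * k * (1 - k ^ 2 * 0 ^ 2) / alpha k t * deriv f (alpha k t * (1 + e * k * 0)) * θ 0 t
          - k * (1 + e * k * 0) * deriv f (alpha k t * (1 + e * k * 0))
            * (gamma k 0 / alpha k t * θ 0 t)))) +
      ∫ y in Ioo (0 : ℝ) 1,
        ((f (alpha k T * (1 + e * k * y)) * dt θ y T
          - k * (1 + e * k * y) * deriv f (alpha k T * (1 + e * k * y)) * θ y T
          + f (alpha k T * (1 + e * k * y)) * dy (fun y t => gamma k y / alpha k t * θ y t) y T)
        - (f (alpha k 0 * (1 + e * k * y)) * dt θ y 0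
          - k * (1 + e * k * y) * deriv f (alpha k 0 * (1 + e * k * y)) * θ y 0
          + f (alpha k 0 * (1 + e * k * y)) * dy (fun y t => gamma k y / alpha k t * θ y t) y 0)) := by
  have hα : ∀ t ∈ Icc 0 T, alpha k t ≠ 0 := fun t ht =>
    (zero_lt_one.trans_le (one_le_alpha hk ht.1)).ne'
  have hf1 : ContDiff ℝ 1 f := hf.of_le (by norm_num)
  have hf' : ContDiff ℝ 1 (deriv f) := (contDiff_succ_iff_deriv (n := 1)).1 (by norm_num; exact hf) |>.2.2
  have d1 : ∀ x, HasDerivAt f (deriv f x) x := fun x =>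
    (hf1.differentiable (by simp) x).hasDerivAt
  have d2 : ∀ x, HasDerivAt (deriv f) (deriv (deriv f) x) x := fun x =>
    (hf'.differentiable (by simp) x).hasDerivAt
  rw [← green (R := fun y t => -(f (alpha k t * (1 + e * k * y)) * (beta k y t / alpha k t * dy θ y t))
          + e * k * (1 - k ^ 2 * y ^ 2) / alpha k t * deriv f (alpha k t * (1 + e * k * y)) * θ y t
          - k * (1 + e * k * y) * deriv f (alpha k t * (1 + e * k * y))
            * (gamma k y / alpha k t * θ y t))
      (P := fun y t => f (alpha k t * (1 + e * k * y)) * dt θ y t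
          - k * (1 + e * k * y) * deriv f (alpha k t * (1 + e * k * y)) * θ y t
          + f (alpha k t * (1 + e * k * y)) * dy (fun y t => gamma k y / alpha k t * θ y t) y t) hT]
  · refine setIntegral_congr_fun measurableSet_Ioo fun t ht => ?_
    refine setIntegral_congr_fun measurableSet_Ioo fun y hy => ?_
    have hy' := Ioo_subset_Icc_self hy
    have ht' := Ioo_subset_Icc_self ht
    have hs := hθ y hy' t ht'
    have ha := hα t ht'
    have c1 := (d1 _).comp y (hasDerivAt_char_y k e y t)
    have c2 := (d2 _).comp y (hasDerivAt_char_y k e y t)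
    have c3 := (d1 _).comp t (hasDerivAt_char_t k e y t)
    have c4 := (d2 _).comp t (hasDerivAt_char_t k e y t)
    have w1 : HasDerivAt (fun y : ℝ => e * k * (1 - k ^ 2 * y ^ 2) / alpha k t)
        (-(2 * e * k ^ 3 * y) / alpha k t) y := by
      have := (((((hasDerivAt_id y).pow 2).const_mul (k ^ 2)).const_sub 1).const_mul
        (e * k)).div_const (alpha k t)
      refine this.congr_deriv ?_
      simp; ring
    have w2 : HasDerivAt (fun y : ℝ => k * (1 + e * k * y)) (k * (e * k)) y := by
      simpa using (((hasDerivAt_id y).const_mul (e * k)).const_add 1).const_mul k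
    have hy1 := hs.one.hasDerivAt_y
    have ht1 := hs.one.hasDerivAt_t
    have hR := ((c1.mul (hs.flux ha).hasDerivAt_y).neg.add ((w1.mul c2).mul hy1)).sub
      ((w2.mul c2).mul (SmoothAt.hasDerivAt_y
        (θ := fun y t => gamma k y / alpha k t * θ y t) (((smoothAt_coef ha).2.1).mul hs.one)))
    have hP := ((c3.mul hs.dt'.hasDerivAt_t).sub
      ((c4.const_mul (k * (1 + e * k * y))).mul ht1)).add (c3.mul (hs.drift ha).hasDerivAt_t)
    have hR' := hR.deriv
    have hP' := hP.deriv
    simp only [Function.comp_def, Pi.mul_apply] at hR' hP'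
    rw [dy, dt]
    refine Eq.trans ?_ (congrArg₂ (· + ·) hR'.symm hP'.symm)
    unfold adjointOp adjointL
    have hg : gamma k y = -2 * k * y := rfl
    have hb : beta k y t = (1 - k ^ 2 * y ^ 2) / alpha k t := rfl
    generalize dy (fun y t => gamma k y / alpha k t * θ y t) y t = D1
    generalize dy (fun y t => beta k y t / alpha k t * dy θ y t) y t = D2
    generalize dt (dy fun y t => gamma k y / alpha k t * θ y t) y t = D3
    rw [hg, hb]
    set X := deriv (deriv f) (alpha k t * (1 + e * k * y))
    set X1 := deriv f (alpha k t * (1 + e * k * y))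
    set X0 := f (alpha k t * (1 + e * k * y))
    field_simp
    -- What is left is θ times the wave equation for f(α(1 + eky)), which holds because e² = 1.
    linear_combination (-(alpha k t * θ y t * X * k ^ 2)) * he
  · intro y _ t ht
    exact ((((smoothAt_char hf1).mul ((hθ y ‹_› t ht).flux (hα t ht))).neg).add
      (((contDiffAt_const.mul (contDiffAt_const.sub (contDiffAt_const.mul
        (contDiffAt_fst.pow 2)))).div ((by unfold alpha; fun_prop :
          ContDiff ℝ 1 fun p : ℝ × ℝ => alpha k p.2).contDiffAt) (hα t ht)).mul
        (smoothAt_char hf') |>.mul (hθ y ‹_› t ht).one)).sub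
      (((contDiffAt_const.mul (contDiffAt_const.add (contDiffAt_const.mul contDiffAt_fst))).mul
        (smoothAt_char hf')).mul
        (((smoothAt_coef (hα t ht)).2.1).mul (hθ y ‹_› t ht).one))
  · intro y _ t ht
    exact (((smoothAt_char hf1).mul (hθ y ‹_› t ht).dt').sub
      (((contDiffAt_const.mul (contDiffAt_const.add (contDiffAt_const.mul contDiffAt_fst))).mul
        (smoothAt_char hf')).mul (hθ y ‹_› t ht).one)).add
      ((smoothAt_char hf1).mul ((hθ y ‹_› t ht).drift (hα t ht)))

end SmoothWave

/-! ### Velocities in `H⁻¹` -/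

theorem WBdd.mul {X : Type*} [MeasurableSpace X] {m : X → ℝ} {μ : Measure X} {C : NNReal}
    (hm : Measurable m) (hC : ∀ᵐ x ∂μ, ‖m x‖₊ ≤ C) : WBdd m id μ μ C 1 where
  meas_weight := hm
  meas_map := measurable_id
  bound := hC
  map_le := by
    rw [Measure.map_id, one_smul]
    exact Measure.restrict_le_self

/-- Multiplication by `e + k y` on `L²(0,1)`. -/
def weightOp (k e : ℝ) : L2Omega →L[ℝ] L2Omega :=
  wcomp (fun y => e + k * y) id (volume.restrict (Ioo 0 1)) (volume.restrict (Ioo 0 1))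

theorem coeFn_weightOp (k e : ℝ) (g : L2Omega) :
    weightOp k e g =ᵐ[volume.restrict (Ioo 0 1)] fun y => (e + k * y) * g y := by
  refine (WBdd.mul (C := ‖e‖₊ + ‖k‖₊) (by fun_prop) ?_).coeFn_wcomp g
  filter_upwards [ae_restrict_mem measurableSet_Ioo] with y hy
  refine (nnnorm_add_le _ _).trans ?_
  gcongr
  rw [nnnorm_mul]
  refine mul_le_of_le_one_right (by positivity) ?_
  rw [← NNReal.coe_le_coe, coe_nnnorm, Real.norm_eq_abs, abs_of_pos hy.1]
  exact hy.2.le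

/-- The functional `φ ↦ ∫ g (L φ)`, as a continuous linear function of `g`. -/
def pairing (L : H10 →L[ℝ] L2Omega) : L2Omega →L[ℝ] Hm1 :=
  LinearMap.mkContinuous
    { toFun := fun g => (innerSL ℝ g).comp L
      map_add' := fun g h => by ext φ; simp
      map_smul' := fun r g => by ext φ; simp }
    ‖L‖ fun g => by
      refine (ContinuousLinearMap.opNorm_comp_le _ _).trans ?_
      rw [innerSL_apply_norm, mul_comm]

theorem pairing_apply (L : H10 →L[ℝ] L2Omega) (g : L2Omega) (φ : H10) :
    pairing L g φ = inner ℝ g (L φ) := rfl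

/-- `(φ, φ') ↦ φ`. -/
def valueMap : H10 →L[ℝ] L2Omega := (WithLp.fstL 2 ℝ L2Omega L2Omega).comp H10.subtypeL

/-- `(φ, φ') ↦ φ'`. -/
def derivMap : H10 →L[ℝ] L2Omega := (WithLp.sndL 2 ℝ L2Omega L2Omega).comp H10.subtypeL

theorem toHm1_eq (g : L2Omega) : toHm1 g = pairing valueMap g := rfl

/-- The operator `g ↦ (φ ↦ -∫ g (k φ + (e + k y) φ'))`; at time `t` the time derivative of
`f(α(t)(1 + e k y))` is `α(t)⁻¹` times its value at `slice k e t f`. -/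
def velocity (k e : ℝ) : L2Omega →L[ℝ] Hm1 :=
  -pairing (k • valueMap + (weightOp k e).comp derivMap)

theorem velocity_apply (k e : ℝ) (g : L2Omega) (φ : H10) :
    velocity k e g φ = -inner ℝ g (k • valueMap φ + weightOp k e (derivMap φ)) := rfl

theorem velocity_apply_eq_integral (k e : ℝ) (g : L2Omega) (φ : H10) {ψ ψ' : ℝ → ℝ}
    (h : valueMap φ =ᵐ[volume.restrict (Ioo 0 1)] ψ)
    (h' : derivMap φ =ᵐ[volume.restrict (Ioo 0 1)] ψ') :
    velocity k e g φ = -∫ y in Ioo (0 : ℝ) 1, g y * (k * ψ y + (e + k * y) * ψ' y) := by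
  rw [velocity_apply, inner_eq_integral]
  congr 1
  refine integral_congr_ae ?_
  filter_upwards [h, h', coeFn_weightOp k e (derivMap φ), Lp.coeFn_smul k (valueMap φ),
    Lp.coeFn_add (k • valueMap φ) (weightOp k e (derivMap φ))] with y h1 h2 h3 h4 h5
  rw [h5, Pi.add_apply, h4, h3, Pi.smul_apply, h1, h2, smul_eq_mul]

/-! ### The transposition identity for a wave with an `L²` profile -/

theorem memLp_rect {F : ℝ × ℝ → ℝ} {T : ℝ} (hF : ContinuousOn F (Icc 0 1 ×ˢ Icc 0 T)) :
    MemLp F 2 (volume.restrict (Ioo (0 : ℝ) 1 ×ˢ Ioo 0 T)) := by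
  obtain ⟨C, hC⟩ := (isCompact_Icc.prod isCompact_Icc).exists_bound_of_continuousOn hF
  have hsub : Ioo (0 : ℝ) 1 ×ˢ Ioo 0 T ⊆ Icc 0 1 ×ˢ Icc 0 T :=
    prod_mono Ioo_subset_Icc_self Ioo_subset_Icc_self
  have hms : MeasurableSet (Ioo (0 : ℝ) 1 ×ˢ Ioo 0 T) := measurableSet_Ioo.prod measurableSet_Ioo
  have : IsFiniteMeasure (volume.restrict (Ioo (0 : ℝ) 1 ×ˢ Ioo 0 T)) := by
    refine ⟨?_⟩
    rw [Measure.restrict_apply_univ]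
    exact (measure_mono hsub).trans_lt (isCompact_Icc.prod isCompact_Icc).measure_lt_top
  refine MemLp.of_bound ((hF.mono hsub).aestronglyMeasurable hms) C ?_
  filter_upwards [ae_restrict_mem hms] with p hp using hC p (hsub hp)

theorem memLp_Ioo {F : ℝ → ℝ} {T : ℝ} (hF : ContinuousOn F (Icc 0 T)) :
    MemLp F 2 (volume.restrict (Ioo 0 T)) := by
  obtain ⟨C, hC⟩ := isCompact_Icc.exists_bound_of_continuousOn hF
  refine MemLp.of_bound
    ((hF.mono Ioo_subset_Icc_self).aestronglyMeasurable measurableSet_Ioo) C ?_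
  filter_upwards [ae_restrict_mem measurableSet_Ioo] with y hy using hC y (Ioo_subset_Icc_self hy)

theorem integrableOn_Ioo {F : ℝ → ℝ} {a b : ℝ} (h : ContinuousOn F (Icc a b)) :
    IntegrableOn F (Ioo a b) :=
  (h.integrableOn_compact isCompact_Icc).mono_set Ioo_subset_Icc_self

/-- By density of smooth functions with compact support, identities that are continuous in the
profile need checking only where pointwise calculus applies. -/
theorem L2R_induction {A B : L2R → ℝ} (hA : Continuous A) (hB : Continuous B)
    (h : ∀ (f : L2R) (g : ℝ → ℝ), f =ᵐ[volume] g → ContDiff ℝ ∞ g → A f = B f) (f : L2R) :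
    A f = B f := by
  have hd := Lp.dense_hasCompactSupport_contDiff (F := ℝ) (μ := (volume : Measure ℝ)) (p := 2)
      ENNReal.ofNat_ne_top
  have hsub : {f : L2R | ∃ g : ℝ → ℝ, f =ᵐ[volume] g ∧ HasCompactSupport g ∧ ContDiff ℝ ∞ g} ⊆
      {f | A f = B f} := by
    rintro f ⟨g, h1, _, h3⟩
    exact h f g h1 h3
  exact (isClosed_eq hA hB).closure_subset_iff.2 hsub (hd f)

theorem integral_inner_left {X : Type*} [MeasureSpace X] {s : Set X} (f : L2 s) {F : X → ℝ}
    (hF : MemLp F 2 (volume.restrict s)) : ∫ x in s, f x * F x = inner ℝ f (hF.toLp F) := by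
  rw [inner_eq_integral]
  refine integral_congr_ae ?_
  filter_upwards [hF.coeFn_toLp] with x hx
  rw [hx]

section Test

variable {T : ℝ} (θ : AdjointTest T)

theorem AdjointTest.continuousOn_dy (θ : AdjointTest T) {y : ℝ} (hy : y ∈ Icc (0 : ℝ) 1) :
    ContinuousOn (fun t => dy θ.toFun y t) (Icc 0 T) := fun t ht =>
  ((SmoothAt.dy' (θ.smooth y hy t ht)).hasDerivAt_t.continuousAt).continuousWithinAt

theorem AdjointTest.continuousOn_dt (θ : AdjointTest T) {t : ℝ} (ht : t ∈ Icc 0 T) :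
    ContinuousOn (fun y => dt θ.toFun y t) (Icc 0 1) := fun y hy =>
  ((SmoothAt.dt' (θ.smooth y hy t ht)).hasDerivAt_y.continuousAt).continuousWithinAt

theorem AdjointTest.continuousOn_drift {k : ℝ} (hk : 0 < k) (θ : AdjointTest T) {t : ℝ}
    (ht : t ∈ Icc 0 T) :
    ContinuousOn (fun y => dy (fun y t => gamma k y / alpha k t * θ.toFun y t) y t) (Icc 0 1) :=
  fun y hy => (SmoothAt.hasDerivAt_y (SmoothAt.drift (k := k)
    (zero_lt_one.trans_le (one_le_alpha hk ht.1)).ne'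
    (θ.smooth y hy t ht))).continuousAt.continuousWithinAt

theorem continuousOn_alpha_inv {k : ℝ} (hk : 0 < k) :
    ContinuousOn (fun t => 1 / alpha k t ^ 2) (Icc 0 T) := fun t ht => by
  have := (zero_lt_one.trans_le (one_le_alpha hk ht.1)).ne'
  exact (continuousAt_const.div ((hasDerivAt_alpha k t).continuousAt.pow 2)
    (pow_ne_zero 2 this)).continuousWithinAt

variable {k e : ℝ} {f : ℝ → ℝ}

/-- The two integrands add up to the derivative of e(1 + eky) f(1 + eky) φ(y), which vanishes at
both ends. This removes the derivative from the profile and produces the functional `velocity`. -/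
theorem integral_by_parts_char (he : e ^ 2 = 1) (hf : ContDiff ℝ 1 f) {φ : ℝ → ℝ}
    (hφ : ∀ y ∈ Icc (0 : ℝ) 1, HasDerivAt φ (deriv φ y) y) (hφ' : ContinuousOn (deriv φ) (Icc 0 1))
    (h0 : φ 0 = 0) (h1 : φ 1 = 0) :
    ∫ y in Ioo (0 : ℝ) 1, k * (1 + e * k * y) * deriv f (1 + e * k * y) * φ y =
      -∫ y in Ioo (0 : ℝ) 1, f (1 + e * k * y) * (k * φ y + (e + k * y) * deriv φ y) := by
  have hφc : ContinuousOn φ (Icc 0 1) := fun y hy => (hφ y hy).continuousAt.continuousWithinAt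
  have hfc := hf.continuous
  have hfc' : Continuous (deriv f) := hf.continuous_deriv (by simp)
  have i1 : IntegrableOn (fun y => k * (1 + e * k * y) * deriv f (1 + e * k * y) * φ y)
    (Ioo 0 1) := integrableOn_Ioo (ContinuousOn.mul (by fun_prop) hφc)
  have c2 : ContinuousOn (fun y => f (1 + e * k * y) * (k * φ y + (e + k * y) * deriv φ y))
    (Icc 0 1) := ContinuousOn.mul (by fun_prop)
      ((continuousOn_const.mul hφc).add (ContinuousOn.mul (by fun_prop) hφ'))
  have i2 := integrableOn_Ioo c2
  rw [eq_neg_iff_add_eq_zero, ← integral_add i1 i2]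
  have hd : ∀ y ∈ uIcc (0 : ℝ) 1, HasDerivAt (fun y => e * (1 + e * k * y) * f (1 + e * k * y) * φ y)
      (k * (1 + e * k * y) * deriv f (1 + e * k * y) * φ y
        + f (1 + e * k * y) * (k * φ y + (e + k * y) * deriv φ y)) y := by
    intro y hy
    rw [uIcc_of_le zero_le_one] at hy
    have a1 : HasDerivAt (fun y : ℝ => 1 + e * k * y) (e * k) y := by
      simpa using ((hasDerivAt_id y).const_mul (e * k)).const_add 1
    have a2 := ((hf.differentiable (by simp) (1 + e * k * y)).hasDerivAt).comp y a1
    have := ((a1.const_mul e).mul a2).mul (hφ y hy)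
    refine this.congr_deriv ?_
    simp only [Function.comp, Pi.mul_apply]
    linear_combination ((f (1 + e * k * y) * k * φ y + (1 + e * k * y) * deriv f (1 + e * k * y) * k * φ y) + f (1 + e * k * y) * k * y * deriv φ y) * he
  have hint : IntervalIntegrable (fun y => k * (1 + e * k * y) * deriv f (1 + e * k * y) * φ y
        + f (1 + e * k * y) * (k * φ y + (e + k * y) * deriv φ y)) volume 0 1 := by
    rw [intervalIntegrable_iff_integrableOn_Ioo_of_le zero_le_one]
    exact i1.add i2
  have := intervalIntegral.integral_eq_sub_of_hasDerivAt hd hint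
  rw [intervalIntegral.integral_of_le zero_le_one, integral_Ioc_eq_integral_Ioo] at this
  rw [this, h0, h1]; simp

/-- In Green's formula the terms at time T vanish with θ(T) and θ'(T), and on the sides only those
with θ_y survive. After the integration by parts at time 0 no derivative of f remains, so the
identity makes sense for L² profiles. The factor 1 - k² is the numerator of β at y = 1. -/
theorem transposition_smooth (hk : 0 < k) (he : e ^ 2 = 1) (hT : 0 < T) (hf : ContDiff ℝ 2 f) :
    ∫ t in Ioo 0 T, ∫ y in Ioo (0 : ℝ) 1,
        f (alpha k t * (1 + e * k * y)) * adjointOp k θ.toFun y t =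
      -(∫ y in Ioo (0 : ℝ) 1, f (1 + e * k * y) *
          (k * θ.toFun y 0 + (e + k * y) * deriv (fun z => θ.toFun z 0) y))
      - (∫ y in Ioo (0 : ℝ) 1, f (1 + e * k * y) *
          (dt θ.toFun y 0 + dy (fun y t => gamma k y / alpha k t * θ.toFun y t) y 0))
      + (∫ t in Ioo 0 T, f (alpha k t) * (1 / alpha k t ^ 2 * dy θ.toFun 0 t))
      - ∫ t in Ioo 0 T, f (alpha k t * (1 + e * k)) *
          ((1 - k ^ 2) * (1 / alpha k t ^ 2 * dy θ.toFun 1 t)) := by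
  have h00 : (0 : ℝ) ∈ Icc 0 T := ⟨le_rfl, hT.le⟩
  have hf1 : ContDiff ℝ 1 f := hf.of_le (by norm_num)
  have hfc := hf.continuous
  have hfc' : Continuous (deriv f) := hf1.continuous_deriv (by simp)
  have hac : Continuous (fun t => alpha k t) := by unfold alpha; fun_prop
  rw [smoothWave_green hk he hT.le hf θ.smooth]
  have hθd : ∀ y ∈ Icc (0 : ℝ) 1, HasDerivAt (fun z => θ.toFun z 0)
      (deriv (fun z => θ.toFun z 0) y) y := fun y hy =>
    (SmoothAt.one (θ.smooth y hy 0 h00)).hasDerivAt_y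
  have e1 := integral_by_parts_char (k := k) he hf1 hθd (θ.continuousOn_deriv_initial hT)
    (θ.left 0 h00) (θ.right 0 h00)
  have hc1 : ContinuousOn (fun t => f (alpha k t) * (1 / alpha k t ^ 2 * dy θ.toFun 0 t))
      (Icc 0 T) := (ContinuousOn.mul (by fun_prop)
        ((continuousOn_alpha_inv hk).mul (θ.continuousOn_dy (by simp))))
  have hc2 : ContinuousOn (fun t => f (alpha k t * (1 + e * k)) *
      ((1 - k ^ 2) * (1 / alpha k t ^ 2 * dy θ.toFun 1 t))) (Icc 0 T) :=
    (ContinuousOn.mul (by fun_prop)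
        (continuousOn_const.mul ((continuousOn_alpha_inv hk).mul (θ.continuousOn_dy (by simp)))))
  have hc3 : ContinuousOn (fun y => k * (1 + e * k * y) * deriv f (1 + e * k * y) * θ.toFun y 0)
      (Icc 0 1) := ContinuousOn.mul (by fun_prop) (θ.continuousOn_initial hT)
  have hc4 : ContinuousOn (fun y => f (1 + e * k * y) *
      (dt θ.toFun y 0 + dy (fun y t => gamma k y / alpha k t * θ.toFun y t) y 0)) (Icc 0 1) :=
    ContinuousOn.mul (by fun_prop) ((θ.continuousOn_dt h00).add (θ.continuousOn_drift hk h00))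
  rw [← e1, ← integral_sub (integrableOn_Ioo hc3) (integrableOn_Ioo hc4), add_sub_assoc,
    ← integral_sub (integrableOn_Ioo hc1) (integrableOn_Ioo hc2), add_comm]
  congr 1
  · refine setIntegral_congr_fun measurableSet_Ioo fun y hy => ?_
    have hy' := Ioo_subset_Icc_self hy
    have d0 : dy (fun y t => gamma k y / alpha k t * θ.toFun y t) y T = 0 := by
      have : (fun z => gamma k z / alpha k T * θ.toFun z T) =ᶠ[𝓝 y] fun _ => 0 := by
        filter_upwards [Icc_mem_nhds hy.1 hy.2] with z hz
        rw [θ.final z hz, mul_zero]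
      rw [dy, this.deriv_eq, deriv_const]
    have ha0 : alpha k 0 = 1 := by simp [alpha]
    simp only [θ.final y hy', θ.final_deriv y hy', d0, ha0, one_mul]
    ring
  · refine setIntegral_congr_fun measurableSet_Ioo fun t ht => ?_
    have ht' := Ioo_subset_Icc_self ht
    have ha := (zero_lt_one.trans_le (one_le_alpha hk ht'.1)).ne'
    simp only [θ.left t ht', θ.right t ht', beta]
    field_simp
    ring_nf

theorem initial_fst (hT : 0 < T) :
    valueMap (θ.initial hT) =ᵐ[volume.restrict (Ioo 0 1)] fun y => θ.toFun y 0 :=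
  MemLp.coeFn_toLp (memLp_of_contOn (θ.continuousOn_initial hT))

theorem initial_snd (hT : 0 < T) :
    derivMap (θ.initial hT) =ᵐ[volume.restrict (Ioo 0 1)] deriv fun y => θ.toFun y 0 :=
  MemLp.coeFn_toLp (memLp_of_contOn (θ.continuousOn_deriv_initial hT))

theorem memLp_adjointOp (hk : 0 < k) :
    MemLp (fun p : ℝ × ℝ => adjointOp k θ.toFun p.1 p.2) 2
      (volume.restrict (Ioo (0 : ℝ) 1 ×ˢ Ioo 0 T)) :=
  memLp_rect (continuousOn_of_rect fun y hy t ht => SmoothAt.continuousAt_adjointOp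
    (zero_lt_one.trans_le (one_le_alpha hk ht.1)).ne' (θ.smooth y hy t ht))

/-- Each term is a continuous linear function of f, so the smooth case suffices. A single wave
leaves a trace term at y = 1, which cancels only when two waves are added. -/
theorem transposition_slice (hk : 0 < k) (hk1 : k < 1) (he : e ^ 2 = 1) (hT : 0 < T) (f : L2R) :
    ∫ t in Ioo 0 T, ∫ y in Ioo (0 : ℝ) 1, slice k e t f y * adjointOp k θ.toFun y t =
      velocity k e (slice k e 0 f) (θ.initial hT)
      - (∫ y in Ioo (0 : ℝ) 1, slice k e 0 f y *
          (dt θ.toFun y 0 + dy (fun y t => gamma k y / alpha k t * θ.toFun y t) y 0))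
      + (∫ t in Ioo 0 T, trace k e 0 T f t * (1 / alpha k t ^ 2 * dy θ.toFun 0 t))
      - ∫ t in Ioo 0 T, trace k e 1 T f t *
          ((1 - k ^ 2) * (1 / alpha k t ^ 2 * dy θ.toFun 1 t)) := by
  have h00 : (0 : ℝ) ∈ Icc 0 T := ⟨le_rfl, hT.le⟩
  have hek : 1 + e * k * 1 ≠ 0 := by
    intro h
    have : (e * k) ^ 2 = 1 := by
      have : e * k = -1 := by linarith
      rw [this]; norm_num
    rw [mul_pow, he, one_mul] at this
    nlinarith
  have m1 : MemLp (fun y => dt θ.toFun y 0 +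
      dy (fun y t => gamma k y / alpha k t * θ.toFun y t) y 0) 2 (volume.restrict (Ioo 0 1)) :=
    memLp_of_contOn ((θ.continuousOn_dt h00).add (θ.continuousOn_drift hk h00))
  have m2 : MemLp (fun t => 1 / alpha k t ^ 2 * dy θ.toFun 0 t) 2 (volume.restrict (Ioo 0 T)) :=
    memLp_Ioo ((continuousOn_alpha_inv hk).mul (θ.continuousOn_dy (by simp)))
  have m3 : MemLp (fun t => (1 - k ^ 2) * (1 / alpha k t ^ 2 * dy θ.toFun 1 t)) 2
      (volume.restrict (Ioo 0 T)) := memLp_Ioo (continuousOn_const.mul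
      ((continuousOn_alpha_inv hk).mul (θ.continuousOn_dy (by simp))))
  rw [integral_slice_mul hk he f _ (memLp_adjointOp θ hk).coeFn_toLp,
    integral_inner_left _ m1,
    integral_inner_left _ m2,
    integral_inner_left _ m3]
  revert f
  refine L2R_induction (by fun_prop) (by fun_prop) fun f g hfg hg => ?_
  rw [← integral_slice_mul hk he f _ (memLp_adjointOp θ hk).coeFn_toLp,
    ← integral_inner_left _ m1,
    ← integral_inner_left _ m2,
    ← integral_inner_left _ m3,
    velocity_apply_eq_integral _ _ _ _ (initial_fst θ hT) (initial_snd θ hT)]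
  have s0 := coeFn_slice hk he le_rfl f hfg
  have ha0 : alpha k 0 = 1 := by simp [alpha]
  simp only [ha0, one_mul] at s0
  have t0 := coeFn_trace (T := T) (e := e) (b := 0) hk (by simp) f hfg
  have t1 := coeFn_trace (T := T) (e := e) (b := 1) hk hek f hfg
  have key := transposition_smooth θ hk he hT (by exact_mod_cast contDiff_infty.1 hg 2)
  convert key using 1
  · refine setIntegral_congr_fun measurableSet_Ioo fun t ht => integral_congr_ae ?_
    filter_upwards [coeFn_slice hk he ht.1.le f hfg] with y hy
    rw [hy]
  · congr 1
    · congr 1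
      · congr 1
        · congr 1
          refine integral_congr_ae ?_
          filter_upwards [s0] with y hy
          rw [hy]
        · refine integral_congr_ae ?_
          filter_upwards [s0] with y hy
          rw [hy]
      · refine integral_congr_ae ?_
        filter_upwards [t0] with y hy
        rw [hy]; simp
    · refine integral_congr_ae ?_
      filter_upwards [t1] with y hy
      rw [hy]; simp

end Test

/-! ### The time derivative in `H⁻¹` -/

theorem H10_dense_span : Dense {φ : H10 | (φ : L2Pair) ∈ Submodule.span ℝ testPairs} := by
  rw [Subtype.dense_iff]
  intro x hx
  have hx' : x ∈ closure (Submodule.span ℝ testPairs : Set L2Pair) := hx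
  refine closure_mono ?_ hx'
  intro z hz
  exact ⟨⟨z, Submodule.le_topologicalClosure _ hz⟩, hz, rfl⟩

theorem Hm1_ext {L₁ L₂ : Hm1} (h : ∀ φ : H10, (φ : L2Pair) ∈ testPairs → L₁ φ = L₂ φ) :
    L₁ = L₂ := by
  refine ContinuousLinearMap.ext_on (s := {φ : H10 | (φ : L2Pair) ∈ testPairs}) ?_ fun φ hφ => h φ hφ
  refine H10_dense_span.mono fun φ hφ => ?_
  have : Submodule.span ℝ testPairs =
      (Submodule.span ℝ {φ : H10 | (φ : L2Pair) ∈ testPairs}).map H10.subtype := by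
    rw [Submodule.map_span]
    congr 1
    ext z
    refine ⟨fun hz => ⟨⟨z, Submodule.le_topologicalClosure _ (Submodule.subset_span hz)⟩, hz, rfl⟩,
      ?_⟩
    rintro ⟨w, hw, rfl⟩
    exact hw
  have hφ' : (φ : L2Pair) ∈ Submodule.span ℝ testPairs := hφ
  rw [this] at hφ'
  obtain ⟨w, hw, hwφ⟩ := hφ'
  rwa [← Subtype.ext hwφ]

section Dual

variable {H : Type*} [NormedAddCommGroup H] [NormedSpace ℝ H] {F W F' W' : ℝ → StrongDual ℝ H}
  {T t : ℝ}

/-- A curve in a dual space which is a weak primitive of a continuous curve is its primitive. -/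
theorem hasDerivWithinAt_dual {S : Set H} (hW : ContinuousOn W (Icc 0 T))
    (hS : ∀ L₁ L₂ : StrongDual ℝ H, (∀ φ ∈ S, L₁ φ = L₂ φ) → L₁ = L₂)
    (hF : ∀ t ∈ Icc 0 T, ∀ φ ∈ S, ∫ r in Ioo 0 t, W r φ = F t φ - F 0 φ) (ht : t ∈ Icc 0 T) :
    HasDerivWithinAt F (W t) (Icc 0 T) t := by
  have hii : ∀ t ∈ Icc 0 T, IntervalIntegrable W volume 0 t := fun t ht =>
    ContinuousOn.intervalIntegrable (by
      rw [uIcc_of_le ht.1]; exact hW.mono (Icc_subset_Icc_right ht.2))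
  have hint : ∀ t ∈ Icc 0 T, F t = F 0 + ∫ r in (0 : ℝ)..t, W r := by
    intro t ht
    refine hS _ _ fun φ hφ => ?_
    rw [add_apply, ContinuousLinearMap.intervalIntegral_apply (hii t ht) φ,
      intervalIntegral.integral_of_le ht.1, integral_Ioc_eq_integral_Ioo, hF t ht φ hφ]
    ring
  have : Fact (t ∈ Icc 0 T) := ⟨ht⟩
  have h1 := (intervalIntegral.integral_hasDerivWithinAt_right (s := Icc 0 T) (t := Icc 0 T)
    (hii t ht) (hW.stronglyMeasurableAtFilter_nhdsWithin measurableSet_Icc t) (hW t ht)).const_add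
      (F 0)
  exact h1.congr (fun s hs => hint s hs) (hint t ht)

theorem hasDerivWithinAt_dual_add {s : Set ℝ} {L L' : StrongDual ℝ H}
    (h : HasDerivWithinAt F L s t) (h' : HasDerivWithinAt F' L' s t) :
    HasDerivWithinAt (fun t => F t + F' t) (L + L') s t := h.add h'

theorem continuousOn_dual_add {s : Set ℝ} (h : ContinuousOn F s) (h' : ContinuousOn F' s) :
    ContinuousOn (fun t => F t + F' t) s := h.add h'

end Dual

variable {k e T t : ℝ} {f : ℝ → ℝ}

/-- A travelling wave satisfies v_t = ((e + ky)/α) v_y, by e² = 1. Hence the time derivative can be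
moved onto ψ, which vanishes at both ends, through Green's formula. -/
theorem smoothWave_deriv (hk : 0 < k) (he : e ^ 2 = 1) (ht : 0 ≤ t) (hf : ContDiff ℝ 1 f)
    {ψ : ℝ → ℝ} (hψ : ContDiff ℝ 1 ψ) (h0 : ψ 0 = 0) (h1 : ψ 1 = 0) :
    ∫ r in Ioo 0 t, ∫ y in Ioo (0 : ℝ) 1, f (alpha k r * (1 + e * k * y)) *
        (-(1 / alpha k r) * (k * ψ y + (e + k * y) * deriv ψ y)) =
      (∫ y in Ioo (0 : ℝ) 1, f (alpha k t * (1 + e * k * y)) * ψ y)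
        - ∫ y in Ioo (0 : ℝ) 1, f (alpha k 0 * (1 + e * k * y)) * ψ y := by
  have hα : ∀ r ∈ Icc 0 t, alpha k r ≠ 0 := fun r hr =>
    (zero_lt_one.trans_le (one_le_alpha hk hr.1)).ne'
  have hfc := hf.continuous
  have hψc := hψ.continuous
  have key := green (R := fun y r => -((e + k * y) / alpha k r * f (alpha k r * (1 + e * k * y)) * ψ y))
    (P := fun y r => f (alpha k r * (1 + e * k * y)) * ψ y) ht (fun y _ r hr => ?_)
    (fun y _ r _ => ?_)
  · rw [← integral_sub (integrableOn_Ioo (by fun_prop)) (integrableOn_Ioo (by fun_prop))]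
    simp only [h0, h1, mul_zero, neg_zero, sub_zero, integral_zero, zero_add] at key
    rw [← key]
    refine setIntegral_congr_fun measurableSet_Ioo fun r hr => ?_
    refine setIntegral_congr_fun measurableSet_Ioo fun y hy => ?_
    have ha := hα r (Ioo_subset_Icc_self hr)
    have d1 : ∀ x, HasDerivAt f (deriv f x) x := fun x =>
      (hf.differentiable (by simp) x).hasDerivAt
    have d2 : HasDerivAt ψ (deriv ψ y) y := (hψ.differentiable (by simp) y).hasDerivAt
    have c1 := (d1 _).comp y (hasDerivAt_char_y k e y r)
    have c3 := (d1 _).comp r (hasDerivAt_char_t k e y r)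
    have w1 : HasDerivAt (fun y : ℝ => (e + k * y) / alpha k r) (k / alpha k r) y := by
      simpa using (((hasDerivAt_id y).const_mul k).const_add e).div_const (alpha k r)
    have hR' := ((w1.mul c1).mul d2).neg.deriv
    have hP' := (c3.mul_const (ψ y)).deriv
    simp only [Function.comp_def, Pi.mul_apply] at hR' hP'
    simp only [dy, dt]
    refine Eq.trans ?_ (congrArg₂ (· + ·) hR'.symm hP'.symm)
    field_simp
    linear_combination (deriv f (alpha k r * (1 + e * k * y)) * k * ψ y * alpha k r) * he
  · have hy1 : ContDiff ℝ 1 fun p : ℝ × ℝ => e + k * p.1 := by fun_prop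
    have hy2 : ContDiff ℝ 1 fun p : ℝ × ℝ => alpha k p.2 := by unfold alpha; fun_prop
    exact (((hy1.contDiffAt.div hy2.contDiffAt (hα r hr)).mul (smoothAt_char hf)).mul
      (hψ.comp contDiff_fst).contDiffAt).neg
  · exact (smoothAt_char hf).mul (hψ.comp contDiff_fst).contDiffAt

/-- The time derivative of `toHm1 (slice k e t f)`. -/
def sliceDeriv (k e t : ℝ) (f : L2R) : Hm1 := velocity k e ((alpha k t)⁻¹ • slice k e t f)

theorem continuousOn_sliceDeriv (hk : 0 < k) (he : e ^ 2 = 1) (f : L2R) :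
    ContinuousOn (fun t => sliceDeriv k e t f) (Icc 0 T) := by
  have h : ContinuousOn (fun t => (alpha k t)⁻¹) (Icc 0 T) := fun t ht => ?_
  · exact (velocity k e).continuous.comp_continuousOn (h.smul (continuousOn_slice hk he f))
  exact ((hasDerivAt_alpha k t).continuousAt.inv₀
    (zero_lt_one.trans_le (one_le_alpha hk ht.1)).ne').continuousWithinAt

/-- Identifies `sliceDeriv` as a weak time derivative: `smoothWave_deriv` for smooth profiles,
extended by density. -/
theorem slice_integral (hk : 0 < k) (he : e ^ 2 = 1) (ht : 0 ≤ t) (f : L2R) (φ : H10)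
    (hφ : (φ : L2Pair) ∈ testPairs) : ∫ r in Ioo 0 t, sliceDeriv k e r f φ =
      toHm1 (slice k e t f) φ - toHm1 (slice k e 0 f) φ := by
  obtain ⟨ψ, hψ, -, hs, h1, h2⟩ := hφ
  have hψ0 : ψ 0 = 0 := image_eq_zero_of_notMem_tsupport fun h => by simpa using hs h
  have hψ1 : ψ 1 = 0 := image_eq_zero_of_notMem_tsupport fun h => by simpa using hs h
  have hψc := hψ.continuous
  have hψd := hψ.continuous_deriv (by simp)
  have hm : MemLp (fun p : ℝ × ℝ => -(1 / alpha k p.2) * (k * ψ p.1 + (e + k * p.1) * deriv ψ p.1))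
      2 (volume.restrict (Ioo (0 : ℝ) 1 ×ˢ Ioo 0 t)) := by
    refine memLp_rect (ContinuousOn.mul ?_ (by fun_prop))
    refine ContinuousOn.neg (ContinuousOn.div continuousOn_const ?_ fun p hp =>
      (zero_lt_one.trans_le (one_le_alpha hk hp.2.1)).ne')
    unfold alpha; fun_prop
  have hv : ∀ r, ∫ y in Ioo (0 : ℝ) 1, slice k e r f y *
      (-(1 / alpha k r) * (k * ψ y + (e + k * y) * deriv ψ y)) = sliceDeriv k e r f φ := by
    intro r
    rw [sliceDeriv, velocity_apply_eq_integral k e _ φ h1 h2, ← integral_neg]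
    refine integral_congr_ae ?_
    filter_upwards [Lp.coeFn_smul (alpha k r)⁻¹ (slice k e r f)] with y hy
    rw [hy, Pi.smul_apply, smul_eq_mul]
    ring
  rw [← setIntegral_congr_fun measurableSet_Ioo fun r _ => hv r,
    integral_slice_mul hk he f (hm.toLp _)
      (g := fun y r => -(1 / alpha k r) * (k * ψ y + (e + k * y) * deriv ψ y)) hm.coeFn_toLp]
  rw [toHm1_eq, toHm1_eq, pairing_apply, pairing_apply]
  clear hv
  revert f
  refine L2R_induction (by fun_prop) (by fun_prop) fun f g hfg hg => ?_
  rw [← integral_slice_mul hk he f (hm.toLp _)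
      (g := fun y r => -(1 / alpha k r) * (k * ψ y + (e + k * y) * deriv ψ y)) hm.coeFn_toLp,
    inner_eq_integral, inner_eq_integral]
  have key := smoothWave_deriv hk he ht (hg.of_le (by simp)) (hψ.of_le (m := 1) (by simp)) hψ0 hψ1
  have hsl : ∀ r, 0 ≤ r → ∫ y in Ioo (0 : ℝ) 1, slice k e r f y * valueMap φ y =
      ∫ y in Ioo (0 : ℝ) 1, g (alpha k r * (1 + e * k * y)) * ψ y := by
    intro r hr
    refine integral_congr_ae ?_
    filter_upwards [coeFn_slice hk he hr f hfg, h1] with y hy hy'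
    rw [hy]
    exact congrArg _ hy'
  rw [hsl t ht, hsl 0 le_rfl, ← key]
  refine setIntegral_congr_fun measurableSet_Ioo fun r hr => integral_congr_ae ?_
  filter_upwards [coeFn_slice hk he hr.1.le f hfg] with y hy
  rw [hy]

theorem hasDerivWithinAt_slice (hk : 0 < k) (he : e ^ 2 = 1) (f : L2R) (ht : t ∈ Icc 0 T) :
    HasDerivWithinAt (fun s => toHm1 (slice k e s f)) (sliceDeriv k e t f) (Icc 0 T) t :=
  hasDerivWithinAt_dual (H := H10) (W := fun t => sliceDeriv k e t f)
    (S := {φ : H10 | (φ : L2Pair) ∈ testPairs})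
    (continuousOn_sliceDeriv hk he f) (fun _ _ h => Hm1_ext h)
    (fun _ ht φ hφ => slice_integral hk he ht.1 f φ hφ) ht

/-! ### d'Alembert solutions -/

/-- A pair of `L²` profiles which cancel at the moving endpoint gives a solution of the boundary
value problem. -/
theorem isSolution_of_profiles (hk : 0 < k) (hk1 : k < 1) (hT : 0 < T) (P Q : L2R)
    (hPQ : trace k 1 1 T P + trace k (-1) 1 T Q = 0) :
    IsSolution k hT (slice k 1 0 P + slice k (-1) 0 Q)
      (velocity k 1 (slice k 1 0 P) + velocity k (-1) (slice k (-1) 0 Q))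
      (trace k 1 0 T P + trace k (-1) 0 T Q)
      (fun t => slice k 1 t P + slice k (-1) t Q)
      (fun t => sliceDeriv k 1 t P + sliceDeriv k (-1) t Q) where
  continuousOn := (continuousOn_slice hk (by norm_num) P).add (continuousOn_slice hk (by norm_num) Q)
  hasDeriv := fun t ht => by
    have : (fun s => toHm1 (slice k 1 s P + slice k (-1) s Q)) =
        fun s => toHm1 (slice k 1 s P) + toHm1 (slice k (-1) s Q) :=
      funext fun s => (pairing valueMap).map_add _ _
    rw [this]
    exact hasDerivWithinAt_dual_add (hasDerivWithinAt_slice hk (by norm_num) P ht)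
      (hasDerivWithinAt_slice hk (by norm_num) Q ht)
  continuousOn_deriv := continuousOn_dual_add
    (continuousOn_sliceDeriv hk (by norm_num) P) (continuousOn_sliceDeriv hk (by norm_num) Q)
  initial := rfl
  initial_deriv := by simp [sliceDeriv, alpha]
  transposition := fun θ => by
    have h00 : (0 : ℝ) ∈ Icc 0 T := ⟨le_rfl, hT.le⟩
    have hP := transposition_slice θ hk hk1 (e := 1) (by norm_num) hT P
    have hQ := transposition_slice θ hk hk1 (e := -1) (by norm_num) hT Q
    have add1 : ∀ {s : Set ℝ} (f g : L2 s) {F : ℝ → ℝ}, MemLp F 2 (volume.restrict s) →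
        ∫ x in s, (f + g) x * F x = (∫ x in s, f x * F x) + ∫ x in s, g x * F x := by
      intro s f g F hF
      rw [integral_inner_left _ hF, integral_inner_left _ hF, integral_inner_left _ hF,
        inner_add_left]
    have m1 : MemLp (fun y => dt θ.toFun y 0 +
        dy (fun y t => gamma k y / alpha k t * θ.toFun y t) y 0) 2 (volume.restrict (Ioo 0 1)) :=
      memLp_of_contOn ((θ.continuousOn_dt h00).add (θ.continuousOn_drift hk h00))
    have m2 : MemLp (fun t => 1 / alpha k t ^ 2 * dy θ.toFun 0 t) 2 (volume.restrict (Ioo 0 T)) :=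
      memLp_Ioo ((continuousOn_alpha_inv hk).mul (θ.continuousOn_dy (by simp)))
    have m3 : MemLp (fun t => (1 - k ^ 2) * (1 / alpha k t ^ 2 * dy θ.toFun 1 t)) 2
        (volume.restrict (Ioo 0 T)) := memLp_Ioo (continuousOn_const.mul
        ((continuousOn_alpha_inv hk).mul (θ.continuousOn_dy (by simp))))
    -- The trace terms at y = 1 of the two waves carry the same weight and cancel by `hPQ`.
    have h3 := add1 (trace k 1 1 T P) (trace k (-1) 1 T Q) m3
    rw [hPQ, integral_inner_left _ m3, inner_zero_left] at h3
    rw [add1 _ _ m1, add1 _ _ m2, add_apply]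
    have hG := (memLp_adjointOp θ hk).coeFn_toLp
    have mE : ∀ t ∈ Icc 0 T, MemLp (fun y => adjointOp k θ.toFun y t) 2
        (volume.restrict (Ioo 0 1)) := fun t ht =>
      memLp_of_contOn fun y hy => (((SmoothAt.continuousAt_adjointOp
        (zero_lt_one.trans_le (one_le_alpha hk ht.1)).ne' (θ.smooth y hy t ht)).comp
          (f := fun y => (y, t)) (by fun_prop))).continuousWithinAt
    have hint : ∀ (e : ℝ) (_ : e ^ 2 = 1) (f : L2R), IntegrableOn
        (fun t => ∫ y in Ioo (0 : ℝ) 1, slice k e t f y * adjointOp k θ.toFun y t) (Ioo 0 T) := by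
      intro e he f
      exact integrableOn_slice_mul hk he f _ hG
    have : ∫ t in Ioo 0 T, ∫ y in Ioo (0 : ℝ) 1, (slice k 1 t P + slice k (-1) t Q) y *
          adjointOp k θ.toFun y t =
        (∫ t in Ioo 0 T, ∫ y in Ioo (0 : ℝ) 1, slice k 1 t P y * adjointOp k θ.toFun y t) +
        ∫ t in Ioo 0 T, ∫ y in Ioo (0 : ℝ) 1, slice k (-1) t Q y * adjointOp k θ.toFun y t := by
      rw [← integral_add (hint 1 (by norm_num) P) (hint (-1) (by norm_num) Q)]
      exact setIntegral_congr_fun measurableSet_Ioo fun t ht =>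
        add1 _ _ (mE t (Ioo_subset_Icc_self ht))
    refine this.trans ?_
    rw [hP, hQ]
    linarith

/-! ### Representation of `H⁻¹` -/

/-- Test functions already form a vector space. Taking the span in `H10` adds nothing, and closed
inequalities may be verified on single test functions. -/
theorem span_testPairs : (Submodule.span ℝ testPairs : Set L2Pair) = testPairs := by
  refine Subset.antisymm (fun p hp => ?_) Submodule.subset_span
  induction hp using Submodule.span_induction with
  | mem x hx => exact hx
  | zero =>
    refine ⟨fun _ => 0, contDiff_const, HasCompactSupport.zero, by simp [tsupport], ?_, ?_⟩
    · exact Lp.coeFn_zero _ _ _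
    · exact (Lp.coeFn_zero ℝ 2 (volume.restrict (Ioo (0 : ℝ) 1))).trans
        (.of_forall fun z => by simp)
  | add x y _ _ hx hy =>
    obtain ⟨ψ, h1, h2, h3, h4, h5⟩ := hx
    obtain ⟨χ, g1, g2, g3, g4, g5⟩ := hy
    refine ⟨ψ + χ, h1.add g1, h2.add g2, (tsupport_add ψ χ).trans (union_subset h3 g3), ?_, ?_⟩
    · exact (Lp.coeFn_add _ _).trans (h4.add g4)
    · refine (Lp.coeFn_add _ _).trans ((h5.add g5).trans (.of_forall fun z => ?_))
      exact (deriv_add (h1.differentiable (by simp) z) (g1.differentiable (by simp) z)).symm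
  | smul a x _ hx =>
    obtain ⟨ψ, h1, h2, h3, h4, h5⟩ := hx
    refine ⟨a • ψ, contDiff_const.smul h1, h2.smul_left (f := fun _ => a),
      (tsupport_smul_subset_right (fun _ => a) ψ).trans h3, ?_, ?_⟩
    · exact (Lp.coeFn_smul _ _).trans (h4.const_smul a)
    · refine (Lp.coeFn_smul _ _).trans ((h5.const_smul a).trans (.of_forall fun z => ?_))
      exact (deriv_const_smul a (h1.differentiable (by simp) z)).symm

/-- ψ is the integral of ψ' from 0, so Cauchy–Schwarz against the constant 1 bounds even its
supremum by the L² norm of ψ'. -/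
theorem poincare_test {p : L2Pair} (hp : p ∈ testPairs) : ‖p.fst‖ ≤ ‖p.snd‖ := by
  obtain ⟨ψ, hψ, -, hs, h1, h2⟩ := hp
  have hψ0 : ψ 0 = 0 := image_eq_zero_of_notMem_tsupport fun h => by simpa using hs h
  have hd : Continuous (deriv ψ) := hψ.continuous_deriv (by simp)
  refine norm_L2Omega_le (norm_nonneg _) ?_
  filter_upwards [h1, ae_restrict_mem measurableSet_Ioo] with y hy hy01
  have e1 : ψ y = ∫ z in (0 : ℝ)..y, deriv ψ z := by
    rw [intervalIntegral.integral_deriv_eq_sub (fun z _ => hψ.differentiable (by simp) z)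
      (hd.intervalIntegrable _ _), hψ0, sub_zero]
  have hsub : Ioc 0 y ⊆ Ioo 0 1 := fun z hz => ⟨hz.1, hz.2.trans_lt hy01.2⟩
  have hi : IntegrableOn (fun z => ‖deriv ψ z‖) (Ioo 0 1) :=
    integrableOn_Ioo hd.norm.continuousOn
  have hint : ‖ψ y‖ ≤ ∫ z in Ioo (0 : ℝ) 1, ‖deriv ψ z‖ := by
    rw [e1]
    refine (intervalIntegral.norm_integral_le_integral_norm hy01.1.le).trans ?_
    rw [intervalIntegral.integral_of_le hy01.1.le]
    exact setIntegral_mono_set hi (.of_forall fun z => norm_nonneg _) hsub.eventuallyLE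
  have m1 : MemLp (fun z => ‖deriv ψ z‖) 2 (volume.restrict (Ioo (0 : ℝ) 1)) :=
    memLp_of_contOn hd.norm.continuousOn
  have m2 : MemLp (fun _ : ℝ => (1 : ℝ)) 2 (volume.restrict (Ioo (0 : ℝ) 1)) :=
    memLp_of_contOn continuousOn_const
  have e2 : ∫ z in Ioo (0 : ℝ) 1, ‖deriv ψ z‖ = inner ℝ (m2.toLp _) (m1.toLp _) := by
    rw [← integral_inner_left _ m1]
    refine integral_congr_ae ?_
    filter_upwards [m2.coeFn_toLp] with z hz
    rw [hz, one_mul]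
  have n1 : ‖m1.toLp _‖ = ‖p.snd‖ := by
    refine le_antisymm (Lp.norm_le_norm_of_ae_le ?_) (Lp.norm_le_norm_of_ae_le ?_) <;>
    · filter_upwards [m1.coeFn_toLp, h2] with z hz hz'
      rw [hz, hz', norm_norm]
  have n2 : ‖m2.toLp _‖ ≤ 1 := by
    refine norm_L2Omega_le zero_le_one ?_
    filter_upwards [m2.coeFn_toLp] with z hz
    rw [hz, norm_one]
  rw [hy]
  refine hint.trans ?_
  rw [e2]
  refine (real_inner_le_norm _ _).trans ?_
  rw [n1]
  exact mul_le_of_le_one_left (norm_nonneg _) n2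

theorem poincare (φ : H10) : ‖valueMap φ‖ ≤ ‖derivMap φ‖ := by
  refine (isClosed_le (f := fun φ => ‖valueMap φ‖) (g := fun φ => ‖derivMap φ‖)
    (by fun_prop) (by fun_prop)).closure_subset_iff.2 ?_ (H10_dense_span φ)
  intro φ hφ
  exact poincare_test (p := φ) (span_testPairs ▸ hφ)

theorem norm_sq_H10 (φ : H10) : ‖φ‖ ^ 2 ≤ 2 * ‖derivMap φ‖ ^ 2 := by
  have h : ‖φ‖ ^ 2 = ‖valueMap φ‖ ^ 2 + ‖derivMap φ‖ ^ 2 :=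
    WithLp.prod_norm_sq_eq_of_L2 (φ : L2Pair)
  have := poincare φ
  rw [h]
  nlinarith [norm_nonneg (valueMap φ)]

/-- Lax–Milgram for the form (x, y) ↦ ⟨Dx, Dy⟩ represents L by some x, and U = Dx. -/
theorem exists_antideriv_of_coercive {H E : Type*} [NormedAddCommGroup H] [InnerProductSpace ℝ H]
    [CompleteSpace H] [NormedAddCommGroup E] [InnerProductSpace ℝ E] (D : H →L[ℝ] E)
    (hD : ∀ φ, ‖φ‖ ^ 2 ≤ 2 * ‖D φ‖ ^ 2) (L : StrongDual ℝ H) :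
    ∃ U : E, ∀ φ, L φ = inner ℝ U (D φ) := by
  let B : H →L[ℝ] H →L[ℝ] ℝ := (innerSL ℝ : E →L[ℝ] E →L[ℝ] ℝ).bilinearComp D D
  have hB : ∀ x y, B x y = inner ℝ (D x) (D y) := fun x y => rfl
  have hc : IsCoercive B := ⟨1 / 2, by norm_num, fun u => by
    rw [hB, real_inner_self_eq_norm_sq]
    nlinarith [hD u]⟩
  let x := hc.continuousLinearEquivOfBilin.symm ((InnerProductSpace.toDual ℝ H).symm L)
  refine ⟨D x, fun φ => ?_⟩
  rw [← hB, ← hc.continuousLinearEquivOfBilin_apply x φ]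
  simp [x]

theorem exists_representation (L : Hm1) : ∃ U : L2Omega, ∀ φ, L φ = inner ℝ U (derivMap φ) := by
  have : CompleteSpace H10 :=
    (Submodule.isClosed_topologicalClosure (Submodule.span ℝ testPairs)).completeSpace_coe
  exact exists_antideriv_of_coercive (H := H10) derivMap norm_sq_H10 L

/-- Every state in `L² × H⁻¹` is the state of a pair of travelling waves. -/
theorem exists_state_profiles {k a : ℝ} (ha : a ≠ 0) (z₀ : L2Omega) (z₁ : Hm1) :
    ∃ p q : L2Omega, p + q = z₀ ∧ velocity k 1 (a • p) + velocity k (-1) (a • q) = z₁ := by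
  -- With p + q = z₀ fixed, the summands of the velocity condition that do not depend on the sign of
  -- e involve only z₀, and the rest is -a ∫ (p - q) φ'. The condition therefore prescribes p - q,
  -- which is this U.
  obtain ⟨U, hU⟩ := exists_representation
    (-(a⁻¹ • z₁) - pairing (k • valueMap + (weightOp k 0).comp derivMap) z₀)
  have hw : ∀ (e : ℝ) (g : L2Omega), weightOp k e g = e • g + weightOp k 0 g := by
    intro e g
    refine Lp.ext ?_
    filter_upwards [coeFn_weightOp k e g, coeFn_weightOp k 0 g, Lp.coeFn_smul e g,
      Lp.coeFn_add (e • g) (weightOp k 0 g)] with y h1 h2 h3 h4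
    rw [h1, h4, Pi.add_apply, h3, h2, Pi.smul_apply, smul_eq_mul]
    ring
  refine ⟨(1 / 2 : ℝ) • (z₀ + U), (1 / 2 : ℝ) • (z₀ - U), ?_, ?_⟩
  · rw [← smul_add]
    rw [show z₀ + U + (z₀ - U) = (2 : ℝ) • z₀ by rw [two_smul]; abel, smul_smul]
    norm_num
  · refine ContinuousLinearMap.ext fun φ => ?_
    have h := hU φ
    rw [add_apply, velocity_apply, velocity_apply, hw 1, hw (-1)]
    simp only [sub_apply, neg_apply, smul_apply, pairing_apply, smul_eq_mul, add_apply,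
      ContinuousLinearMap.comp_apply, inner_add_right, inner_smul_right, inner_smul_left,
      inner_add_left, inner_sub_left, RCLike.conj_to_real] at h ⊢
    field_simp at h ⊢
    linarith

/-! ### Profiles with prescribed data -/

/-- `g ↦ 1_I(s) g(a + b s)`, with values in `L²(ℝ)`. -/
def cutComp (I : Set ℝ) (a b : ℝ) (ν : Measure ℝ) : Lp ℝ 2 ν →L[ℝ] L2R :=
  wcomp (I.indicator fun _ => 1) (fun s => a + b * s) volume ν

theorem wbdd_cutComp {I u : Set ℝ} {a b : ℝ} (hI : MeasurableSet I) (hb : b ≠ 0)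
    (h : ∀ s ∈ I, a + b * s ∈ u) :
    WBdd (I.indicator fun _ => 1) (fun s => a + b * s) volume (volume.restrict u) 1
      (Real.toNNReal |b|⁻¹) := by
  have := WBdd.affine (a := a) hb (s := I) (t := univ) (u := u) (m := I.indicator fun _ => 1)
    (C := 1) MeasurableSet.univ (measurable_const.indicator hI) ?_ ?_ h _ (Real.le_coe_toNNReal _)
  · rwa [Measure.restrict_univ] at this
  · intro x _
    by_cases hx : x ∈ I <;> simp [hx]
  · intro x _ hx
    by_contra h
    simp [h] at hx

theorem wbdd_cutComp_univ {I : Set ℝ} {a b : ℝ} (hI : MeasurableSet I) (hb : b ≠ 0) :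
    WBdd (I.indicator fun _ => 1) (fun s => a + b * s) volume volume 1
      (Real.toNNReal |b|⁻¹) := by
  have := wbdd_cutComp (u := univ) (a := a) hI hb fun _ _ => mem_univ _
  rwa [Measure.restrict_univ] at this

theorem ae_cutComp {I : Set ℝ} {a b : ℝ} {ν : Measure ℝ} {C c : NNReal}
    (h : WBdd (I.indicator fun _ => 1) (fun s => a + b * s) volume ν C c) (g : Lp ℝ 2 ν) :
    ∀ᵐ s, (s ∈ I → cutComp I a b ν g s = g (a + b * s)) ∧ (s ∉ I → cutComp I a b ν g s = 0) := by
  filter_upwards [h.coeFn_wcomp g] with s hs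
  rw [cutComp, hs]
  exact ⟨fun hI => by simp [hI], fun hI => by simp [hI]⟩

variable {k e T t : ℝ}

theorem ae_slice (hk : 0 < k) (he : e ^ 2 = 1) (ht : 0 ≤ t) {p : ℝ → Prop} (hp : ∀ᵐ s, p s) :
    ∀ᵐ y ∂(volume.restrict (Ioo (0 : ℝ) 1)), p (alpha k t * (1 + e * k * y)) := by
  filter_upwards [(wbdd_slice hk he ht).ae_comp hp] with y hy
  have := hy one_ne_zero
  rwa [show alpha k t + alpha k t * (e * k) * y = alpha k t * (1 + e * k * y) by ring] at this

theorem ae_trace {b : ℝ} (hk : 0 < k) (hb : 1 + e * k * b ≠ 0) {p : ℝ → Prop} (hp : ∀ᵐ s, p s) :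
    ∀ᵐ t ∂(volume.restrict (Ioo 0 T)), p (alpha k t * (1 + e * k * b)) := by
  filter_upwards [(wbdd_trace hk hb).ae_comp hp] with y hy
  have := hy one_ne_zero
  rwa [show (1 + e * k * b) + (1 + e * k * b) * k * y = alpha k y * (1 + e * k * b) by
    unfold alpha; ring] at this

/-- The characteristic map is affine with nonzero slope, so null sets pull back to null sets. An
almost everywhere description `p` of the profile on the line may therefore be used along the slice.
-/
theorem slice_eq (hk : 0 < k) (he : e ^ 2 = 1) (ht : 0 ≤ t) {f : L2R} {g : L2Omega}
    {p : ℝ → Prop} (hp : ∀ᵐ s, p s)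
    (h : ∀ y ∈ Ioo (0 : ℝ) 1, p (alpha k t * (1 + e * k * y)) →
      f (alpha k t * (1 + e * k * y)) = g y) : slice k e t f = g := by
  refine Lp.ext ?_
  filter_upwards [coeFn_slice hk he ht f .rfl, ae_slice hk he ht hp,
    ae_restrict_mem measurableSet_Ioo] with y h1 h2 hy
  rw [h1, h y hy h2]

/-- The profile `s ↦ -Q(s (1 - k) / (1 + k))` on `(1 + k, (1 + k) M)`, and `p` on `(1, 1 + k)`. -/
def rightProfile (k M : ℝ) (p : L2Omega) (Q : L2R) : L2R :=
  cutComp (Ioo 1 (1 + k)) (-(1 / k)) (1 / k) _ p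
    - cutComp (Ioo (1 + k) ((1 + k) * M)) 0 ((1 - k) / (1 + k)) _ Q

theorem ae_rightProfile (hk : 0 < k) (hk1 : k < 1) (M : ℝ) (p : L2Omega) (Q : L2R) :
    ∀ᵐ s, rightProfile k M p Q s = (Ioo 1 (1 + k)).indicator (fun s => p (-(1 / k) + 1 / k * s)) s
      - (Ioo (1 + k) ((1 + k) * M)).indicator (fun s => Q ((1 - k) / (1 + k) * s)) s := by
  have hρ : (1 - k) / (1 + k) ≠ 0 := div_ne_zero (by linarith) (by linarith)
  have w1 : ∀ s ∈ Ioo 1 (1 + k), -(1 / k) + 1 / k * s ∈ Ioo (0 : ℝ) 1 := fun s hs => by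
    rw [show -(1 / k) + 1 / k * s = (s - 1) / k by ring]
    exact ⟨div_pos (by linarith [hs.1]) hk, (div_lt_one hk).2 (by linarith [hs.2])⟩
  filter_upwards [ae_cutComp (wbdd_cutComp measurableSet_Ioo (by positivity) w1) p,
    ae_cutComp (wbdd_cutComp_univ (I := Ioo (1 + k) ((1 + k) * M)) (a := 0) measurableSet_Ioo hρ) Q,
    Lp.coeFn_sub (cutComp (Ioo 1 (1 + k)) (-(1 / k)) (1 / k) _ p)
      (cutComp (Ioo (1 + k) ((1 + k) * M)) 0 ((1 - k) / (1 + k)) _ Q)] with s h1 h2 h3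
  rw [rightProfile, h3, Pi.sub_apply]
  congr 1
  · by_cases hs : s ∈ Ioo 1 (1 + k)
    · rw [h1.1 hs, indicator_of_mem hs]
    · rw [h1.2 hs, indicator_of_notMem hs]
  · by_cases hs : s ∈ Ioo (1 + k) ((1 + k) * M)
    · rw [h2.1 hs, indicator_of_mem hs, zero_add]
    · rw [h2.2 hs, indicator_of_notMem hs]

theorem rightProfile_slice (hk : 0 < k) (hk1 : k < 1) (M : ℝ) (p : L2Omega) (Q : L2R) :
    slice k 1 0 (rightProfile k M p Q) = p := by
  refine slice_eq hk (by norm_num) le_rfl (ae_rightProfile hk hk1 M p Q) fun y hy h => ?_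
  have ha : alpha k 0 * (1 + 1 * k * y) = 1 + k * y := by simp [alpha]
  rw [ha] at h ⊢
  have h1 : 1 + k * y ∈ Ioo 1 (1 + k) := ⟨by nlinarith [hy.1], by nlinarith [hy.2]⟩
  have h2 : 1 + k * y ∉ Ioo (1 + k) ((1 + k) * M) := fun h => by linarith [h.1, h1.2]
  rw [h, indicator_of_mem h1, indicator_of_notMem h2, sub_zero]
  congr 1
  field_simp
  ring

/-- For t in (0,T) the point α(t)(1 + k) stays in (1 + k, (1 + k)(1 + kT)), where the right profile
is by construction minus Q at the contracted point α(t)(1 - k). -/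
theorem rightProfile_trace (hk : 0 < k) (hk1 : k < 1) (p : L2Omega) (Q : L2R) :
    trace k 1 1 T (rightProfile k (1 + k * T) p Q) + trace k (-1) 1 T Q = 0 := by
  have b1 : 1 + 1 * k * 1 ≠ 0 := by linarith
  have b2 : 1 + -1 * k * 1 ≠ 0 := by linarith
  refine Lp.ext ?_
  filter_upwards [Lp.coeFn_add (trace k 1 1 T (rightProfile k (1 + k * T) p Q))
    (trace k (-1) 1 T Q), Lp.coeFn_zero ℝ 2 (volume.restrict (Ioo 0 T)),
    coeFn_trace (T := T) hk b1 (rightProfile k (1 + k * T) p Q) .rfl,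
    coeFn_trace (T := T) hk b2 Q .rfl,
    ae_trace (T := T) hk b1 (ae_rightProfile hk hk1 (1 + k * T) p Q),
    ae_restrict_mem measurableSet_Ioo] with t h1 h2 h3 h4 h5 ht
  have hα : alpha k t = 1 + k * t := rfl
  have hkt : 0 < k * t := mul_pos hk ht.1
  have hkT : k * t < k * T := by nlinarith [ht.2]
  have m1 : alpha k t * (1 + 1 * k * 1) ∉ Ioo 1 (1 + k) := fun h => by
    rw [hα] at h; nlinarith [h.2]
  have m2 : alpha k t * (1 + 1 * k * 1) ∈ Ioo (1 + k) ((1 + k) * (1 + k * T)) := by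
    rw [hα]; constructor <;> nlinarith
  rw [h1, h2, Pi.add_apply, h3, h4, h5, indicator_of_notMem m1, indicator_of_mem m2]
  have : (1 - k) / (1 + k) * (alpha k t * (1 + 1 * k * 1)) = alpha k t * (1 + -1 * k * 1) := by
    have : 1 + k ≠ 0 := by linarith
    field_simp; ring
  rw [this]; simp

/-- The part of the reflection operator which stays in `(1, M)`. -/
def reflOp (k M : ℝ) : L2R →L[ℝ] L2R := cutComp (Ioo (1 + k) M) 0 ((1 - k) / (1 + k)) volume

theorem ae_reflOp (hk : 0 < k) (hk1 : k < 1) (M : ℝ) (f : L2R) :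
    ∀ᵐ s, reflOp k M f s = (Ioo (1 + k) M).indicator (fun s => f ((1 - k) / (1 + k) * s)) s := by
  have hρ : (1 - k) / (1 + k) ≠ 0 := div_ne_zero (by linarith) (by linarith)
  filter_upwards [ae_cutComp (wbdd_cutComp_univ (I := Ioo (1 + k) M) (a := 0) measurableSet_Ioo hρ) f]
    with s h1
  rw [reflOp]
  by_cases hs : s ∈ Ioo (1 + k) M
  · rw [h1.1 hs, indicator_of_mem hs, zero_add]
  · rw [h1.2 hs, indicator_of_notMem hs]

/-- Each application contracts the argument by (1-k)/(1+k) and produces zero to the left of 1 + k.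
After n + 1 applications the result vanishes up to ((1+k)/(1-k))ⁿ, which finally exceeds the cutoff
M. -/
theorem reflOp_nilpotent (hk : 0 < k) (hk1 : k < 1) (M : ℝ) : IsNilpotent (reflOp k M) := by
  have hlam : 1 < (1 + k) / (1 - k) := by rw [lt_div_iff₀] <;> linarith
  have hρ : (1 - k) / (1 + k) ≠ 0 := div_ne_zero (by linarith) (by linarith)
  have hρ0 : 0 < (1 - k) / (1 + k) := div_pos (by linarith) (by linarith)
  have hρl : (1 - k) / (1 + k) * ((1 + k) / (1 - k)) = 1 := by
    have : 1 - k ≠ 0 := by linarith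
    have : 1 + k ≠ 0 := by linarith
    field_simp
  have key : ∀ (n : ℕ) (f : L2R), ∀ᵐ s, s ≤ ((1 + k) / (1 - k)) ^ n →
      (reflOp k M ^ (n + 1)) f s = 0 := by
    intro n
    induction n with
    | zero =>
      intro f
      filter_upwards [ae_reflOp hk hk1 M f] with s hs h
      rw [zero_add, pow_one, hs, indicator_of_notMem]
      intro h'
      rw [pow_zero] at h
      linarith [h'.1]
    | succ n ih =>
      intro f
      have hw := (wbdd_cutComp_univ (I := Ioo (1 + k) M) (a := 0) measurableSet_Ioo hρ).ae_comp (ih f)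
      filter_upwards [ae_reflOp hk hk1 M ((reflOp k M ^ (n + 1)) f), hw] with s hs hw h
      rw [pow_succ', mul_apply_eq_comp, hs]
      by_cases hI : s ∈ Ioo (1 + k) M
      · rw [indicator_of_mem hI]
        have := hw (by simp [hI])
        rw [zero_add] at this
        refine this ?_
        calc (1 - k) / (1 + k) * s
            ≤ (1 - k) / (1 + k) * ((1 + k) / (1 - k)) ^ (n + 1) := by gcongr
          _ = _ := by rw [pow_succ', ← mul_assoc, hρl, one_mul]
      · rw [indicator_of_notMem hI]
  obtain ⟨n, hn⟩ := pow_unbounded_of_one_lt M hlam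
  refine ⟨n + 2, ContinuousLinearMap.ext fun f => ?_⟩
  refine Lp.ext ?_
  filter_upwards [key (n + 1) f, ae_reflOp hk hk1 M ((reflOp k M ^ (n + 1)) f),
    Lp.coeFn_zero ℝ 2 (volume : Measure ℝ)] with s h1 h2 h3
  rw [zero_apply, h3, Pi.zero_apply]
  by_cases hs : s ≤ ((1 + k) / (1 - k)) ^ (n + 1)
  · exact h1 hs
  · rw [pow_succ', mul_apply_eq_comp, h2, indicator_of_notMem]
    intro h
    have : ((1 + k) / (1 - k)) ^ n ≤ ((1 + k) / (1 - k)) ^ (n + 1) :=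
      pow_le_pow_right₀ hlam.le (by simp)
    linarith [h.2]

/-- One minus a nilpotent operator is invertible; S is the inverse. -/
theorem exists_reflOp_resolvent (hk : 0 < k) (hk1 : k < 1) (M : ℝ) :
    ∃ S : L2R →L[ℝ] L2R, ∀ f, S f = f + reflOp k M (S f) := by
  obtain ⟨u, hu⟩ := (reflOp_nilpotent hk hk1 M).isUnit_one_sub
  refine ⟨↑u⁻¹, fun f => ?_⟩
  have := congrArg (fun A : L2R →L[ℝ] L2R => A f) (u.mul_inv)
  simp only [mul_apply_eq_comp, hu, sub_apply, one_apply_eq_self] at this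
  rw [sub_eq_iff_eq_add] at this
  exact this

/-- Profiles of the solution with given initial profiles and given boundary control. -/
theorem exists_profiles (hk : 0 < k) (hk1 : k < 1) :
    ∃ P Q : (L2Omega × L2Omega × L2 (Ioo 0 T)) →L[ℝ] L2R, ∀ p q w,
      slice k 1 0 (P (p, q, w)) = p ∧ slice k (-1) 0 (Q (p, q, w)) = q ∧
      trace k 1 0 T (P (p, q, w)) + trace k (-1) 0 T (Q (p, q, w)) = w ∧
      trace k 1 1 T (P (p, q, w)) + trace k (-1) 1 T (Q (p, q, w)) = 0 := by
  set M := 1 + k * T with hM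
  obtain ⟨S, hS⟩ := exists_reflOp_resolvent hk hk1 M
  let X₁ : L2Omega →L[ℝ] L2R := cutComp (Ioo 1 (1 + k)) (-(1 / k)) (1 / k) _
  let X₂ : L2Omega →L[ℝ] L2R := cutComp (Ioo (1 - k) 1) (1 / k) (-(1 / k)) _
  let X₃ : L2 (Ioo 0 T) →L[ℝ] L2R := cutComp (Ioo 1 M) (-(1 / k)) (1 / k) _
  let X₄ : L2R →L[ℝ] L2R := cutComp (Ioo 1 M) 0 1 _
  -- The condition at y = 0 says Q = w - P on (1, M), where P is p on (1, 1 + k) and minus the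
  -- contracted Q beyond. So Q equals data plus `reflOp` applied to Q, with q placed on (1 - k, 1),
  -- and S solves this equation.
  let Q : (L2Omega × L2Omega × L2 (Ioo 0 T)) →L[ℝ] L2R := S.comp
    (X₂.comp ((ContinuousLinearMap.fst ℝ _ _).comp (ContinuousLinearMap.snd ℝ _ _))
      + X₃.comp ((ContinuousLinearMap.snd ℝ _ _).comp (ContinuousLinearMap.snd ℝ _ _))
      - (X₄.comp X₁).comp (ContinuousLinearMap.fst ℝ _ _))
  let P : (L2Omega × L2Omega × L2 (Ioo 0 T)) →L[ℝ] L2R :=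
    X₁.comp (ContinuousLinearMap.fst ℝ _ _)
      - (cutComp (Ioo (1 + k) ((1 + k) * M)) 0 ((1 - k) / (1 + k)) _).comp Q
  refine ⟨P, Q, fun p q w => ?_⟩
  have hP : P (p, q, w) = rightProfile k M p (Q (p, q, w)) := rfl
  have hQ : Q (p, q, w) = (X₂ q + X₃ w - X₄ (X₁ p)) + reflOp k M (Q (p, q, w)) := hS _
  rw [hP]
  generalize Q (p, q, w) = Q at hQ
  have w1 : ∀ s ∈ Ioo 1 (1 + k), -(1 / k) + 1 / k * s ∈ Ioo (0 : ℝ) 1 := fun s hs => by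
    rw [show -(1 / k) + 1 / k * s = (s - 1) / k by ring]
    exact ⟨div_pos (by linarith [hs.1]) hk, (div_lt_one hk).2 (by linarith [hs.2])⟩
  have w2 : ∀ s ∈ Ioo (1 - k) 1, 1 / k + -(1 / k) * s ∈ Ioo (0 : ℝ) 1 := fun s hs => by
    rw [show 1 / k + -(1 / k) * s = (1 - s) / k by ring]
    exact ⟨div_pos (by linarith [hs.2]) hk, (div_lt_one hk).2 (by linarith [hs.1])⟩
  have w3 : ∀ s ∈ Ioo 1 M, -(1 / k) + 1 / k * s ∈ Ioo (0 : ℝ) T := fun s hs => by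
    rw [show -(1 / k) + 1 / k * s = (s - 1) / k by ring]
    exact ⟨div_pos (by linarith [hs.1]) hk, (div_lt_iff₀ hk).2 (by linarith [hs.2])⟩
  have hQs : ∀ᵐ s, Q s = ((Ioo (1 - k) 1).indicator (fun s => q (1 / k + -(1 / k) * s)) s
      + (Ioo 1 M).indicator (fun s => w (-(1 / k) + 1 / k * s)) s
      - (Ioo 1 M).indicator (fun s =>
          (Ioo 1 (1 + k)).indicator (fun s => p (-(1 / k) + 1 / k * s)) s) s)
      + (Ioo (1 + k) M).indicator (fun s => Q ((1 - k) / (1 + k) * s)) s := by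
    have c2 := ae_cutComp (wbdd_cutComp measurableSet_Ioo
      (neg_ne_zero.2 (by positivity : 1 / k ≠ 0)) w2) q
    have c3 := ae_cutComp (wbdd_cutComp measurableSet_Ioo (by positivity) w3) w
    have c1 := ae_cutComp (wbdd_cutComp measurableSet_Ioo (by positivity) w1) p
    have c4 := ae_cutComp (wbdd_cutComp_univ (I := Ioo 1 M) (a := 0) measurableSet_Ioo
      one_ne_zero) (X₁ p)
    have e1 : Q =ᵐ[volume] ((X₂ q + X₃ w - X₄ (X₁ p)) + reflOp k M Q : L2R) := by
      rw [← hQ]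
    filter_upwards [c1, c2, c3, c4, ae_reflOp hk hk1 M Q, e1,
      Lp.coeFn_add (X₂ q + X₃ w - X₄ (X₁ p)) (reflOp k M Q), Lp.coeFn_sub (X₂ q + X₃ w) (X₄ (X₁ p)),
      Lp.coeFn_add (X₂ q) (X₃ w)] with s c1 c2 c3 c4 c5 e1 e2 e3 e4
    rw [e1, e2, Pi.add_apply, e3, Pi.sub_apply, e4, Pi.add_apply, c5]
    congr 1
    congr 1
    · congr 1
      · by_cases hs : s ∈ Ioo (1 - k) 1
        · rw [indicator_of_mem hs]; exact c2.1 hs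
        · rw [indicator_of_notMem hs]; exact c2.2 hs
      · by_cases hs : s ∈ Ioo 1 M
        · rw [indicator_of_mem hs]; exact c3.1 hs
        · rw [indicator_of_notMem hs]; exact c3.2 hs
    · by_cases hs : s ∈ Ioo 1 M
      · rw [indicator_of_mem hs]
        refine (c4.1 hs).trans ?_
        rw [zero_add, one_mul]
        by_cases hs : s ∈ Ioo 1 (1 + k)
        · rw [indicator_of_mem hs]; exact c1.1 hs
        · rw [indicator_of_notMem hs]; exact c1.2 hs
      · rw [indicator_of_notMem hs]; exact c4.2 hs
  refine ⟨rightProfile_slice hk hk1 M p Q, ?_, ?_, rightProfile_trace hk hk1 p Q⟩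
  · refine slice_eq hk (by norm_num) le_rfl hQs fun y hy h => ?_
    have ha : alpha k 0 * (1 + -1 * k * y) = 1 - k * y := by simp [alpha]; ring
    rw [ha] at h ⊢
    have h1 : 1 - k * y ∈ Ioo (1 - k) 1 := ⟨by nlinarith [hy.2], by nlinarith [hy.1]⟩
    have h2 : 1 - k * y ∉ Ioo 1 M := fun h => by linarith [h.1, h1.2]
    have h3 : 1 - k * y ∉ Ioo (1 + k) M := fun h => by linarith [h.1, h1.2]
    rw [h, indicator_of_mem h1, indicator_of_notMem h2, indicator_of_notMem h2,
      indicator_of_notMem h3, add_zero, add_zero, sub_zero]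
    congr 1
    field_simp
    ring
  · have b1 : 1 + 1 * k * 0 ≠ 0 := by simp
    have b2 : 1 + -1 * k * 0 ≠ 0 := by simp
    refine Lp.ext ?_
    filter_upwards [Lp.coeFn_add (trace k 1 0 T (rightProfile k M p Q)) (trace k (-1) 0 T Q),
      coeFn_trace (T := T) hk b1 (rightProfile k M p Q) .rfl, coeFn_trace (T := T) hk b2 Q .rfl,
      ae_trace (T := T) hk b1 (ae_rightProfile hk hk1 M p Q), ae_trace (T := T) hk b2 hQs,
      ae_restrict_mem measurableSet_Ioo] with t h1 h2 h3 h4 h5 ht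
    rw [h1, Pi.add_apply, h2, h3]
    simp only [mul_zero, add_zero, mul_one] at h4 h5 ⊢
    rw [h4, h5]
    have hα : alpha k t = 1 + k * t := rfl
    have hkt : 0 < k * t := mul_pos hk ht.1
    have hkT : k * t < k * T := by nlinarith [ht.2]
    have m1 : alpha k t ∉ Ioo (1 - k) 1 := fun h => by rw [hα] at h; linarith [h.2]
    have m2 : alpha k t ∈ Ioo 1 M := by rw [hα]; constructor <;> linarith
    -- P is cut off at (1 + k)M and `reflOp` at M. The two agree at α(t), which stays below M.
    have m3 : (Ioo (1 + k) ((1 + k) * M)).indicator (fun s => Q ((1 - k) / (1 + k) * s)) (alpha k t)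
        = (Ioo (1 + k) M).indicator (fun s => Q ((1 - k) / (1 + k) * s)) (alpha k t) := by
      by_cases hs : alpha k t ∈ Ioo (1 + k) M
      · have hs' : alpha k t ∈ Ioo (1 + k) ((1 + k) * M) := ⟨hs.1, by nlinarith [hs.2, hs.1]⟩
        rw [indicator_of_mem hs, indicator_of_mem hs']
      · rw [indicator_of_notMem hs, indicator_of_notMem fun h => hs ⟨h.1, m2.2⟩]
    rw [m3, indicator_of_notMem m1, indicator_of_mem m2, indicator_of_mem m2]
    have : -(1 / k) + 1 / k * alpha k t = t := by rw [hα]; field_simp; ring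
    rw [this]
    ring

/-- Exact controllability, in terms of profiles. -/
theorem exists_profiles_joining (hk : 0 < k) (hk1 : k < 1) (hT : 2 / (1 - k) < T)
    (p q p' q' : L2Omega) :
    ∃ P Q : L2R, slice k 1 0 P = p ∧ slice k (-1) 0 Q = q ∧ slice k 1 T P = p' ∧
      slice k (-1) T Q = q' ∧ trace k 1 1 T P + trace k (-1) 1 T Q = 0 := by
  have h1k : 0 < 1 - k := by linarith
  have hT' : 2 < T * (1 - k) := (div_lt_iff₀ h1k).1 hT
  have hT0 : 0 < T := (by positivity : 0 < 2 / (1 - k)).trans hT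
  set M := 1 + k * T with hM
  -- This is the condition T > 2/(1-k). It gives ρM > 1: the intervals (ρM, M(1-k)) and (M(1-k), M)
  -- on which the final state prescribes Q lie to the right of (1 - k, 1), where the initial state
  -- does.
  have hM1 : 1 + k < M * (1 - k) := by nlinarith
  have hM0 : 0 < M := by positivity
  set ρ := (1 - k) / (1 + k) with hρ
  have hρM : 1 < ρ * M := by
    rw [hρ, div_mul_eq_mul_div, lt_div_iff₀ (by linarith)]; linarith
  have hρM' : ρ * M < M * (1 - k) := by
    rw [hρ, div_mul_eq_mul_div, div_lt_iff₀ (by linarith)]; nlinarith [mul_pos hM0 h1k]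
  have w2 : ∀ s ∈ Ioo (1 - k) 1, 1 / k + -(1 / k) * s ∈ Ioo (0 : ℝ) 1 := fun s hs => by
    rw [show 1 / k + -(1 / k) * s = (1 - s) / k by ring]
    exact ⟨div_pos (by linarith [hs.2]) hk, (div_lt_one hk).2 (by linarith [hs.1])⟩
  have hkM : 0 < k * M := by positivity
  have w4 : ∀ s ∈ Ioo (M * (1 - k)) M, 1 / k + -(1 / (k * M)) * s ∈ Ioo (0 : ℝ) 1 := fun s hs => by
    rw [show 1 / k + -(1 / (k * M)) * s = (M - s) / (k * M) by
      field_simp; ring]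
    exact ⟨div_pos (by linarith [hs.2]) hkM, (div_lt_one hkM).2 (by linarith [hs.1])⟩
  have hρ0 : 0 < ρ := div_pos h1k (by linarith)
  have hρk : ρ * (1 + k) = 1 - k := by rw [hρ]; field_simp
  have w5 : ∀ s ∈ Ioo (ρ * M) (M * (1 - k)), -(1 / k) + 1 / (ρ * (k * M)) * s ∈ Ioo (0 : ℝ) 1 :=
    fun s hs => by
    rw [show -(1 / k) + 1 / (ρ * (k * M)) * s = (s - ρ * M) / (ρ * (k * M)) by field_simp; ring]
    refine ⟨div_pos (by linarith [hs.1]) (by positivity), (div_lt_one (by positivity)).2 ?_⟩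
    have : M * (1 - k) = ρ * M + ρ * (k * M) := by rw [← hρk]; ring
    linarith [hs.2]
  let X₂ : L2R := cutComp (Ioo (1 - k) 1) (1 / k) (-(1 / k)) _ q
  let X₄ : L2R := cutComp (Ioo (M * (1 - k)) M) (1 / k) (-(1 / (k * M))) _ q'
  -- At time T the right wave occupies (M, (1 + k)M), where it is minus Q at the point multiplied by
  -- ρ. So p' prescribes Q on (ρM, M(1-k)) through s = ρM(1 + ky), with the opposite sign. On (1,
  -- ρM) Q is free and is taken to be zero.
  let X₅ : L2R := cutComp (Ioo (ρ * M) (M * (1 - k))) (-(1 / k)) (1 / (ρ * (k * M))) _ p'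
  let Q : L2R := X₂ + X₄ - X₅
  have hQs : ∀ᵐ s, Q s = (Ioo (1 - k) 1).indicator (fun s => q (1 / k + -(1 / k) * s)) s
      + (Ioo (M * (1 - k)) M).indicator (fun s => q' (1 / k + -(1 / (k * M)) * s)) s
      - (Ioo (ρ * M) (M * (1 - k))).indicator (fun s => p' (-(1 / k) + 1 / (ρ * (k * M)) * s)) s := by
    have c2 := ae_cutComp (wbdd_cutComp measurableSet_Ioo
      (neg_ne_zero.2 (by positivity : 1 / k ≠ 0)) w2) q
    have c4 := ae_cutComp (wbdd_cutComp measurableSet_Ioo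
      (neg_ne_zero.2 (by positivity : 1 / (k * M) ≠ 0)) w4) q'
    have c5 := ae_cutComp (wbdd_cutComp measurableSet_Ioo (by positivity) w5) p'
    filter_upwards [c2, c4, c5, Lp.coeFn_sub (X₂ + X₄) X₅, Lp.coeFn_add X₂ X₄]
      with s c2 c4 c5 e3 e4
    rw [e3, Pi.sub_apply, e4, Pi.add_apply]
    congr 1
    · congr 1
      · by_cases hs : s ∈ Ioo (1 - k) 1
        · rw [indicator_of_mem hs]; exact c2.1 hs
        · rw [indicator_of_notMem hs]; exact c2.2 hs
      · by_cases hs : s ∈ Ioo (M * (1 - k)) M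
        · rw [indicator_of_mem hs]; exact c4.1 hs
        · rw [indicator_of_notMem hs]; exact c4.2 hs
    · by_cases hs : s ∈ Ioo (ρ * M) (M * (1 - k))
      · rw [indicator_of_mem hs]; exact c5.1 hs
      · rw [indicator_of_notMem hs]; exact c5.2 hs
  have hαT : alpha k T = M := rfl
  refine ⟨rightProfile k M p Q, Q, rightProfile_slice hk hk1 M p Q, ?_, ?_, ?_,
    rightProfile_trace hk hk1 p Q⟩
  · refine slice_eq hk (by norm_num) le_rfl hQs fun y hy h => ?_
    have ha : alpha k 0 * (1 + -1 * k * y) = 1 - k * y := by simp [alpha]; ring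
    rw [ha] at h ⊢
    have h1 : 1 - k * y ∈ Ioo (1 - k) 1 := ⟨by nlinarith [hy.2], by nlinarith [hy.1]⟩
    have h2 : 1 - k * y ∉ Ioo (M * (1 - k)) M := fun h => by linarith [h.1, h1.2]
    have h3 : 1 - k * y ∉ Ioo (ρ * M) (M * (1 - k)) := fun h => by linarith [h.1, h1.2]
    rw [h, indicator_of_mem h1, indicator_of_notMem h2, indicator_of_notMem h3, add_zero, sub_zero]
    congr 1
    field_simp
    ring
  · have hw := (wbdd_cutComp_univ (I := univ) (a := 0) MeasurableSet.univ hρ0.ne').ae_comp hQs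
    have hb := (ae_rightProfile hk hk1 M p Q).and hw
    refine slice_eq hk (by norm_num) hT0.le hb fun y hy h => ?_
    obtain ⟨h, h'⟩ := h
    have h' := h' (by simp)
    rw [hαT] at h h' ⊢
    have ky : 0 < k * M * y := mul_pos hkM hy.1
    have ky' : k * M * y < k * M := by nlinarith [hy.2]
    have m1 : M * (1 + 1 * k * y) ∉ Ioo 1 (1 + k) := fun h => by
      nlinarith [h.2, mul_pos hM0 hk]
    have m2 : M * (1 + 1 * k * y) ∈ Ioo (1 + k) ((1 + k) * M) := by
      constructor <;> nlinarith [mul_pos hM0 hk]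
    rw [h, indicator_of_notMem m1, indicator_of_mem m2]
    rw [zero_add] at h'
    have r1 : ρ * (M * (1 + 1 * k * y)) = ρ * M + ρ * (k * M * y) := by ring
    have r2 : M * (1 - k) = ρ * M + ρ * (k * M) := by rw [← hρk]; ring
    have n3 : ρ * (M * (1 + 1 * k * y)) ∈ Ioo (ρ * M) (M * (1 - k)) := by
      rw [r1, r2]; constructor <;> nlinarith [mul_pos hρ0 ky]
    have n1 : ρ * (M * (1 + 1 * k * y)) ∉ Ioo (1 - k) 1 := fun h => by linarith [h.2, n3.1]
    have n2 : ρ * (M * (1 + 1 * k * y)) ∉ Ioo (M * (1 - k)) M := fun h => by linarith [h.1, n3.2]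
    rw [h', indicator_of_mem n3, indicator_of_notMem n1, indicator_of_notMem n2]
    rw [add_zero, zero_sub, zero_sub, neg_neg]
    congr 1
    field_simp
    ring
  · refine slice_eq hk (by norm_num) hT0.le hQs fun y hy h => ?_
    rw [hαT] at h ⊢
    have ky : 0 < k * M * y := mul_pos hkM hy.1
    have ky' : k * M * y < k * M := by nlinarith [hy.2]
    have h1 : M * (1 + -1 * k * y) ∈ Ioo (M * (1 - k)) M := ⟨by linarith, by linarith⟩
    have h2 : M * (1 + -1 * k * y) ∉ Ioo (1 - k) 1 := fun h => by linarith [h.2, h1.1]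
    have h3 : M * (1 + -1 * k * y) ∉ Ioo (ρ * M) (M * (1 - k)) := fun h => by linarith [h.2, h1.1]
    rw [h, indicator_of_mem h1, indicator_of_notMem h2, indicator_of_notMem h3, zero_add, sub_zero]
    congr 1
    field_simp
    ring

/-! ### Test functions obtained by reflections -/

section AdjointAlgebra

variable {θ η : ℝ → ℝ → ℝ} {k y t : ℝ}

theorem dy_add (h : SmoothAt 1 θ y t) (h' : SmoothAt 1 η y t) :
    dy (fun y t => θ y t + η y t) y t = dy θ y t + dy η y t :=
  (h.hasDerivAt_y.add h'.hasDerivAt_y).deriv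

theorem dt_add (h : SmoothAt 1 θ y t) (h' : SmoothAt 1 η y t) :
    dt (fun y t => θ y t + η y t) y t = dt θ y t + dt η y t :=
  (h.hasDerivAt_t.add h'.hasDerivAt_t).deriv

theorem SmoothAt.eventually_one (h : SmoothAt 1 θ y t) :
    ∀ᶠ p in 𝓝 (y, t), SmoothAt 1 θ p.1 p.2 := by
  exact_mod_cast SmoothAt.eventually (n := 1) (by exact_mod_cast h)

theorem adjointOp_add (ht : alpha k t ≠ 0) (h : SmoothAt 2 θ y t) (h' : SmoothAt 2 η y t) :
    adjointOp k (fun y t => θ y t + η y t) y t = adjointOp k θ y t + adjointOp k η y t := by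
  have e1 : ∀ᶠ p in 𝓝 (y, t), dt (fun y t => θ y t + η y t) p.1 p.2 = dt θ p.1 p.2 + dt η p.1 p.2 := by
    filter_upwards [h.one.eventually_one, h'.one.eventually_one] with p hp hp' using dt_add hp hp'
  have e2 : ∀ᶠ p in 𝓝 (y, t), beta k p.1 p.2 / alpha k p.2 * dy (fun y t => θ y t + η y t) p.1 p.2
      = beta k p.1 p.2 / alpha k p.2 * dy θ p.1 p.2 + beta k p.1 p.2 / alpha k p.2 * dy η p.1 p.2 := by
    filter_upwards [h.one.eventually_one, h'.one.eventually_one] with p hp hp'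
    rw [dy_add hp hp', mul_add]
  have s1 : SmoothAt 1 (fun y t => gamma k y / alpha k t * θ y t) y t :=
    (smoothAt_coef ht).2.1.mul h.one
  have s2 : SmoothAt 1 (fun y t => gamma k y / alpha k t * η y t) y t :=
    (smoothAt_coef ht).2.1.mul h'.one
  have e3 : ∀ᶠ p in 𝓝 (y, t), dy (fun y t => gamma k y / alpha k t * (θ y t + η y t)) p.1 p.2 =
      dy (fun y t => gamma k y / alpha k t * θ y t) p.1 p.2 +
      dy (fun y t => gamma k y / alpha k t * η y t) p.1 p.2 := by
    filter_upwards [s1.eventually_one, s2.eventually_one] with p hp hp'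
    rw [← dy_add hp hp']
    simp only [mul_add]
  have f1 := (dt_congr (η := fun y t => dt θ y t + dt η y t) e1).self_of_nhds
  have f2 := (dy_congr (θ := fun y t => beta k y t / alpha k t * dy (fun y t => θ y t + η y t) y t)
    (η := fun y t => beta k y t / alpha k t * dy θ y t + beta k y t / alpha k t * dy η y t)
    e2).self_of_nhds
  have f3 := (dt_congr (η := fun y t => dy (fun y t => gamma k y / alpha k t * θ y t) y t +
      dy (fun y t => gamma k y / alpha k t * η y t) y t) e3).self_of_nhds
  unfold adjointOp adjointL
  rw [f1, f2, f3, dt_add h.dt' h'.dt', dy_add (h.flux ht) (h'.flux ht),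
    dt_add (h.drift ht) (h'.drift ht)]
  ring

theorem adjointOp_sum {ι : Type*} (s : Finset ι) (θ : ι → ℝ → ℝ → ℝ) (ht : alpha k t ≠ 0)
    (h : ∀ i, SmoothAt 2 (θ i) y t) :
    adjointOp k (fun y t => ∑ i ∈ s, θ i y t) y t = ∑ i ∈ s, adjointOp k (θ i) y t := by
  classical
  induction s using Finset.induction_on with
  | empty => simp [adjointOp, adjointL, dy, dt]
  | insert a s ha ih =>
    simp only [Finset.sum_insert ha]
    rw [adjointOp_add ht (h a) (ContDiffAt.sum fun i _ => h i), ih]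

theorem smoothAt_product {A B : ℝ → ℝ} (hA : ContDiff ℝ 2 A) (hB : ContDiff ℝ 2 B) :
    SmoothAt 2 (fun y t => alpha k t * (A (alpha k t * (1 + k * y)) * B (alpha k t * (1 - k * y))))
      y t := by
  have h1 : ContDiff ℝ 2 fun p : ℝ × ℝ => alpha k p.2 := by unfold alpha; fun_prop
  have h2 : ContDiff ℝ 2 fun p : ℝ × ℝ => alpha k p.2 * (1 + k * p.1) := by unfold alpha; fun_prop
  have h3 : ContDiff ℝ 2 fun p : ℝ × ℝ => alpha k p.2 * (1 - k * p.1) := by unfold alpha; fun_prop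
  exact (h1.mul ((hA.comp h2).mul (hB.comp h3))).contDiffAt

/-- In characteristic coordinates the prefactor α absorbs the lower order terms of the adjoint
operator, and the mixed derivative remains. The second derivatives of A and B cancel. -/
theorem adjointOp_product {A B A' B' : ℝ → ℝ} (hA : ∀ x, HasDerivAt A (A' x) x)
    (hB : ∀ x, HasDerivAt B (B' x) x) (hA' : ContDiff ℝ 1 A') (hB' : ContDiff ℝ 1 B')
    (ht : 0 < alpha k t) :
    adjointOp k (fun y t =>
        alpha k t * (A (alpha k t * (1 + k * y)) * B (alpha k t * (1 - k * y)))) y t =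
      4 * k ^ 2 * alpha k t * (A' (alpha k t * (1 + k * y)) * B' (alpha k t * (1 - k * y))) := by
  have hA2 : ∀ x, HasDerivAt A' (deriv A' x) x := fun x => (hA'.differentiable (by simp) x).hasDerivAt
  have hB2 : ∀ x, HasDerivAt B' (deriv B' x) x := fun x => (hB'.differentiable (by simp) x).hasDerivAt
  have a1 : ∀ y t, HasDerivAt (fun y => alpha k t * (1 + k * y)) (k * alpha k t) y := fun y t => by
    simpa using hasDerivAt_char_y k 1 y t
  have a2 : ∀ y t, HasDerivAt (fun y => alpha k t * (1 - k * y)) (-(k * alpha k t)) y := fun y t => by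
    have := hasDerivAt_char_y k (-1) y t
    simpa [sub_eq_add_neg] using this
  have b1 : ∀ y t, HasDerivAt (fun t => alpha k t * (1 + k * y)) (k * (1 + k * y)) t := fun y t => by
    simpa using hasDerivAt_char_t k 1 y t
  have b2 : ∀ y t, HasDerivAt (fun t => alpha k t * (1 - k * y)) (k * (1 - k * y)) t := fun y t => by
    have := hasDerivAt_char_t k (-1) y t
    simpa [sub_eq_add_neg] using this
  have hc := hasDerivAt_alpha k
  set θ : ℝ → ℝ → ℝ := fun y t =>
    alpha k t * (A (alpha k t * (1 + k * y)) * B (alpha k t * (1 - k * y))) with hθ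
  have d1 : dt θ = fun y t => k * (A (alpha k t * (1 + k * y)) * B (alpha k t * (1 - k * y))) +
      alpha k t * (k * (1 + k * y) * (A' (alpha k t * (1 + k * y)) * B (alpha k t * (1 - k * y))) +
        k * (1 - k * y) * (A (alpha k t * (1 + k * y)) * B' (alpha k t * (1 - k * y)))) := by
    funext y t
    refine (((hc t).mul (((hA _).comp t (b1 y t)).mul ((hB _).comp t (b2 y t)))).deriv).trans ?_
    simp only [Function.comp, Pi.mul_apply]
    ring
  have d2 : dy θ = fun y t => k * alpha k t ^ 2 *
      (A' (alpha k t * (1 + k * y)) * B (alpha k t * (1 - k * y)) -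
        A (alpha k t * (1 + k * y)) * B' (alpha k t * (1 - k * y))) := by
    funext y t
    refine (((((hA _).comp y (a1 y t)).mul ((hB _).comp y (a2 y t))).const_mul
      (alpha k t)).deriv).trans ?_
    simp only [Function.comp]
    ring
  have e1 : dt (dt θ) y t = 2 * (k * (k * (1 + k * y) *
        (A' (alpha k t * (1 + k * y)) * B (alpha k t * (1 - k * y))) +
        k * (1 - k * y) * (A (alpha k t * (1 + k * y)) * B' (alpha k t * (1 - k * y))))) +
      alpha k t * (k ^ 2 * (1 + k * y) ^ 2 *
          (deriv A' (alpha k t * (1 + k * y)) * B (alpha k t * (1 - k * y))) +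
        2 * (k ^ 2 * (1 + k * y) * (1 - k * y) *
          (A' (alpha k t * (1 + k * y)) * B' (alpha k t * (1 - k * y)))) +
        k ^ 2 * (1 - k * y) ^ 2 *
          (A (alpha k t * (1 + k * y)) * deriv B' (alpha k t * (1 - k * y)))) := by
    rw [d1]
    have cA := (hA _).comp t (b1 y t)
    have cB := (hB _).comp t (b2 y t)
    have cA' := (hA2 _).comp t (b1 y t)
    have cB' := (hB2 _).comp t (b2 y t)
    refine ((((cA.mul cB).const_mul k).add ((hc t).mul (((cA'.mul cB).const_mul (k * (1 + k * y))).add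
      ((cA.mul cB').const_mul (k * (1 - k * y)))))).deriv).trans ?_
    simp only [Function.comp, Pi.mul_apply, Pi.add_apply]
    ring
  have e2 : dy (fun y t => beta k y t / alpha k t * dy θ y t) y t =
      k * (-(2 * k ^ 2 * y) * (A' (alpha k t * (1 + k * y)) * B (alpha k t * (1 - k * y)) -
        A (alpha k t * (1 + k * y)) * B' (alpha k t * (1 - k * y))) +
      (1 - k ^ 2 * y ^ 2) * (k * alpha k t) *
        (deriv A' (alpha k t * (1 + k * y)) * B (alpha k t * (1 - k * y)) -
          2 * (A' (alpha k t * (1 + k * y)) * B' (alpha k t * (1 - k * y))) +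
          A (alpha k t * (1 + k * y)) * deriv B' (alpha k t * (1 - k * y)))) := by
    rw [d2]
    have cA := (hA _).comp y (a1 y t)
    have cB := (hB _).comp y (a2 y t)
    have cA' := (hA2 _).comp y (a1 y t)
    have cB' := (hB2 _).comp y (a2 y t)
    have w : HasDerivAt (fun y : ℝ => beta k y t / alpha k t) (-(2 * k ^ 2 * y) / alpha k t ^ 2) y := by
      have := ((((hasDerivAt_id y).pow 2).const_mul (k ^ 2)).const_sub 1).div_const (alpha k t)
        |>.div_const (alpha k t)
      refine this.congr_deriv ?_
      simp
      field_simp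
    refine ((w.mul (((cA'.mul cB).sub (cA.mul cB')).const_mul (k * alpha k t ^ 2))).deriv).trans ?_
    simp only [Function.comp, Pi.mul_apply, Pi.sub_apply, beta]
    field_simp
    ring
  have e3 : dt (dy (fun y t => gamma k y / alpha k t * θ y t)) y t =
      -2 * k * (k * (1 + k * y) * (A' (alpha k t * (1 + k * y)) * B (alpha k t * (1 - k * y))) +
        k * (1 - k * y) * (A (alpha k t * (1 + k * y)) * B' (alpha k t * (1 - k * y)))) +
      -2 * k * y * (k * (k * (A' (alpha k t * (1 + k * y)) * B (alpha k t * (1 - k * y)) -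
          A (alpha k t * (1 + k * y)) * B' (alpha k t * (1 - k * y)))) +
        k * alpha k t * (k * (1 + k * y) *
            (deriv A' (alpha k t * (1 + k * y)) * B (alpha k t * (1 - k * y)))
          + k * (1 - k * y) * (A' (alpha k t * (1 + k * y)) * B' (alpha k t * (1 - k * y)))
          - k * (1 + k * y) * (A' (alpha k t * (1 + k * y)) * B' (alpha k t * (1 - k * y)))
          - k * (1 - k * y) *
            (A (alpha k t * (1 + k * y)) * deriv B' (alpha k t * (1 - k * y))))) := by
    have hev : (fun s => dy (fun y t => gamma k y / alpha k t * θ y t) y s) =ᶠ[𝓝 t] fun s =>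
        -2 * k * (A (alpha k s * (1 + k * y)) * B (alpha k s * (1 - k * y))) +
        -2 * k * y * (k * alpha k s * (A' (alpha k s * (1 + k * y)) * B (alpha k s * (1 - k * y)) -
          A (alpha k s * (1 + k * y)) * B' (alpha k s * (1 - k * y)))) := by
      filter_upwards [(hc t).continuousAt.eventually (lt_mem_nhds ht)] with s hs
      have cA := (hA _).comp y (a1 y s)
      have cB := (hB _).comp y (a2 y s)
      have w : HasDerivAt (fun y : ℝ => gamma k y / alpha k s) (-2 * k / alpha k s) y := by
        have := ((hasDerivAt_id y).const_mul (-2 * k)).div_const (alpha k s)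
        simpa [gamma] using this
      refine ((w.mul ((cA.mul cB).const_mul (alpha k s))).deriv).trans ?_
      simp only [Function.comp, Pi.mul_apply, gamma]
      field_simp
      ring
    rw [dt, hev.deriv_eq]
    have cA := (hA _).comp t (b1 y t)
    have cB := (hB _).comp t (b2 y t)
    have cA' := (hA2 _).comp t (b1 y t)
    have cB' := (hB2 _).comp t (b2 y t)
    refine ((((cA.mul cB).const_mul (-2 * k)).add ((((hc t).const_mul k).mul
      ((cA'.mul cB).sub (cA.mul cB'))).const_mul (-2 * k * y))).deriv).trans ?_
    simp only [Function.comp, Pi.mul_apply, Pi.sub_apply]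
    ring
  unfold adjointOp adjointL
  rw [e1, e2, e3]
  ring

end AdjointAlgebra

/-! ### Supports of the reflected products -/

section Vanishing

variable {A B : ℝ → ℝ} {l ξ₁ η₁ ξ η : ℝ}

theorem zpow_trichotomy (hl : 1 < l) (n : ℤ) : n = 0 ∨ l ≤ l ^ n ∨ l ≤ (l ^ n)⁻¹ := by
  rcases lt_trichotomy n 0 with h | h | h
  · right; right
    rw [← zpow_neg]
    calc l = l ^ (1 : ℤ) := (zpow_one l).symm
      _ ≤ _ := zpow_le_zpow_right₀ hl.le (by omega)
  · exact Or.inl h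
  · right; left
    calc l = l ^ (1 : ℤ) := (zpow_one l).symm
      _ ≤ _ := zpow_le_zpow_right₀ hl.le (by omega)

/-- A nonzero product would put both rescaled arguments below the thresholds ξ₁ and η₁. For each
sign of n the sector condition η ≤ ξ ≤ lη then forces ξ + η < ξ₁ + η₁. Since ξ + η = 2α(t), this
produces the vanishing of the test function near the final time. -/
theorem reflected_eq_zero (hl : 1 < l) (hA : ∀ x, ξ₁ ≤ x → A x = 0) (hB : ∀ x, η₁ ≤ x → B x = 0)
    (h1 : η₁ ≤ ξ₁) (h2 : ξ₁ ≤ l * η₁) (hη : 0 < η) (hηξ : η ≤ ξ) (hξη : ξ ≤ l * η)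
    (hs : ξ₁ + η₁ ≤ ξ + η) (n : ℤ) :
    A (l ^ n * ξ) * B ((l ^ n)⁻¹ * η) = 0 ∧ A (l ^ n * η) * B ((l ^ n)⁻¹ * ξ) = 0 := by
  have hl0 : 0 < l := by linarith
  have hξ : 0 < ξ := by linarith
  have red : ∀ x y, (l ^ n * x < ξ₁ → (l ^ n)⁻¹ * y < η₁ → False) →
      A (l ^ n * x) * B ((l ^ n)⁻¹ * y) = 0 := by
    intro x y h
    by_cases hx : ξ₁ ≤ l ^ n * x
    · rw [hA _ hx, zero_mul]
    · by_cases hy : η₁ ≤ (l ^ n)⁻¹ * y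
      · rw [hB _ hy, mul_zero]
      · exact (h (not_le.1 hx) (not_le.1 hy)).elim
  have mono : ∀ {c x : ℝ}, 0 < x → l ≤ c → l * x ≤ c * x := fun hx hc => by gcongr
  have lx : ∀ {x : ℝ}, 0 < x → x < l * x := fun hx => by nlinarith
  have cancel : ∀ {x y : ℝ}, l * x < l * y → x < y := fun h => lt_of_mul_lt_mul_left h hl0.le
  refine ⟨red _ _ fun ha hb => ?_, red _ _ fun ha hb => ?_⟩
  · rcases zpow_trichotomy hl n with rfl | h | h
    · simp only [zpow_zero, one_mul, inv_one] at ha hb; linarith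
    · have := cancel (((mono hξ h).trans_lt ha).trans_le h2)
      linarith
    · have := mono hη h
      linarith [lx hη]
  · rcases zpow_trichotomy hl n with rfl | h | h
    · simp only [zpow_zero, one_mul, inv_one] at ha hb; linarith
    · have h3 := mono hη h
      have := cancel ((h3.trans_lt ha).trans_le h2)
      linarith
    · have := mono hξ h
      linarith [lx hξ]

/-- The sector η < ξ < lη is a fundamental domain for the group generated by the reflections in its
two sides, which consists of the maps (ξ, η) ↦ (lⁿξ, l⁻ⁿη) and their compositions with the swap. The
rectangle carrying the bump lies in this sector, so only the identity maps a point of the sector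
into it. -/
theorem reflected_bump_eq_zero {a b : ℝ → ℝ} {ξ₀ η₀ : ℝ} (hl : 1 < l)
    (ha : ∀ x, x ∉ Ioo ξ₀ ξ₁ → a x = 0) (hb : ∀ x, x ∉ Ioo η₀ η₁ → b x = 0)
    (h1 : η₁ ≤ ξ₀) (h2 : ξ₁ ≤ l * η₀) (hη : 0 < η) (hηξ : η < ξ) (hξη : ξ < l * η) (n : ℤ) :
    (n ≠ 0 → a (l ^ n * ξ) * b ((l ^ n)⁻¹ * η) = 0) ∧ a (l ^ n * η) * b ((l ^ n)⁻¹ * ξ) = 0 := by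
  have hl0 : 0 < l := by linarith
  have hξ : 0 < ξ := by linarith
  have hc : 0 < l ^ n := zpow_pos hl0 n
  have red : ∀ x y, (l ^ n * x ∈ Ioo ξ₀ ξ₁ → (l ^ n)⁻¹ * y ∈ Ioo η₀ η₁ → False) →
      a (l ^ n * x) * b ((l ^ n)⁻¹ * y) = 0 := by
    intro x y h
    by_cases hx : l ^ n * x ∈ Ioo ξ₀ ξ₁
    · by_cases hy : (l ^ n)⁻¹ * y ∈ Ioo η₀ η₁
      · exact (h hx hy).elim
      · rw [hb _ hy, mul_zero]
    · rw [ha _ hx, zero_mul]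
  set c := l ^ n with hcdef
  have hci : 0 < c⁻¹ := inv_pos.2 hc
  have hcc : c * c⁻¹ = 1 := mul_inv_cancel₀ hc.ne'
  refine ⟨fun hn => red _ _ fun ha hb => ?_, red _ _ fun ha hb => ?_⟩
  · rcases zpow_trichotomy hl n with h | h | h
    · exact hn h
    · have h3 : l * (c⁻¹ * η) ≤ c * ξ := by
        have : l * (c⁻¹ * η) ≤ c * (c⁻¹ * η) := by gcongr
        rw [← mul_assoc c, hcc, one_mul] at this
        have h5 : η ≤ c * ξ := by nlinarith
        linarith
      have h4 : l * η₀ < l * (c⁻¹ * η) := by have := hb.1; gcongr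
      linarith [ha.2]
    · have h3 : c * ξ ≤ c⁻¹ * η := by
        have : l * (c * ξ) ≤ c⁻¹ * (c * ξ) := by gcongr
        rw [← mul_assoc c⁻¹, mul_comm c⁻¹ c, hcc, one_mul] at this
        have h5 : l * (c * ξ) < l * η := this.trans_lt hξη
        have h6 := lt_of_mul_lt_mul_left h5 hl0.le
        have h7 : l * η ≤ c⁻¹ * η := by gcongr
        nlinarith
      linarith [ha.1, hb.2]
  · rcases zpow_trichotomy hl n with h | h | h
    · have : c = 1 := by rw [hcdef, h, zpow_zero]
      rw [this] at ha hb
      simp only [one_mul, inv_one] at ha hb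
      linarith [ha.1, hb.2]
    · have h3 : l * (c⁻¹ * ξ) ≤ c * (c⁻¹ * ξ) := by gcongr
      rw [← mul_assoc c, hcc, one_mul] at h3
      have h5 : l * η ≤ c * η := by gcongr
      have h4 : l * η₀ < l * (c⁻¹ * ξ) := by have := hb.1; gcongr
      linarith [ha.2]
    · have h3 : c * η ≤ c⁻¹ * ξ := by
        have : l * (c * η) ≤ c⁻¹ * (c * η) := by gcongr
        rw [← mul_assoc c⁻¹, mul_comm c⁻¹ c, hcc, one_mul] at this
        have h7 : l * ξ ≤ c⁻¹ * ξ := by gcongr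
        nlinarith [mul_pos hc hη]
      linarith [ha.1, hb.2]

end Vanishing

/-! ### Uniqueness -/

/-- Integration starts at the right endpoint so that the primitive vanishes for large arguments,
that is, at late times. -/
theorem exists_primitive {a : ℝ → ℝ} (ha : ContDiff ℝ ∞ a) {x₀ x₁ : ℝ}
    (h : ∀ x, x ∉ Ioo x₀ x₁ → a x = 0) :
    ∃ A : ℝ → ℝ, ContDiff ℝ 2 A ∧ (∀ x, HasDerivAt A (a x) x) ∧ ∀ x, x₁ ≤ x → A x = 0 := by
  have hd : ∀ x, HasDerivAt (fun x => ∫ z in x₁..x, a z) (a x) x := fun x =>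
    (ha.continuous.integral_hasStrictDerivAt x₁ x).hasDerivAt
  refine ⟨fun x => ∫ z in x₁..x, a z, ?_, hd, fun x hx => ?_⟩
  · have h1 : ContDiff ℝ (1 + 1) fun x => ∫ z in x₁..x, a z := by
      rw [contDiff_succ_iff_deriv]
      refine ⟨fun x => (hd x).differentiableAt, by simp, ?_⟩
      rw [show deriv (fun x => ∫ z in x₁..x, a z) = a from funext fun x => (hd x).deriv]
      exact ha.of_le (by simp)
    rwa [one_add_one_eq_two] at h1
  · refine intervalIntegral.integral_zero_ae (.of_forall fun z hz => h z fun hz' => ?_)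
    rw [uIoc_of_le hx] at hz
    exact lt_asymm hz.1 hz'.2

/-- A test function whose image under the adjoint operator is a bump function, in characteristic
coordinates. -/
theorem exists_test {k T : ℝ} (hk : 0 < k) (hk1 : k < 1) (hT : 0 < T) {a b : ℝ → ℝ}
    {ξ₀ ξ₁ η₀ η₁ : ℝ} (hac : ContDiff ℝ ∞ a) (hbc : ContDiff ℝ ∞ b)
    (ha : ∀ x, x ∉ Ioo ξ₀ ξ₁ → a x = 0) (hb : ∀ x, x ∉ Ioo η₀ η₁ → b x = 0)
    (h0 : ξ₀ ≤ ξ₁) (h0' : η₀ ≤ η₁)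
    (h1 : η₁ ≤ ξ₀) (h2 : (1 - k) * ξ₁ ≤ (1 + k) * η₀) (h3 : ξ₁ + η₁ < 2 * (1 + k * T)) :
    ∃ θ : AdjointTest T, ∀ y ∈ Ioo (0 : ℝ) 1, ∀ t ∈ Ioo 0 T, adjointOp k θ.toFun y t =
      4 * k ^ 2 * alpha k t * (a (alpha k t * (1 + k * y)) * b (alpha k t * (1 - k * y))) := by
  obtain ⟨A, hA2, hAd, hA0⟩ := exists_primitive hac ha
  obtain ⟨B, hB2, hBd, hB0⟩ := exists_primitive hbc hb
  have hk1' : 0 < 1 - k := by linarith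
  set l := (1 + k) / (1 - k) with hl
  have hl1 : 1 < l := by rw [hl, lt_div_iff₀ hk1']; linarith
  have hl0 : 0 < l := by linarith
  have hle : l * (1 - k) = 1 + k := by rw [hl]; field_simp
  have h2' : ξ₁ ≤ l * η₀ := by
    rw [hl, div_mul_eq_mul_div, le_div_iff₀ hk1']; linarith
  have h2'' : ξ₁ ≤ l * η₁ := h2'.trans (by gcongr)
  have hα : ∀ t, 0 ≤ t → 0 < alpha k t := fun t ht => zero_lt_one.trans_le (one_le_alpha hk ht)
  -- N is so large that the outermost reflected terms, with factors of size at least lᴺ, vanish on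
  -- the side y = 1. The exponents j - N below run from -N to N.
  obtain ⟨N, hN⟩ := pow_unbounded_of_one_lt (ξ₁ / (1 - k)) hl1
  have hNξ : ξ₁ < l ^ N * (1 - k) := (div_lt_iff₀ hk1').1 hN
  let c : ℕ → ℝ := fun j => l ^ ((j : ℤ) - N)
  have hc : ∀ j, 0 < c j := fun j => zpow_pos hl0 _
  let U : ℕ → ℝ → ℝ → ℝ := fun j y t =>
    alpha k t * (A (c j * (alpha k t * (1 + k * y))) * B ((c j)⁻¹ * (alpha k t * (1 - k * y))))
  -- Minus the term `U j` with ξ and η exchanged, so that the sum vanishes on y = 0, where ξ = η.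
  let V : ℕ → ℝ → ℝ → ℝ := fun j y t =>
    alpha k t * ((-B ((c j)⁻¹ * (alpha k t * (1 + k * y)))) * A (c j * (alpha k t * (1 - k * y))))
  have hAc : ∀ r : ℝ, ContDiff ℝ 2 fun x => A (r * x) := fun r =>
    hA2.comp (contDiff_const.mul contDiff_id)
  have hBc : ∀ r : ℝ, ContDiff ℝ 2 fun x => B (r * x) := fun r =>
    hB2.comp (contDiff_const.mul contDiff_id)
  have sU : ∀ j y t, SmoothAt 2 (U j) y t := fun j y t => smoothAt_product (hAc _) (hBc _)
  have sV : ∀ j y t, SmoothAt 2 (V j) y t := fun j y t => smoothAt_product (hBc _).neg (hAc _)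
  let W : ℕ → ℝ → ℝ → ℝ := fun j y t => U j y t + V j y t
  have sW : ∀ j y t, SmoothAt 2 (W j) y t := fun j y t => (sU j y t).add (sV j y t)
  have hWval : ∀ j y t, W j y t = alpha k t *
      (A (c j * (alpha k t * (1 + k * y))) * B ((c j)⁻¹ * (alpha k t * (1 - k * y)))
        - A (c j * (alpha k t * (1 - k * y))) * B ((c j)⁻¹ * (alpha k t * (1 + k * y)))) :=
    fun j y t => by simp only [W, U, V]; ring
  have hfin : ∀ y ∈ Icc (0 : ℝ) 1, ∀ t, 0 ≤ t → ξ₁ + η₁ ≤ 2 * alpha k t → ∀ j, W j y t = 0 := by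
    intro y hy t ht hs j
    have hky : k * y ≤ k := by nlinarith [hy.2]
    have hky0 : 0 ≤ k * y := mul_nonneg hk.le hy.1
    obtain ⟨e1, e2⟩ := reflected_eq_zero hl1 hA0 hB0 (h1.trans h0) h2''
      (ξ := alpha k t * (1 + k * y)) (η := alpha k t * (1 - k * y))
      (mul_pos (hα t ht) (by linarith)) (mul_le_mul_of_nonneg_left (by linarith) (hα t ht).le)
      (by
        rw [mul_left_comm]
        refine mul_le_mul_of_nonneg_left ?_ (hα t ht).le
        rw [hl, div_mul_eq_mul_div, le_div_iff₀ hk1']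
        nlinarith)
      (by linarith) ((j : ℤ) - N)
    rw [hWval, e1, e2, sub_zero, mul_zero]
  refine ⟨⟨fun y t => ∑ j ∈ Finset.range (2 * N + 1), W j y t,
    fun y _ t _ => ContDiffAt.sum fun j _ => sW j y t, fun t _ => ?_, fun t ht => ?_,
    fun y hy => ?_, fun y hy => ?_⟩, fun y hy t ht => ?_⟩
  · refine Finset.sum_eq_zero fun j _ => ?_
    rw [hWval]
    simp
  · have hη : (1 - k) ≤ alpha k t * (1 - k) := by
      nlinarith [one_le_alpha hk ht.1]
    -- On y = 1 one has ξ = lη, so the direct part of term j is the exchanged part of term j + 1 up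
    -- to sign, and the sum telescopes.
    let F : ℕ → ℝ := fun j => A (c j * (alpha k t * (1 - k))) *
      B ((c j)⁻¹ * (l * (alpha k t * (1 - k))))
    have hF : ∀ j, W j 1 t = alpha k t * (F (j + 1) - F j) := by
      intro j
      have e1 : alpha k t * (1 + k * 1) = l * (alpha k t * (1 - k)) := by
        rw [mul_one, ← hle]; ring
      have e2 : c (j + 1) = c j * l := by
        simp only [c]
        rw [show ((j + 1 : ℕ) : ℤ) - N = ((j : ℤ) - N) + 1 by push_cast; ring,
          zpow_add_one₀ hl0.ne']
      have e3 : (c j * l)⁻¹ * (l * (alpha k t * (1 - k))) = (c j)⁻¹ * (alpha k t * (1 - k)) := by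
        rw [mul_inv, mul_assoc, inv_mul_cancel_left₀ hl0.ne']
      rw [hWval, e1]
      simp only [F]
      rw [e2, e3, mul_one, mul_assoc (c j) l]
    simp only [hF]
    rw [← Finset.mul_sum, Finset.sum_range_sub]
    have hN' : ξ₁ ≤ l ^ N * (alpha k t * (1 - k)) := hNξ.le.trans (by gcongr)
    have hpos : 0 < l ^ N * (alpha k t * (1 - k)) :=
      mul_pos (pow_pos hl0 N) (mul_pos (hα t ht.1) hk1')
    have z1 : F (2 * N + 1) = 0 := by
      have : c (2 * N + 1) = l * l ^ N := by
        simp only [c]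
        rw [show ((2 * N + 1 : ℕ) : ℤ) - N = (N + 1 : ℕ) by push_cast; ring, zpow_natCast, pow_succ']
      simp only [F]
      rw [this, hA0 _ (by rw [mul_assoc]; nlinarith), zero_mul]
    have z2 : F 0 = 0 := by
      have : (c 0)⁻¹ = l ^ N := by
        simp only [c]
        rw [← zpow_neg, show -(((0 : ℕ) : ℤ) - N) = (N : ℕ) by push_cast; ring, zpow_natCast]
      simp only [F]
      rw [this, hB0 _ (by rw [mul_left_comm]; nlinarith [h1.trans h0]), mul_zero]
    rw [z1, z2, sub_zero, mul_zero]
  · exact Finset.sum_eq_zero fun j _ => hfin y hy T hT.le (by unfold alpha; linarith) j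
  · have hev : (fun t => ∑ j ∈ Finset.range (2 * N + 1), W j y t) =ᶠ[𝓝 T] fun _ => 0 := by
      have hlim : ∀ᶠ t in 𝓝 T, ξ₁ + η₁ < 2 * alpha k t :=
        (((hasDerivAt_alpha k T).continuousAt.const_mul 2)).eventually
          (lt_mem_nhds (by unfold alpha; linarith))
      filter_upwards [hlim, lt_mem_nhds hT] with t h h'
      exact Finset.sum_eq_zero fun j _ => hfin y hy t h'.le h.le j
    rw [dt, hev.deriv_eq, deriv_const]
  · have ht0 := hα t ht.1.le
    change adjointOp k (fun y t => ∑ j ∈ Finset.range (2 * N + 1), W j y t) y t = _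
    rw [adjointOp_sum _ _ ht0.ne' fun j => sW j y t]
    have hky : k * y < k := by nlinarith [hy.2]
    have hky0 : 0 < k * y := mul_pos hk hy.1
    have hAcd : ∀ r x : ℝ, HasDerivAt (fun x => A (r * x)) (r * a (r * x)) x := fun r x => by
      have := (hAd (r * x)).comp x ((hasDerivAt_id x).const_mul r)
      refine this.congr_deriv ?_
      simp [mul_comm]
    have hBcd : ∀ r x : ℝ, HasDerivAt (fun x => B (r * x)) (r * b (r * x)) x := fun r x => by
      have := (hBd (r * x)).comp x ((hasDerivAt_id x).const_mul r)
      refine this.congr_deriv ?_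
      simp [mul_comm]
    have hacd : ∀ r : ℝ, ContDiff ℝ 1 fun x => r * a (r * x) := fun r =>
      contDiff_const.mul ((hac.of_le (by simp)).comp (contDiff_const.mul contDiff_id))
    have hbcd : ∀ r : ℝ, ContDiff ℝ 1 fun x => r * b (r * x) := fun r =>
      contDiff_const.mul ((hbc.of_le (by simp)).comp (contDiff_const.mul contDiff_id))
    have hW : ∀ j, adjointOp k (W j) y t = 4 * k ^ 2 * alpha k t *
        (a (c j * (alpha k t * (1 + k * y))) * b ((c j)⁻¹ * (alpha k t * (1 - k * y)))
          - a (c j * (alpha k t * (1 - k * y))) * b ((c j)⁻¹ * (alpha k t * (1 + k * y)))) := by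
      intro j
      have hcc : c j * (c j)⁻¹ = 1 := mul_inv_cancel₀ (hc j).ne'
      have eV : adjointOp k (V j) y t = 4 * k ^ 2 * alpha k t *
          (-((c j)⁻¹ * b ((c j)⁻¹ * (alpha k t * (1 + k * y)))) *
            (c j * a (c j * (alpha k t * (1 - k * y))))) :=
        adjointOp_product (A := fun x => -B ((c j)⁻¹ * x))
          (A' := fun x => -((c j)⁻¹ * b ((c j)⁻¹ * x))) (B := fun x => A (c j * x))
          (B' := fun x => c j * a (c j * x)) (fun x => (hBcd _ x).neg) (hAcd _) (hbcd _).neg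
          (hacd _) ht0
      rw [adjointOp_add ht0.ne' (sU j y t) (sV j y t),
        adjointOp_product (hAcd _) (hBcd _) (hacd _) (hbcd _) ht0, eV]
      linear_combination (4 * k ^ 2 * alpha k t *
        (a (c j * (alpha k t * (1 + k * y))) * b ((c j)⁻¹ * (alpha k t * (1 - k * y)))
          - a (c j * (alpha k t * (1 - k * y))) * b ((c j)⁻¹ * (alpha k t * (1 + k * y))))) * hcc
    have hbump := fun j : ℕ => reflected_bump_eq_zero hl1 ha hb h1 h2'
      (ξ := alpha k t * (1 + k * y)) (η := alpha k t * (1 - k * y))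
      (mul_pos ht0 (by linarith)) (mul_lt_mul_of_pos_left (by linarith) ht0)
      (by
        rw [mul_left_comm]
        refine mul_lt_mul_of_pos_left ?_ ht0
        rw [hl, div_mul_eq_mul_div, lt_div_iff₀ hk1']
        nlinarith) ((j : ℤ) - N)
    -- The index N has factor l⁰ = 1: only the unreflected product contributes inside the rectangle.
    rw [Finset.sum_eq_single N]
    · rw [hW, (hbump N).2]
      simp [c]
    · intro j _ hj
      rw [hW, (hbump j).1 (by intro h; apply hj; omega), (hbump j).2, sub_zero, mul_zero]
    · intro h
      exact (h (Finset.mem_range.2 (by omega))).elim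

/-! ### A smooth partition of unity on the line -/

/-- A smooth bump function supported in `[-1,1]`, whose integer translates sum to one. -/
def hat (x : ℝ) : ℝ := Real.smoothTransition (x + 1) - Real.smoothTransition x

theorem hat_contDiff : ContDiff ℝ ∞ hat :=
  (Real.smoothTransition.contDiff.comp (contDiff_id.add contDiff_const)).sub
    Real.smoothTransition.contDiff

theorem hat_eq_zero {x : ℝ} (hx : x ∉ Ioo (-1 : ℝ) 1) : hat x = 0 := by
  unfold hat
  rw [mem_Ioo, not_and_or, not_lt, not_lt] at hx
  rcases hx with h | h
  · rw [Real.smoothTransition.zero_of_nonpos (by linarith),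
      Real.smoothTransition.zero_of_nonpos (by linarith), sub_zero]
  · rw [Real.smoothTransition.one_of_one_le (by linarith),
      Real.smoothTransition.one_of_one_le h, sub_self]

theorem hat_nonneg (x : ℝ) : 0 ≤ hat x :=
  sub_nonneg.2 (Real.smoothTransition.monotone (by linarith))

theorem hat_sum (N : ℕ) (x : ℝ) : ∑ j ∈ Finset.range (2 * N + 1), hat (x - ((j : ℝ) - N)) =
    Real.smoothTransition (x + N + 1) - Real.smoothTransition (x - N) := by
  have := Finset.sum_range_sub' (fun j : ℕ => Real.smoothTransition (x - ((j : ℝ) - N) + 1))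
    (2 * N + 1)
  have e : ∀ j : ℕ, hat (x - ((j : ℝ) - N)) =
      Real.smoothTransition (x - ((j : ℝ) - N) + 1) -
        Real.smoothTransition (x - (((j + 1 : ℕ) : ℝ) - N) + 1) := fun j => by
    unfold hat
    congr 2
    push_cast; ring
  simp only [e]
  rw [this]
  congr 2
  · push_cast; ring
  · push_cast; ring

theorem hat_sum_le (N : ℕ) (x : ℝ) :
    ∑ j ∈ Finset.range (2 * N + 1), hat (x - ((j : ℝ) - N)) ≤ 1 := by
  rw [hat_sum]
  linarith [Real.smoothTransition.le_one (x + N + 1), Real.smoothTransition.nonneg (x - N)]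

theorem hat_sum_eq {N : ℕ} {x : ℝ} (hx : |x| ≤ N) :
    ∑ j ∈ Finset.range (2 * N + 1), hat (x - ((j : ℝ) - N)) = 1 := by
  rw [hat_sum, Real.smoothTransition.one_of_one_le (by linarith [neg_le_of_abs_le hx]),
    Real.smoothTransition.zero_of_nonpos (by linarith [le_of_abs_le hx]), sub_zero]

/-- Uniform approximation of a compactly supported function by sums of products of bumps. -/
theorem exists_approx {g : ℝ × ℝ → ℝ} (hg : Continuous g) (hgs : HasCompactSupport g)
    {U : Set (ℝ × ℝ)} (hU : IsOpen U) (hgU : tsupport g ⊆ U) {ε : ℝ} (hε : 0 < ε) :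
    ∃ r : ℝ, 0 < r ∧ ∃ s : Finset (ℝ × ℝ),
      (∀ p ∈ s, Icc (p.1 - r) (p.1 + r) ×ˢ Icc (p.2 - r) (p.2 + r) ⊆ U) ∧
      ∀ x, |g x - ∑ p ∈ s, g p * (hat ((x.1 - p.1) / r) * hat ((x.2 - p.2) / r))| ≤ ε := by
  classical
  have huc := hgs.uniformContinuous_of_continuous hg
  rw [Metric.uniformContinuous_iff] at huc
  obtain ⟨δ, hδ, hgδ⟩ := huc ε hε
  obtain ⟨δ', hδ', hUδ⟩ := hgs.isCompact.exists_cthickening_subset_open hU hgU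
  set r := min (δ / 2) δ' with hr
  have hr0 : 0 < r := lt_min (by positivity) hδ'
  obtain ⟨R, hR⟩ := hgs.isCompact.isBounded.exists_norm_le
  obtain ⟨N, hN⟩ := exists_nat_ge (R / r)
  have hNR : R ≤ N * r := (div_le_iff₀ hr0).1 hN
  let P : ℕ × ℕ → ℝ × ℝ := fun j => (r * ((j.1 : ℝ) - N), r * ((j.2 : ℝ) - N))
  have hP : Function.Injective P := by
    rintro ⟨i, j⟩ ⟨i', j'⟩ h
    simp only [P, Prod.mk.injEq, mul_eq_mul_left_iff, hr0.ne', or_false, sub_left_inj,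
      Nat.cast_inj] at h
    exact Prod.ext h.1 h.2
  let s₀ : Finset (ℝ × ℝ) :=
    (Finset.range (2 * N + 1) ×ˢ Finset.range (2 * N + 1)).image P
  -- Nodes with g = 0 are dropped. The others lie in the support of g, so the squares of radius r ≤
  -- δ' around them stay in U.
  refine ⟨r, hr0, s₀.filter fun p => g p ≠ 0, fun p hp => ?_, fun x => ?_⟩
  · rw [Finset.mem_filter] at hp
    refine Subset.trans (fun q hq => ?_) hUδ
    refine Metric.mem_cthickening_of_dist_le q p δ' _ (subset_tsupport _ hp.2) ?_
    rw [Prod.dist_eq, Real.dist_eq, Real.dist_eq]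
    have hrδ : r ≤ δ' := min_le_right _ _
    refine max_le ?_ ?_ <;> rw [abs_le] <;> constructor <;>
      linarith [hq.1.1, hq.1.2, hq.2.1, hq.2.2]
  · rw [Finset.sum_filter_of_ne fun p _ h => left_ne_zero_of_mul h]
    let H : ℝ × ℝ → ℝ := fun p => hat ((x.1 - p.1) / r) * hat ((x.2 - p.2) / r)
    have hH0 : ∀ p, 0 ≤ H p := fun p => mul_nonneg (hat_nonneg _) (hat_nonneg _)
    have hHs : ∑ p ∈ s₀, H p = (∑ j ∈ Finset.range (2 * N + 1), hat (x.1 / r - ((j : ℝ) - N))) *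
        ∑ j ∈ Finset.range (2 * N + 1), hat (x.2 / r - ((j : ℝ) - N)) := by
      rw [Finset.sum_image fun a _ b _ h => hP h, Finset.sum_mul_sum, Finset.sum_product]
      refine Finset.sum_congr rfl fun i _ => Finset.sum_congr rfl fun j _ => ?_
      simp only [H, P]
      congr 2 <;> field_simp
    have hH1 : ∑ p ∈ s₀, H p ≤ 1 := by
      rw [hHs]
      exact mul_le_one₀ (hat_sum_le N _) (Finset.sum_nonneg fun _ _ => hat_nonneg _)
        (hat_sum_le N _)
    have hgH : g x * (∑ p ∈ s₀, H p) = g x := by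
      by_cases hx : g x = 0
      · rw [hx, zero_mul]
      · have hxR := hR x (subset_tsupport _ hx)
        have h1 : ∀ z : ℝ, |z| ≤ ‖x‖ → |z / r| ≤ N := fun z hz => by
          rw [abs_div, abs_of_pos hr0, div_le_iff₀ hr0]
          linarith
        rw [hHs, hat_sum_eq (h1 x.1 (norm_fst_le x)), hat_sum_eq (h1 x.2 (norm_snd_le x)),
          mul_one, mul_one]
    have hterm : ∀ p ∈ s₀, |(g x - g p) * H p| ≤ ε * H p := by
      intro p _
      rw [abs_mul, abs_of_nonneg (hH0 p)]
      by_cases h : H p = 0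
      · rw [h, mul_zero, mul_zero]
      · refine mul_le_mul_of_nonneg_right ?_ (hH0 p)
        have n1 : ∀ u : ℝ, hat (u / r) ≠ 0 → |u| < δ := fun u hu => by
          have : u / r ∈ Ioo (-1 : ℝ) 1 := by
            by_contra h'
            exact hu (hat_eq_zero h')
          have h1 : |u / r| < 1 := abs_lt.2 this
          rw [abs_div, abs_of_pos hr0, div_lt_one hr0] at h1
          linarith [min_le_left (δ / 2) δ']
        refine (hgδ ?_).le
        rw [Prod.dist_eq, Real.dist_eq, Real.dist_eq]
        exact max_lt (n1 _ (left_ne_zero_of_mul h)) (n1 _ (right_ne_zero_of_mul h))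
    calc |g x - ∑ p ∈ s₀, g p * H p| = |∑ p ∈ s₀, (g x - g p) * H p| := by
          congr 1
          simp only [sub_mul]
          rw [Finset.sum_sub_distrib, ← Finset.mul_sum, hgH]
      _ ≤ ∑ p ∈ s₀, |(g x - g p) * H p| := Finset.abs_sum_le_sum_abs _ _
      _ ≤ ∑ p ∈ s₀, ε * H p := Finset.sum_le_sum hterm
      _ = ε * ∑ p ∈ s₀, H p := by rw [Finset.mul_sum]
      _ ≤ ε * 1 := by gcongr
      _ = ε := mul_one ε

/-! ### Pairing a curve in L² with functions of the characteristic coordinates -/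

/-- By compactness t ↦ G(·, t) is continuous for uniform convergence, hence in L². The integral is
the inner product of two continuous curves. -/
theorem continuousOn_integral_mul {T : ℝ} {z : ℝ → L2Omega} (hz : ContinuousOn z (Icc 0 T))
    {G : ℝ → ℝ → ℝ} (hG : ContinuousOn (fun p : ℝ × ℝ => G p.1 p.2) (Icc 0 1 ×ˢ Icc 0 T)) :
    ContinuousOn (fun t => ∫ y in Ioo (0 : ℝ) 1, z t y * G y t) (Icc 0 T) := by
  have hGt : ∀ t ∈ Icc 0 T, MemLp (fun y => G y t) 2 (volume.restrict (Ioo (0 : ℝ) 1)) :=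
    fun t ht => memLp_of_contOn (hG.comp (f := fun y : ℝ => (y, t))
      (continuous_id.prodMk continuous_const).continuousOn fun y hy => ⟨hy, ht⟩)
  rw [continuousOn_iff_continuous_domRestrict] at hz ⊢
  have hΓ : Continuous fun t : Icc 0 T => (hGt t t.2).toLp := by
    rw [continuous_iff_continuousAt]
    intro t
    rw [ContinuousAt, Metric.tendsto_nhds]
    intro ε hε
    have hsw : ContinuousOn (Function.uncurry fun t y => G y t) (Icc 0 T ×ˢ Icc 0 1) :=
      hG.comp continuous_swap.continuousOn fun p hp => ⟨hp.2, hp.1⟩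
    obtain ⟨u, hu, hu'⟩ := isCompact_Icc.mem_uniformity_of_prod hsw t.2
      (Metric.dist_mem_uniformity (half_pos hε))
    rw [nhdsWithin_eq_map_subtype_coe t.2, mem_map] at hu
    filter_upwards [hu] with s hs
    rw [dist_eq_norm]
    refine lt_of_le_of_lt (norm_L2Omega_le (half_pos hε).le ?_) (half_lt_self hε)
    filter_upwards [ae_restrict_mem measurableSet_Ioo,
      Lp.coeFn_sub (hGt s s.2).toLp (hGt t t.2).toLp, (hGt s s.2).coeFn_toLp,
      (hGt t t.2).coeFn_toLp] with y hy h1 h2 h3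
    rw [h1, Pi.sub_apply, h2, h3, ← dist_eq_norm]
    exact (hu' s hs y (Ioo_subset_Icc_self hy)).le
  refine (hz.inner hΓ).congr fun t => ?_
  exact (integral_inner_left (z t) (hGt t t.2)).symm

theorem integrableOn_integral_mul {T : ℝ} {z : ℝ → L2Omega} (hz : ContinuousOn z (Icc 0 T))
    {G : ℝ → ℝ → ℝ} (hG : ContinuousOn (fun p : ℝ × ℝ => G p.1 p.2) (Icc 0 1 ×ˢ Icc 0 T)) :
    IntegrableOn (fun t => ∫ y in Ioo (0 : ℝ) 1, z t y * G y t) (Ioo 0 T) :=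
  integrableOn_Ioo (continuousOn_integral_mul hz hG)

theorem integral_mul_add {f : L2Omega} {G H : ℝ → ℝ} (hG : ContinuousOn G (Icc 0 1))
    (hH : ContinuousOn H (Icc 0 1)) :
    ∫ y in Ioo (0 : ℝ) 1, f y * (G y + H y) =
      (∫ y in Ioo (0 : ℝ) 1, f y * G y) + ∫ y in Ioo (0 : ℝ) 1, f y * H y := by
  have hi : ∀ {F : ℝ → ℝ}, ContinuousOn F (Icc 0 1) →
      Integrable (fun y => f y * F y) (volume.restrict (Ioo (0 : ℝ) 1)) := fun hF =>
    (Lp.memLp f).integrable_mul (memLp_of_contOn hF)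
  simp only [mul_add]
  exact integral_add (hi hG) (hi hH)

theorem integral_sub_mul {f f' : L2Omega} {G : ℝ → ℝ} (hG : ContinuousOn G (Icc 0 1)) :
    ∫ y in Ioo (0 : ℝ) 1, (f - f' : L2Omega) y * G y =
      (∫ y in Ioo (0 : ℝ) 1, f y * G y) - ∫ y in Ioo (0 : ℝ) 1, f' y * G y := by
  rw [integral_inner_left _ (memLp_of_contOn hG), integral_inner_left _ (memLp_of_contOn hG),
    integral_inner_left _ (memLp_of_contOn hG), inner_sub_left]

/-- A function of the characteristic coordinates, as a function of `(y,t)`. -/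
def charWeight (k : ℝ) (g : C(ℝ × ℝ, ℝ)) (y t : ℝ) : ℝ :=
  alpha k t * g (alpha k t * (1 + k * y), alpha k t * (1 - k * y))

theorem continuous_charWeight (k : ℝ) (g : C(ℝ × ℝ, ℝ)) :
    Continuous fun p : ℝ × ℝ => charWeight k g p.1 p.2 := by
  unfold charWeight alpha
  fun_prop

theorem continuous_charWeight_left (k : ℝ) (g : C(ℝ × ℝ, ℝ)) (t : ℝ) :
    Continuous fun y => charWeight k g y t :=
  (continuous_charWeight k g).comp (continuous_id.prodMk continuous_const)

/-- The pairing of a curve in `L²(0,1)` with functions of the characteristic coordinates. -/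
def charPairing (k : ℝ) {T : ℝ} {z : ℝ → L2Omega} (hz : ContinuousOn z (Icc 0 T)) :
    C(ℝ × ℝ, ℝ) →ₗ[ℝ] ℝ where
  toFun g := ∫ t in Ioo 0 T, ∫ y in Ioo (0 : ℝ) 1, z t y * charWeight k g y t
  map_add' g h := by
    rw [← integral_add (integrableOn_integral_mul hz (continuous_charWeight k g).continuousOn)
      (integrableOn_integral_mul hz (continuous_charWeight k h).continuousOn)]
    congr 1 with t
    rw [← integral_mul_add (continuous_charWeight_left k g t).continuousOn
      (continuous_charWeight_left k h t).continuousOn]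
    simp only [charWeight, ContinuousMap.add_apply, mul_add]
  map_smul' c g := by
    rw [RingHom.id_apply, smul_eq_mul, ← integral_const_mul]
    congr 1 with t
    rw [← integral_const_mul]
    congr 1 with y
    simp only [charWeight, ContinuousMap.smul_apply, smul_eq_mul]
    ring

/-- A bound in the supremum norm, so that the vanishing of the pairing survives uniform
approximation. -/
theorem exists_abs_charPairing_le {k T : ℝ} (hk : 0 < k) (hT : 0 < T) {z : ℝ → L2Omega}
    (hz : ContinuousOn z (Icc 0 T)) :
    ∃ C : ℝ, 0 ≤ C ∧ ∀ (g : C(ℝ × ℝ, ℝ)) (ε : ℝ), 0 ≤ ε → (∀ x, |g x| ≤ ε) →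
      |charPairing k hz g| ≤ C * ε := by
  obtain ⟨D, hD⟩ := isCompact_Icc.exists_bound_of_continuousOn hz
  have hD0 : 0 ≤ D := (norm_nonneg _).trans (hD 0 ⟨le_rfl, hT.le⟩)
  have hM : 0 ≤ alpha k T := zero_le_one.trans (one_le_alpha hk hT.le)
  refine ⟨D * alpha k T * T, by positivity, fun g ε hε hg => ?_⟩
  have hb := norm_setIntegral_le_of_norm_le_const (μ := volume) (s := Ioo 0 T)
    (f := fun t => ∫ y in Ioo (0 : ℝ) 1, z t y * charWeight k g y t) (C := D * (alpha k T * ε))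
    (by simp) fun t ht => by
      have hα := one_le_alpha hk ht.1.le
      have hα' : alpha k t ≤ alpha k T := by unfold alpha; nlinarith [ht.2]
      have hm := memLp_of_contOn (continuous_charWeight_left k g t).continuousOn
      rw [integral_inner_left _ hm]
      refine (norm_inner_le_norm _ _).trans (mul_le_mul (hD t (Ioo_subset_Icc_self ht))
        (norm_L2Omega_le (by positivity) ?_) (norm_nonneg _) hD0)
      filter_upwards [hm.coeFn_toLp] with y hy
      rw [hy, charWeight, Real.norm_eq_abs, abs_mul, abs_of_pos (by linarith)]
      exact mul_le_mul hα' (hg _) (abs_nonneg _) hM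
  refine hb.trans (le_of_eq ?_)
  simp [measureReal_def, hT.le]
  ring

/-- An open set that contains the characteristic coordinates of the points of `(0,1) × (0,T)`. -/
def charRegion (k T : ℝ) : Set (ℝ × ℝ) :=
  {p | p.2 < p.1 ∧ (1 - k) * p.1 < (1 + k) * p.2 ∧ p.1 + p.2 < 2 * (1 + k * T)}

theorem isOpen_charRegion (k T : ℝ) : IsOpen (charRegion k T) :=
  (isOpen_lt continuous_snd continuous_fst).inter
    ((isOpen_lt (continuous_const.mul continuous_fst) (continuous_const.mul continuous_snd)).inter
      (isOpen_lt (continuous_fst.add continuous_snd) continuous_const))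

/-- Products of bumps on small squares are, up to a constant factor and the weight α, images of test
functions, so the pairing kills them. Uniform approximation of g by sums of such products gives the
rest. -/
theorem charPairing_eq_zero {k T : ℝ} (hk : 0 < k) (hk1 : k < 1) (hT : 0 < T) {z : ℝ → L2Omega}
    (hz : ContinuousOn z (Icc 0 T))
    (h : ∀ θ : AdjointTest T,
      ∫ t in Ioo 0 T, ∫ y in Ioo (0 : ℝ) 1, z t y * adjointOp k θ.toFun y t = 0)
    (g : C(ℝ × ℝ, ℝ)) (hgs : HasCompactSupport g) (hgU : tsupport g ⊆ charRegion k T) :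
    charPairing k hz g = 0 := by
  obtain ⟨C, hC, hbound⟩ := exists_abs_charPairing_le hk hT hz
  let H : ℝ → ℝ × ℝ → C(ℝ × ℝ, ℝ) := fun r p =>
    ⟨fun x => hat ((x.1 - p.1) / r) * hat ((x.2 - p.2) / r), by
      have := hat_contDiff.continuous
      fun_prop⟩
  have hH : ∀ r > 0, ∀ p : ℝ × ℝ,
      Icc (p.1 - r) (p.1 + r) ×ˢ Icc (p.2 - r) (p.2 + r) ⊆ charRegion k T →
      charPairing k hz (H r p) = 0 := by
    intro r hr p hp
    have hs : ∀ c : ℝ, ContDiff ℝ ∞ fun x => hat ((x - c) / r) := fun c =>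
      hat_contDiff.comp ((contDiff_id.sub contDiff_const).div_const r)
    have h0 : ∀ c x : ℝ, x ∉ Ioo (c - r) (c + r) → hat ((x - c) / r) = 0 := by
      intro c x hx
      refine hat_eq_zero fun h => hx ?_
      have h1 := (lt_div_iff₀ hr).1 h.1
      have h2 := (div_lt_iff₀ hr).1 h.2
      exact ⟨by linarith, by linarith⟩
    -- Each of the three inequalities defining the region is tightest at one corner of the square.
    -- These three corners supply what `exists_test` requires.
    have c1 := (hp (mk_mem_prod (a := p.1 - r) (b := p.2 + r)
      ⟨le_rfl, by linarith⟩ ⟨by linarith, le_rfl⟩)).1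
    have c2 := (hp (mk_mem_prod (a := p.1 + r) (b := p.2 - r)
      ⟨by linarith, le_rfl⟩ ⟨le_rfl, by linarith⟩)).2.1
    have c3 := (hp (mk_mem_prod (a := p.1 + r) (b := p.2 + r)
      ⟨by linarith, le_rfl⟩ ⟨by linarith, le_rfl⟩)).2.2
    obtain ⟨θ, hθ⟩ := exists_test hk hk1 hT (hs p.1) (hs p.2) (h0 p.1) (h0 p.2) (by linarith)
      (by linarith) c1.le c2.le c3
    have e : (4 * k ^ 2) * charPairing k hz (H r p) = 0 := by
      rw [← h θ]
      change 4 * k ^ 2 * (∫ t in Ioo 0 T, ∫ y in Ioo (0 : ℝ) 1,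
        z t y * charWeight k (H r p) y t) = _
      rw [← integral_const_mul]
      refine setIntegral_congr_fun measurableSet_Ioo fun t ht => ?_
      rw [← integral_const_mul]
      refine setIntegral_congr_fun measurableSet_Ioo fun y hy => ?_
      rw [hθ y hy t ht]
      simp only [charWeight, H, ContinuousMap.coe_mk]
      ring
    exact (mul_eq_zero.1 e).resolve_left (by positivity)
  by_contra hne
  have hpos := abs_pos.2 hne
  obtain ⟨r, hr, s, hs, happ⟩ := exists_approx g.continuous hgs (isOpen_charRegion k T) hgU
    (ε := |charPairing k hz g| / (2 * (C + 1))) (by positivity)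
  have h1 := hbound (g - ∑ p ∈ s, g p • H r p) (|charPairing k hz g| / (2 * (C + 1)))
    (by positivity) fun x => by
    simpa [H, ContinuousMap.sum_apply] using happ x
  rw [map_sub, map_sum, Finset.sum_eq_zero fun p hp => by
    rw [map_smul, hH r hr p (hs p hp), smul_zero], sub_zero] at h1
  have h2 : C * (|charPairing k hz g| / (2 * (C + 1))) < |charPairing k hz g| := by
    rw [mul_div_assoc', div_lt_iff₀ (by positivity)]
    nlinarith
  linarith

/-- A curve orthogonal to the images of all the test functions vanishes. -/
theorem eq_zero_of_transposition {k T : ℝ} (hk : 0 < k) (hk1 : k < 1) (hT : 0 < T)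
    {z : ℝ → L2Omega} (hz : ContinuousOn z (Icc 0 T))
    (h : ∀ θ : AdjointTest T,
      ∫ t in Ioo 0 T, ∫ y in Ioo (0 : ℝ) 1, z t y * adjointOp k θ.toFun y t = 0) :
    ∀ t ∈ Icc 0 T, z t = 0 := by
  have key : ∀ φ ψ : ℝ → ℝ, Continuous φ → Continuous ψ → HasCompactSupport φ →
      HasCompactSupport ψ → tsupport φ ⊆ Ioo 0 T → tsupport ψ ⊆ Ioo 0 1 →
      ∫ t in Ioo 0 T, φ t * (alpha k t * ∫ y in Ioo (0 : ℝ) 1, z t y * ψ y) = 0 := by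
    intro φ ψ hφ hψ hφc hψc hφs hψs
    -- This is φ(t)ψ(y) in characteristic coordinates: (ξ + η)/2 = α and (ξ - η)/(2kα) = y. The
    -- maximum with 1 keeps the denominator nonzero on the whole plane and changes nothing where φ ≠
    -- 0, since α ≥ 1 there.
    let g : C(ℝ × ℝ, ℝ) := ⟨fun p => φ (((p.1 + p.2) / 2 - 1) / k) *
      ψ ((p.1 - p.2) / (2 * k * max ((p.1 + p.2) / 2) 1)), by
        refine (hφ.comp (by fun_prop)).mul (hψ.comp (Continuous.div (by fun_prop) (by fun_prop)
          fun p => ?_))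
        have : (0 : ℝ) < max ((p.1 + p.2) / 2) 1 := lt_max_of_lt_right one_pos
        positivity⟩
    have hgval : ∀ t ∈ Ioo 0 T, ∀ y,
        g (alpha k t * (1 + k * y), alpha k t * (1 - k * y)) = φ t * ψ y := by
      intro t ht y
      have hα := one_le_alpha hk ht.1.le
      have e1 : (alpha k t * (1 + k * y) + alpha k t * (1 - k * y)) / 2 = alpha k t := by ring
      have e2 : (alpha k t - 1) / k = t := by unfold alpha; field_simp; ring
      have e3 : (alpha k t * (1 + k * y) - alpha k t * (1 - k * y)) / (2 * k * alpha k t) = y := by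
        have : alpha k t ≠ 0 := by linarith
        field_simp; ring
      simp only [g, ContinuousMap.coe_mk, e1, max_eq_left hα, e2, e3]
    let Ψ : ℝ × ℝ → ℝ × ℝ := fun q => (alpha k q.1 * (1 + k * q.2), alpha k q.1 * (1 - k * q.2))
    have hΨ : Continuous Ψ := by
      simp only [Ψ, alpha]
      fun_prop
    have hK : IsCompact (Ψ '' (tsupport φ ×ˢ tsupport ψ)) :=
      (hφc.isCompact.prod hψc.isCompact).image hΨ
    have hsub : Function.support g ⊆ Ψ '' (tsupport φ ×ˢ tsupport ψ) := by
      intro p hp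
      have h1 := subset_tsupport _ (left_ne_zero_of_mul hp : _ ≠ (0 : ℝ))
      have h2 := subset_tsupport _ (right_ne_zero_of_mul hp : _ ≠ (0 : ℝ))
      refine ⟨(_, _), mk_mem_prod h1 h2, ?_⟩
      have ht := hφs h1
      have hs : 1 < (p.1 + p.2) / 2 := by
        have := (lt_div_iff₀ hk).1 ht.1
        linarith
      have e : alpha k (((p.1 + p.2) / 2 - 1) / k) = (p.1 + p.2) / 2 := by
        unfold alpha; field_simp; ring
      simp only [Ψ, e, max_eq_left hs.le]
      have hs' : p.1 + p.2 ≠ 0 := by intro h0; rw [h0] at hs; norm_num at hs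
      refine Prod.ext ?_ ?_ <;> dsimp only <;> field_simp <;> ring
    have hts : tsupport g ⊆ Ψ '' (tsupport φ ×ˢ tsupport ψ) :=
      closure_minimal hsub hK.isClosed
    have h0 := charPairing_eq_zero hk hk1 hT hz h g
      (hK.of_isClosed_subset (isClosed_tsupport _) hts) (hts.trans ?_)
    · refine Eq.trans ?_ h0
      refine setIntegral_congr_fun measurableSet_Ioo fun t ht => ?_
      rw [← integral_const_mul, ← integral_const_mul]
      refine setIntegral_congr_fun measurableSet_Ioo fun y _ => ?_
      simp only [charWeight, hgval t ht]
      ring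
    · rintro _ ⟨⟨t, y⟩, ⟨ht, hy⟩, rfl⟩
      replace ht := hφs ht
      replace hy := hψs hy
      have hα := one_le_alpha hk ht.1.le
      have hα0 : 0 < alpha k t := by linarith
      have hky : 0 < k * y := mul_pos hk hy.1
      have hky' : 0 < k * (1 - y) := mul_pos hk (by linarith [hy.2])
      refine ⟨?_, ?_, ?_⟩
      · exact mul_lt_mul_of_pos_left (by linarith) hα0
      · simp only [Ψ]
        nlinarith [mul_pos hα0 hky']
      · simp only [Ψ, alpha]
        nlinarith [mul_lt_mul_of_pos_left ht.2 hk]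
  -- First φ varies, which gives vanishing for almost every t and, by continuity, for each t in
  -- (0,T). Then ψ varies at fixed t.
  have hIoo : ∀ t ∈ Ioo 0 T, z t = 0 := by
    have hψ0 : ∀ ψ : ℝ → ℝ, Continuous ψ → HasCompactSupport ψ → tsupport ψ ⊆ Ioo 0 1 →
        ∀ t ∈ Ioo 0 T, ∫ y in Ioo (0 : ℝ) 1, z t y * ψ y = 0 := by
      intro ψ hψ hψc hψs
      have hcont : ContinuousOn (fun t => alpha k t * ∫ y in Ioo (0 : ℝ) 1, z t y * ψ y)
          (Icc 0 T) :=
        ContinuousOn.mul (by unfold alpha; fun_prop)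
          (continuousOn_integral_mul (G := fun y _ => ψ y) hz
            (hψ.comp continuous_fst).continuousOn)
      have hcont' := hcont.mono Ioo_subset_Icc_self
      have hae := isOpen_Ioo.ae_eq_zero_of_integral_contDiff_smul_eq_zero
        (hcont'.locallyIntegrableOn measurableSet_Ioo)
        (μ := volume) fun φ hφ hφc hφs => by
          refine Eq.trans (Eq.symm ?_) (key φ ψ hφ.continuous hψ hφc hψc hφs hψs)
          refine setIntegral_eq_integral_of_forall_compl_eq_zero fun t ht => ?_
          rw [image_eq_zero_of_notMem_tsupport fun h' => ht (hφs h'), zero_mul]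
      have hE := Measure.eqOn_open_of_ae_eq (μ := volume)
        ((ae_restrict_iff' measurableSet_Ioo).2 hae) isOpen_Ioo hcont' continuousOn_const
      intro t ht
      have hα := one_le_alpha hk ht.1.le
      exact (mul_eq_zero.1 (hE ht)).resolve_left (by linarith)
    intro t ht
    have hint : IntegrableOn (z t) (Ioo 0 1) :=
      (Lp.memLp (z t)).integrable one_le_two
    have hae := isOpen_Ioo.ae_eq_zero_of_integral_contDiff_smul_eq_zero
      hint.locallyIntegrableOn fun ψ hψ hψc hψs => by
        refine Eq.trans ?_ (hψ0 ψ hψ.continuous hψc hψs t ht)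
        rw [setIntegral_eq_integral_of_forall_compl_eq_zero fun y hy => by
          rw [image_eq_zero_of_notMem_tsupport fun h' => hy (hψs h'), mul_zero]]
        simp only [smul_eq_mul, mul_comm]
    refine (Lp.eq_zero_iff_ae_eq_zero).2 ((ae_restrict_iff' measurableSet_Ioo).2 hae)
  intro t ht
  have hcl : closure (Ioo 0 T) = Icc 0 T := closure_Ioo hT.ne
  exact (EqOn.of_subset_closure (f := z) (g := fun _ => 0) hIoo hz continuousOn_const
    Ioo_subset_Icc_self hcl.ge) ht

/-- The right side of the transposition formula does not involve v, so the difference of two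
solutions is orthogonal to all images of test functions. The velocities agree because derivatives
within [0,T] are unique. -/
theorem IsSolution.unique {k T : ℝ} (hk : 0 < k) (hk1 : k < 1) {hT : 0 < T} {v₀ : L2Omega}
    {v₁ : Hm1} {w : L2 (Ioo 0 T)} {v z : ℝ → L2Omega} {vt zt : ℝ → Hm1}
    (hv : IsSolution k hT v₀ v₁ w v vt) (hz : IsSolution k hT v₀ v₁ w z zt) :
    EqOn z v (Icc 0 T) ∧ EqOn zt vt (Icc 0 T) := by
  have hzv : EqOn z v (Icc 0 T) := by
    intro t ht
    refine sub_eq_zero.1 (eq_zero_of_transposition hk hk1 hT (z := fun t => z t - v t)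
      (hz.continuousOn.sub hv.continuousOn) (fun θ => ?_) t ht)
    have hc := continuousOn_of_rect (F := adjointOp k θ.toFun) fun y hy t ht =>
      SmoothAt.continuousAt_adjointOp (zero_lt_one.trans_le (one_le_alpha hk ht.1)).ne'
        (θ.smooth y hy t ht)
    have hc' : ∀ t ∈ Ioo 0 T, ContinuousOn (fun y => adjointOp k θ.toFun y t) (Icc 0 1) :=
      fun t ht => hc.comp (f := fun y : ℝ => (y, t))
        (continuous_id.prodMk continuous_const).continuousOn
        fun y hy => ⟨hy, Ioo_subset_Icc_self ht⟩
    have e := (hz.transposition θ).trans (hv.transposition θ).symm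
    rw [setIntegral_congr_fun measurableSet_Ioo fun t ht => integral_sub_mul (hc' t ht),
      integral_sub (integrableOn_integral_mul hz.continuousOn hc)
        (integrableOn_integral_mul hv.continuousOn hc)]
    exact sub_eq_zero.2 e
  refine ⟨hzv, fun t ht => ?_⟩
  have h1 : HasDerivWithinAt (fun s => toHm1 (v s)) (zt t) (Icc 0 T) t :=
    (hz.hasDeriv t ht).congr (fun s hs => congrArg toHm1 (hzv hs).symm)
      (congrArg toHm1 (hzv ht).symm)
  exact (uniqueDiffOn_Icc hT t ht).eq_deriv _ h1 (hv.hasDeriv t ht)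

/-! ### Minimization of a regularized quadratic functional -/

section Quadratic

variable {H E : Type*} [NormedAddCommGroup H] [InnerProductSpace ℝ H] [CompleteSpace H]
  [NormedAddCommGroup E] [InnerProductSpace ℝ E] [CompleteSpace E]

/-- K*K + σ is coercive, with constant σ, so Lax–Milgram applies. -/
theorem exists_adjoint_equation (K : H →L[ℝ] E) {σ : ℝ} (hσ : 0 < σ) (c : E) :
    ∃ w, K.adjoint (c + K w) + σ • w = 0 := by
  let B : H →L[ℝ] H →L[ℝ] ℝ := (innerSL ℝ).comp (K.adjoint.comp K + σ • ContinuousLinearMap.id ℝ H)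
  have hB : ∀ u v, B u v = inner ℝ (K.adjoint (K u) + σ • u) v := fun _ _ => rfl
  have hco : IsCoercive B := ⟨σ, hσ, fun u => by
    rw [hB, inner_add_left, ContinuousLinearMap.adjoint_inner_left, real_inner_smul_left,
      real_inner_self_eq_norm_mul_norm, real_inner_self_eq_norm_mul_norm]
    nlinarith [mul_self_nonneg ‖K u‖]⟩
  refine ⟨hco.continuousLinearEquivOfBilin.symm (-K.adjoint c), ?_⟩
  set w := hco.continuousLinearEquivOfBilin.symm (-K.adjoint c) with hw
  have h1 : hco.continuousLinearEquivOfBilin w = K.adjoint (K w) + σ • w :=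
    ext_inner_right ℝ fun v => by rw [hco.continuousLinearEquivOfBilin_apply, hB]
  rw [hw, ContinuousLinearEquiv.apply_symm_apply, ← hw] at h1
  rw [map_add, add_assoc, ← h1, add_neg_cancel]

/-- Completion of the square at a critical point: the equation is what cancels the cross terms. -/
theorem quadratic_eq (K : H →L[ℝ] E) {σ : ℝ} {c : E} {w : H}
    (h : K.adjoint (c + K w) + σ • w = 0) (u : H) :
    1 / 2 * ‖c + K u‖ ^ 2 + σ / 2 * ‖u‖ ^ 2 =
      (1 / 2 * ‖c + K w‖ ^ 2 + σ / 2 * ‖w‖ ^ 2) +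
        (1 / 2 * ‖K (u - w)‖ ^ 2 + σ / 2 * ‖u - w‖ ^ 2) := by
  have e1 : c + K u = (c + K w) + K (u - w) := by rw [map_sub]; abel
  have e2 : ‖u‖ ^ 2 = ‖w + (u - w)‖ ^ 2 := by rw [add_sub_cancel]
  have e3 : inner ℝ (c + K w) (K (u - w)) + σ * inner ℝ w (u - w) = 0 := by
    rw [← ContinuousLinearMap.adjoint_inner_left, ← real_inner_smul_left, ← inner_add_left, h,
      inner_zero_left]
  rw [e1, e2, norm_add_sq_real, norm_add_sq_real w]
  linear_combination e3

/-- A minimizer is compared with the solution of the equation, which exists already. The excess in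
`quadratic_eq` forces the two to coincide, so no differentiation of the functional is needed. -/
theorem isMinimizer_iff (K : H →L[ℝ] E) {σ : ℝ} (hσ : 0 < σ) (c : E) (w : H) :
    (∀ u, 1 / 2 * ‖c + K w‖ ^ 2 + σ / 2 * ‖w‖ ^ 2 ≤ 1 / 2 * ‖c + K u‖ ^ 2 + σ / 2 * ‖u‖ ^ 2) ↔
      K.adjoint (c + K w) + σ • w = 0 := by
  refine ⟨fun h => ?_, fun h u => ?_⟩
  · obtain ⟨w', hw'⟩ := exists_adjoint_equation K hσ c
    have h1 := h w'
    rw [quadratic_eq K hw' w] at h1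
    have h2 : ‖w - w'‖ ^ 2 = 0 := by
      have h3 : σ / 2 * ‖w - w'‖ ^ 2 ≤ 0 := by nlinarith [sq_nonneg ‖K (w - w')‖]
      refine le_antisymm ?_ (sq_nonneg _)
      exact nonpos_of_mul_nonpos_right h3 (half_pos hσ)
    have h4 : w = w' := sub_eq_zero.1 (norm_eq_zero.1 (pow_eq_zero_iff two_ne_zero |>.1 h2))
    rwa [h4]
  · rw [quadratic_eq K h u]
    have := half_pos hσ
    exact le_add_of_nonneg_right (by positivity)

theorem adjoint_equation_unique (K : H →L[ℝ] E) {σ : ℝ} (hσ : 0 < σ) {c : E} {w w' : H}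
    (h : K.adjoint (c + K w) + σ • w = 0) (h' : K.adjoint (c + K w') + σ • w' = 0) : w = w' := by
  have h1 := (isMinimizer_iff K hσ c w).2 h w'
  rw [quadratic_eq K h w'] at h1
  have h2 := (isMinimizer_iff K hσ c w').2 h' w
  rw [quadratic_eq K h w'] at h2
  have h3 : ‖w' - w‖ ^ 2 = 0 := by
    refine le_antisymm (nonpos_of_mul_nonpos_right (?_ : σ / 2 * ‖w' - w‖ ^ 2 ≤ 0) (half_pos hσ))
      (sq_nonneg _)
    nlinarith [sq_nonneg ‖K (w' - w)‖]
  exact (sub_eq_zero.1 (norm_eq_zero.1 (pow_eq_zero_iff two_ne_zero |>.1 h3))).symm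

end Quadratic

/-! ### The Nash equilibrium -/

variable {k σ T : ℝ}

/-- Multiplication by `√α_k(t)` on `L²((0,1) × (0,T))`. -/
def sqrtAlphaMul (k T : ℝ) :
    L2 (Ioo (0 : ℝ) 1 ×ˢ Ioo 0 T) →L[ℝ] L2 (Ioo (0 : ℝ) 1 ×ˢ Ioo 0 T) :=
  wcomp (fun p => √(alpha k p.2)) id (volume.restrict (Ioo (0 : ℝ) 1 ×ˢ Ioo 0 T))
    (volume.restrict (Ioo (0 : ℝ) 1 ×ˢ Ioo 0 T))

theorem coeFn_sqrtAlphaMul (hk : 0 < k) (F : L2 (Ioo (0 : ℝ) 1 ×ˢ Ioo 0 T)) :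
    sqrtAlphaMul k T F =ᵐ[volume.restrict (Ioo (0 : ℝ) 1 ×ˢ Ioo 0 T)]
      fun p => √(alpha k p.2) * F p := by
  refine (WBdd.mul (C := ‖√(alpha k T)‖₊) (by unfold alpha; fun_prop) ?_).coeFn_wcomp F
  filter_upwards [ae_restrict_mem (measurableSet_Ioo.prod measurableSet_Ioo)] with p hp
  rw [← NNReal.coe_le_coe, coe_nnnorm, coe_nnnorm, Real.norm_of_nonneg (Real.sqrt_nonneg _),
    Real.norm_of_nonneg (Real.sqrt_nonneg _)]
  refine Real.sqrt_le_sqrt ?_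
  unfold alpha
  nlinarith [hp.2.2]

/-- The factor √α absorbs the weight of the cost, so that the cost becomes a sum of squared Hilbert
norms. -/
theorem cost_slice (hk : 0 < k) (v₂ : L2 (Ioo (0 : ℝ) 1 ×ˢ Ioo 0 T)) (P Q : L2R)
    (u : L2 (Ioo 0 T)) :
    cost k σ v₂ (fun t => slice k 1 t P + slice k (-1) t Q) u =
      1 / 2 * ‖sqrtAlphaMul k T (wave k 1 T P + wave k (-1) T Q - v₂)‖ ^ 2 + σ / 2 * ‖u‖ ^ 2 := by
  have he : (1 : ℝ) ^ 2 = 1 := by norm_num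
  have he' : (-1 : ℝ) ^ 2 = 1 := by norm_num
  set F := wave k 1 T P + wave k (-1) T Q - v₂ with hF
  let f : ℝ × ℝ → ℝ := fun p => alpha k p.2 * (P (alpha k p.2 * (1 + 1 * k * p.1)) +
    Q (alpha k p.2 * (1 + -1 * k * p.1)) - v₂ (p.1, p.2)) ^ 2
  have hae : (fun p => sqrtAlphaMul k T F p * sqrtAlphaMul k T F p)
      =ᵐ[volume.restrict (Ioo (0 : ℝ) 1 ×ˢ Ioo 0 T)] f := by
    filter_upwards [coeFn_sqrtAlphaMul hk F, coeFn_wave hk he P, coeFn_wave hk he' Q,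
      Lp.coeFn_sub (wave k 1 T P + wave k (-1) T Q) v₂,
      Lp.coeFn_add (wave k 1 T P) (wave k (-1) T Q),
      ae_restrict_mem (measurableSet_Ioo.prod measurableSet_Ioo)] with p h1 h2 h3 h4 h5 h6
    have hα := one_le_alpha hk h6.2.1.le
    rw [h1, hF, h4, Pi.sub_apply, h5, Pi.add_apply, h2, h3, mul_mul_mul_comm,
      Real.mul_self_sqrt (by linarith), ← sq]
  have hm : (volume.restrict (Ioo (0 : ℝ) 1 ×ˢ Ioo 0 T) : Measure (ℝ × ℝ)) =
      (volume.restrict (Ioo (0 : ℝ) 1)).prod (volume.restrict (Ioo 0 T)) := by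
    rw [Measure.prod_restrict, Measure.volume_eq_prod]
  have hint : Integrable f ((volume.restrict (Ioo (0 : ℝ) 1)).prod (volume.restrict (Ioo 0 T))) := by
    rw [← hm]
    exact (L2.integrable_inner (𝕜 := ℝ) (sqrtAlphaMul k T F) (sqrtAlphaMul k T F)).congr hae
  have hn : ‖sqrtAlphaMul k T F‖ ^ 2 = ∫ t in Ioo 0 T, ∫ y in Ioo (0 : ℝ) 1, f (y, t) := by
    rw [← real_inner_self_eq_norm_sq, inner_eq_integral, integral_congr_ae hae, hm,
      integral_prod_symm _ hint]
  unfold cost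
  rw [hn, ← real_inner_self_eq_norm_sq, inner_eq_integral]
  simp only [sq (u _)]
  congr 2
  refine setIntegral_congr_fun measurableSet_Ioo fun t ht => integral_congr_ae ?_
  filter_upwards [coeFn_slice hk he ht.1.le P .rfl, coeFn_slice hk he' ht.1.le Q .rfl,
    Lp.coeFn_add (slice k 1 t P) (slice k (-1) t Q)] with y h1 h2 h3
  simp only [f]
  rw [h3, Pi.add_apply, h1, h2]

theorem cost_congr (v₂ : L2 (Ioo (0 : ℝ) 1 ×ˢ Ioo 0 T)) {v z : ℝ → L2Omega}
    (h : EqOn z v (Icc 0 T)) (u : L2 (Ioo 0 T)) : cost k σ v₂ z u = cost k σ v₂ v u := by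
  unfold cost
  congr 2
  exact setIntegral_congr_fun measurableSet_Ioo fun t ht => by
    rw [h (Ioo_subset_Icc_self ht)]

/-! ### The cost as a quadratic functional, the equilibrium equation and exact control -/

/-- The profiles are linear in (p, q, w), so the weighted state is affine in w: c collects the
initial data and the target v₂, and K is the response to the control. Uniqueness extends the formula
from the d'Alembert solution to every solution. -/
theorem exists_solution_and_cost (hk : 0 < k) (hk1 : k < 1) (hT : 0 < T) (v₀ : L2Omega) (v₁ : Hm1)
    (v₂ : L2 (Ioo (0 : ℝ) 1 ×ˢ Ioo 0 T)) :
    (∀ w, ∃ v vt, IsSolution k hT v₀ v₁ w v vt) ∧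
    ∃ (K : L2 (Ioo 0 T) →L[ℝ] L2 (Ioo (0 : ℝ) 1 ×ˢ Ioo 0 T)) (c : L2 (Ioo (0 : ℝ) 1 ×ˢ Ioo 0 T)),
      ∀ w u v vt, IsSolution k hT v₀ v₁ w v vt →
        cost k σ v₂ v u = 1 / 2 * ‖c + K w‖ ^ 2 + σ / 2 * ‖u‖ ^ 2 := by
  obtain ⟨p, q, hpq, hvel⟩ := exists_state_profiles (k := k) one_ne_zero v₀ v₁
  rw [one_smul, one_smul] at hvel
  obtain ⟨P, Q, hPQ⟩ := exists_profiles (T := T) hk hk1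
  have hsol : ∀ w, IsSolution k hT v₀ v₁ w
      (fun t => slice k 1 t (P (p, q, w)) + slice k (-1) t (Q (p, q, w)))
      (fun t => sliceDeriv k 1 t (P (p, q, w)) + sliceDeriv k (-1) t (Q (p, q, w))) := fun w => by
    obtain ⟨h1, h2, h3, h4⟩ := hPQ p q w
    have := isSolution_of_profiles hk hk1 hT _ _ h4
    rwa [h1, h2, h3, hpq, hvel] at this
  refine ⟨fun w => ⟨_, _, hsol w⟩, ?_⟩
  let S : (L2Omega × L2Omega × L2 (Ioo 0 T)) →L[ℝ] L2 (Ioo (0 : ℝ) 1 ×ˢ Ioo 0 T) :=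
    (wave k 1 T).comp P + (wave k (-1) T).comp Q
  refine ⟨(sqrtAlphaMul k T).comp (S.comp ((ContinuousLinearMap.inr ℝ _ _).comp
    (ContinuousLinearMap.inr ℝ _ _))), sqrtAlphaMul k T (S (p, q, 0) - v₂), fun w u v vt hv => ?_⟩
  rw [cost_congr v₂ ((hsol w).unique hk hk1 hv).1, cost_slice hk]
  congr 4
  have e : (p, q, w) = (p, q, (0 : L2 (Ioo 0 T))) + ((0 : L2Omega), (0 : L2Omega), w) := by simp
  change sqrtAlphaMul k T (S (p, q, w) - v₂) = sqrtAlphaMul k T (S (p, q, 0) - v₂) +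
    sqrtAlphaMul k T (S (0, 0, w))
  rw [e, S.map_add, ← (sqrtAlphaMul k T).map_add, add_sub_right_comm]

/-- K w₁ joins the constant c, and the minimality in w₂ becomes the Euler equation of a quadratic
functional. -/
theorem exists_isNash_iff (hk : 0 < k) (hk1 : k < 1) (hσ : 0 < σ) (hT : 0 < T) (v₀ : L2Omega)
    (v₁ : Hm1) (v₂ : L2 (Ioo (0 : ℝ) 1 ×ˢ Ioo 0 T)) :
    ∃ (K : L2 (Ioo 0 T) →L[ℝ] L2 (Ioo (0 : ℝ) 1 ×ˢ Ioo 0 T)) (c : L2 (Ioo (0 : ℝ) 1 ×ˢ Ioo 0 T)),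
      ∀ w₁ w₂, IsNash k σ hT v₀ v₁ v₂ w₁ w₂ ↔ K.adjoint (c + K w₁ + K w₂) + σ • w₂ = 0 := by
  obtain ⟨hex, K, c, hK⟩ := exists_solution_and_cost (σ := σ) hk hk1 hT v₀ v₁ v₂
  refine ⟨K, c, fun w₁ w₂ => ?_⟩
  rw [← isMinimizer_iff K hσ]
  simp only [add_assoc, ← map_add]
  constructor
  · rintro ⟨v, vt, hv, h⟩ u
    obtain ⟨z, zt, hz⟩ := hex (w₁ + u)
    have := h u z zt hz
    rwa [hK _ _ _ _ hv, hK _ _ _ _ hz] at this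
  · intro h
    obtain ⟨v, vt, hv⟩ := hex (w₁ + w₂)
    refine ⟨v, vt, hv, fun u z zt hz => ?_⟩
    rw [hK _ _ _ _ hv, hK _ _ _ _ hz]
    exact h u

/-- Profiles are built to match both states, and the control is whatever trace they have at y = 0.
-/
theorem exists_control (hk : 0 < k) (hk1 : k < 1) (hT₀ : 0 < T) (hT : 2 / (1 - k) < T)
    (v₀ : L2Omega) (v₁ : Hm1) (z₀ : L2Omega) (z₁ : Hm1) :
    ∃ w v vt, IsSolution k hT₀ v₀ v₁ w v vt ∧ v T = z₀ ∧ vt T = z₁ := by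
  have hα : alpha k T ≠ 0 := (zero_lt_one.trans_le (one_le_alpha hk hT₀.le)).ne'
  obtain ⟨p, q, hpq, hvel⟩ := exists_state_profiles (k := k) one_ne_zero v₀ v₁
  rw [one_smul, one_smul] at hvel
  -- The factor α(T)⁻¹ is the one in `sliceDeriv` at time T; at time 0 it equals 1.
  obtain ⟨p', q', hpq', hvel'⟩ := exists_state_profiles (k := k) (inv_ne_zero hα) z₀ z₁
  obtain ⟨P, Q, h1, h2, h3, h4, h5⟩ := exists_profiles_joining hk hk1 hT p q p' q'
  have := isSolution_of_profiles hk hk1 hT₀ _ _ h5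
  rw [h1, h2, hpq, hvel] at this
  refine ⟨_, _, _, this, ?_, ?_⟩
  · rw [h3, h4, hpq']
  · rw [sliceDeriv, sliceDeriv, h3, h4, hvel']

end

end MovingWave

theorem mainTheorem2 (k σ T : ℝ) (hk₀ : 0 < k) (hk₁ : k < 1 - 1 / Real.sqrt (Real.exp 1))
    (hσ : 0 < σ) (hT₀ : 0 < T) (hT : 2 / (1 - k) < T)
    (v₀ : MovingWave.L2Omega) (v₁ : MovingWave.Hm1)
    (v₂ : MovingWave.L2 (Set.Ioo (0 : ℝ) 1 ×ˢ Set.Ioo 0 T)) :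
    (∀ w : MovingWave.L2 (Set.Ioo 0 T),
      ∃ (v : ℝ → MovingWave.L2Omega) (vt : ℝ → MovingWave.Hm1),
        MovingWave.IsSolution k hT₀ v₀ v₁ w v vt ∧
        ∀ (z : ℝ → MovingWave.L2Omega) (zt : ℝ → MovingWave.Hm1),
          MovingWave.IsSolution k hT₀ v₀ v₁ w z zt →
            Set.EqOn z v (Set.Icc 0 T) ∧ Set.EqOn zt vt (Set.Icc 0 T)) ∧
    (∀ w₁ : MovingWave.L2 (Set.Ioo 0 T), ∃! w₂ : MovingWave.L2 (Set.Ioo 0 T),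
      MovingWave.IsNash k σ hT₀ v₀ v₁ v₂ w₁ w₂) ∧
    Dense {p : MovingWave.L2Omega × MovingWave.Hm1 |
      ∃ (w₁ w₂ : MovingWave.L2 (Set.Ioo 0 T))
        (v : ℝ → MovingWave.L2Omega) (vt : ℝ → MovingWave.Hm1),
        MovingWave.IsNash k σ hT₀ v₀ v₁ v₂ w₁ w₂ ∧
        MovingWave.IsSolution k hT₀ v₀ v₁ (w₁ + w₂) v vt ∧ p = (v T, vt T)} := by
  have hk1 : k < 1 := hk₁.trans (sub_lt_self 1 (by positivity))
  obtain ⟨K, c, hN⟩ := MovingWave.exists_isNash_iff hk₀ hk1 hσ hT₀ v₀ v₁ v₂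
  refine ⟨fun w => ?_, fun w₁ => ?_, fun x => subset_closure ?_⟩
  · obtain ⟨v, vt, hv⟩ := (MovingWave.exists_solution_and_cost (σ := σ) hk₀ hk1 hT₀ v₀ v₁ v₂).1 w
    exact ⟨v, vt, hv, fun z zt hz => hv.unique hk₀ hk1 hz⟩
  · obtain ⟨w₂, hw₂⟩ := MovingWave.exists_adjoint_equation K hσ (c + K w₁)
    exact ⟨w₂, (hN _ _).2 hw₂, fun u hu =>
      MovingWave.adjoint_equation_unique K hσ ((hN _ _).1 hu) hw₂⟩
  · obtain ⟨w, v, vt, hv, h0, h1⟩ := MovingWave.exists_control hk₀ hk1 hT₀ hT v₀ v₁ x.1 x.2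
    -- The equilibrium equation solved for w₂ with the total control w held fixed. The leader then
    -- plays w - w₂, so every state is attained exactly.
    let w₂ := -(σ⁻¹ • K.adjoint (c + K w))
    refine ⟨w - w₂, w₂, v, vt, (hN _ _).2 ?_, by rwa [sub_add_cancel], by rw [h0, h1]⟩
    rw [add_assoc, ← map_add, sub_add_cancel, smul_neg, smul_inv_smul₀ hσ.ne', add_neg_cancel]
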